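/- Let $(B,\Pi)$ be a regular twisted Poisson manifold (a smooth manifold with a smooth bivector field $\Pi$ of constant rank such that, for some closed 3-form $\eta_0$ and all smooth $f,g,h$, $\{\{f,g\},h\}+\{\{g,h\},f\}+\{\{h,f\},g\}+\eta_0(X_f,X_g,X_h)=0$, where $\{f,g\}=\Pi(df,dg)$ and $X_f=-\Pi^\sharp(df)$). Let $\mathcal F$ be its foliation, with tangent distribution $\Pi^\sharp(T^*B)$, whose leaves carry the almost symplectic forms $(X_f,X_g)\mapsto\{f,g\}$, and let $\nu^*\mathcal F\subset T^*B$ be the covectors vanishing on the leaves. Let $\Theta$ be a characteristic form, i.e. a smooth 2-form on $B$ restricting to the almost symplectic form of each leaf. An ASCIR (almost symplectically complete isotropic realization) over $(B,\Pi)$ is a smooth manifold $M$ with a nondegenerate smooth 2-form $\omega$ and a smooth surjective submersion $\pi:M\to B$ with compact, connected, isotropic fibres which is an almost Poisson map and satisfies $d\omega=\pi^*\eta$ for a closed 3-form $\eta$ on $B$ (the twisting form). For a 1-form $\alpha$ vanishing on the leaves let $\varphi(\alpha)$ be the time-one flow of the vertical vector field $X$ with $\iota_X\omega=\pi^*\alpha$;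 on each fibre $\pi^{-1}(b)$ this depends only on $\alpha_b\in\nu^*_b\mathcal F$. The period bundle $P$ of $M$ has as fibre $P_b$ the set of all $\alpha\in\nu^*_b\mathcal F$ with $\varphi(\alpha)=\mathrm{id}$ on $\pi^{-1}(b)$. Let $(M,\omega)\in \mathrm{ASCIR}_0(B,\Pi,P,\Theta)$, i.e. $M$ is an ASCIR over $(B,\Pi)$ with period bundle $P$ and twisting form $d\Theta$. Define sheaves on $B$: $\Omega^0_{\mathcal F}$ is the sheaf of smooth functions constant on the leaves (over an open $U$: constant on the leaves of $\mathcal F|_U$); $\mathcal Z^1_{\mathcal F}$ is the sheaf of closed 1-forms vanishing on the leaves; $\mathcal P$ is the sheaf of smooth (equivalently, locally constant) sections of $P$; $\mathcal O_P(U)=\{f\in C^\infty(U): df\in\mathcal P(U)\}$; and $\mathcal{A}ut(U)$ is the group of diffeomorphisms $f$ of $\pi^{-1}(U)$ with $\pi\circ f=\pi$ and $f^*\omega=\omega$. Then $\mathcal P\subset\mathcal Z^1_{\mathcal F}$ and $\mathcal O_P\subset\Omega^0_{\mathcal F}$, the exterior differential is a morphism of sheaves $d:\Omega^0_{\mathcal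 F}\to\mathcal Z^1_{\mathcal F}$, $\varphi$ is a morphism of sheaves of groups $\mathcal Z^1_{\mathcal F}\to\mathcal{A}ut$, and: 1. $0\to\mathcal O_P\to\Omega^0_{\mathcal F}\xrightarrow{\varphi\circ d}\mathcal{A}ut\to 0$ is a short exact sequence of sheaves of groups; 2. $\varphi$ induces an isomorphism of sheaves of groups from the quotient sheaf $\mathcal K_{\mathcal F}=\mathcal Z^1_{\mathcal F}/\mathcal P$ to $\mathcal{A}ut$. -/

import Mathlib

open CategoryTheory TopologicalSpace Opposite
open scoped Manifold ContDiff

universe u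

namespace ASCIR

noncomputable section

/-! ### Tensor fields on smooth manifolds -/

section Tensors

variable (k : ℕ) {B : Type u} [TopologicalSpace B] [ChartedSpace (EuclideanSpace ℝ (Fin k)) B]

/-- The cotangent space of the `k`-manifold `B` at `b`. -/
abbrev Covec (b : B) : Type := TangentSpace (𝓡 k) b →L[ℝ] ℝ

variable (B) in
/-- (Not necessarily smooth) differential `j`-forms on the `k`-manifold `B`. -/
abbrev DiffForm (j : ℕ) : Type u := ∀ b : B, TangentSpace (𝓡 k) b [⋀^Fin j]→L[ℝ] ℝ

variable (B) in
/-- A bivector field `Π` on the `k`-manifold `B`, given by its bundle map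
`Π♯ : T*B → TB`, `β (Π♯ α) = Π (α, β)`; antisymmetry and smoothness are imposed below. -/
abbrev BivectorField : Type u := ∀ b : B, Covec k b →L[ℝ] TangentSpace (𝓡 k) b

variable {k}

/-- A field of covectors as a differential `1`-form. -/
def oneForm (α : ∀ b : B, Covec k b) : DiffForm k B 1 :=
  fun b => ContinuousAlternatingMap.ofSubsingleton ℝ (TangentSpace (𝓡 k) b) ℝ (0 : Fin 1) (α b)

/-- The coordinate expression of a form in the preferred chart at `x`. -/
def DiffForm.inChart {j : ℕ} (σ : DiffForm k B j) (x : B) (y : EuclideanSpace ℝ (Fin k)) :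
    EuclideanSpace ℝ (Fin k) [⋀^Fin j]→L[ℝ] ℝ :=
  (σ ((extChartAt (𝓡 k) x).symm y)).compContinuousLinearMap
    (mfderiv (𝓡 k) (𝓡 k) (extChartAt (𝓡 k) x).symm y)

/-- The form `σ` is smooth at `b`. -/
def DiffForm.SmoothAt {j : ℕ} (σ : DiffForm k B j) (b : B) : Prop :=
  ContDiffAt ℝ ∞ (DiffForm.inChart σ b) (extChartAt (𝓡 k) b b)

/-- The exterior derivative of a form. -/
def DiffForm.d {j : ℕ} (σ : DiffForm k B j) : DiffForm k B (j + 1) := fun b =>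
  (extDeriv (DiffForm.inChart σ b) (extChartAt (𝓡 k) b b)).compContinuousLinearMap
    (mfderiv (𝓡 k) (𝓡 k) (extChartAt (𝓡 k) b) b)

/-- The differential of a function, as a field of covectors. -/
def diffl (f : B → ℝ) (b : B) : Covec k b := mfderiv (𝓡 k) 𝓘(ℝ, ℝ) f b

/-- The coordinate expression of a bivector field in the preferred chart at `x`. -/
def BivectorField.inChart (Λ : BivectorField k B) (x : B) (y : EuclideanSpace ℝ (Fin k)) :
    (EuclideanSpace ℝ (Fin k) →L[ℝ] ℝ) →L[ℝ] EuclideanSpace ℝ (Fin k) :=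
  let b := (extChartAt (𝓡 k) x).symm y
  let A : TangentSpace (𝓡 k) b →L[ℝ] EuclideanSpace ℝ (Fin k) :=
    mfderiv (𝓡 k) (𝓡 k) (extChartAt (𝓡 k) x) b
  A.comp ((Λ b).comp (ContinuousLinearMap.precomp ℝ A))

/-- The bracket `{f, g} = Π (df, dg)`. -/
def bracket (Λ : BivectorField k B) (f g : B → ℝ) (b : B) : ℝ :=
  diffl g b (Λ b (diffl f b))

/-- The Hamiltonian vector field `X_f = - Π♯ (df)`. -/
def hamVec (Λ : BivectorField k B) (f : B → ℝ) (b : B) : TangentSpace (𝓡 k) b :=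
  - Λ b (diffl f b)

/-- `(B, Π)` is a regular twisted Poisson manifold: `Π` is a smooth bivector field of constant
rank, and for some closed `3`-form `η` the Jacobiator of the bracket is `- η (X_f, X_g, X_h)`. -/
structure IsRegularTwistedPoisson (Λ : BivectorField k B) : Prop where
  skew : ∀ (b : B) (α β : Covec k b), β (Λ b α) = - α (Λ b β)
  smooth : ∀ b : B, ContDiffAt ℝ ∞ (BivectorField.inChart Λ b) (extChartAt (𝓡 k) b b)
  twisted : ∃ η : DiffForm k B 3, (∀ b, DiffForm.SmoothAt η b) ∧ DiffForm.d η = 0 ∧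
    ∀ f g h : B → ℝ, ContMDiff (𝓡 k) 𝓘(ℝ, ℝ) ∞ f → ContMDiff (𝓡 k) 𝓘(ℝ, ℝ) ∞ g →
      ContMDiff (𝓡 k) 𝓘(ℝ, ℝ) ∞ h → ∀ b : B,
        bracket Λ (bracket Λ f g) h b + bracket Λ (bracket Λ g h) f b
          + bracket Λ (bracket Λ h f) g b
          + η b ![hamVec Λ f b, hamVec Λ g b, hamVec Λ h b] = 0
  regular : ∃ r : ℕ, ∀ b : B, Module.finrank ℝ (LinearMap.range (Λ b).toLinearMap) = r

/-- The tangent space at `b` of the almost symplectic leaf through `b`: the image of `Π♯`. -/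
def leafTangent (Λ : BivectorField k B) (b : B) : Submodule ℝ (TangentSpace (𝓡 k) b) :=
  LinearMap.range (Λ b).toLinearMap

/-- The conormal space `ν*_b F` of the foliation: covectors vanishing on the leaf through `b`. -/
def conormal (Λ : BivectorField k B) (b : B) : AddSubgroup (Covec k b) where
  carrier := {α | ∀ v ∈ leafTangent Λ b, α v = 0}
  zero_mem' := by intro v _; rfl
  add_mem' := by
    intro α β hα hβ v hv
    change α v + β v = 0
    rw [hα v hv, hβ v hv, add_zero]
  neg_mem' := by
    intro α hα v hv
    change - α v = 0
    rw [hα v hv, neg_zero]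

/-- `x` and `y` are joined by a `C¹` path lying in `U` and tangent to the foliation. -/
def LeafStep (Λ : BivectorField k B) (U : Set B) (x y : B) : Prop :=
  ∃ (γ : ℝ → B) (s t : ℝ), s ≤ t ∧ γ s = x ∧ γ t = y ∧
    ∀ r ∈ Set.Icc s t, γ r ∈ U ∧ ContMDiffAt 𝓘(ℝ, ℝ) (𝓡 k) 1 γ r ∧
      mfderiv 𝓘(ℝ, ℝ) (𝓡 k) γ r (1 : ℝ) ∈ leafTangent Λ (γ r)

/-- The leaf through `x` of the foliation restricted to the open set `U`: the points reached from
`x` by piecewise `C¹` paths in `U` tangent to the foliation. -/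
def leaf (Λ : BivectorField k B) (U : Set B) (x : B) : Set B :=
  {y | Relation.ReflTransGen (LeafStep Λ U) x y}

/-- `Θ` is a characteristic form: a smooth `2`-form restricting on every leaf to its almost
symplectic form, which is the form sending `(X_f, X_g)` to `{f, g}`. -/
structure IsCharacteristicForm (Λ : BivectorField k B) (Θ : DiffForm k B 2) : Prop where
  smooth : ∀ b, DiffForm.SmoothAt Θ b
  restrict : ∀ (b : B) (α β : Covec k b), Θ b ![Λ b α, Λ b β] = β (Λ b α)

end Tensors

/-! ### Sheaves of sections -/

section Sections

variable {B : Type u} [TopologicalSpace B] {A : B → Type} [∀ b, AddCommGroup (A b)]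

/-- Restriction of a section. -/
def res {U V : Opens B} (h : U ≤ V) (s : ∀ b : V, A b) : ∀ b : U, A b := fun b => s ⟨b, h b.2⟩

open Classical in
/-- Extension by zero of a section over `U`; only its values near points of `U` are ever used. -/
def extend {U : Opens B} (s : ∀ b : U, A b) : ∀ b : B, A b :=
  fun b => if h : b ∈ U then s ⟨b, h⟩ else 0

theorem extend_apply {U : Opens B} (s : ∀ b : U, A b) (b : U) : extend s b = s b := by
  simp [extend]

theorem extend_zero {U : Opens B} : extend (0 : ∀ b : U, A b) = 0 := by
  funext b; by_cases h : b ∈ U <;> simp [extend, h]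

theorem extend_add {U : Opens B} (s t : ∀ b : U, A b) :
    extend (s + t) = extend s + extend t := by
  funext b; by_cases h : b ∈ U <;> simp [extend, h]

theorem extend_neg {U : Opens B} (s : ∀ b : U, A b) : extend (-s) = -extend s := by
  funext b; by_cases h : b ∈ U <;> simp [extend, h]

theorem extend_res {U V : Opens B} (h : U ≤ V) (s : ∀ b : V, A b) {b : B} (hb : b ∈ U) :
    ∀ᶠ c in nhds b, extend (res h s) c = extend s c := by
  filter_upwards [U.2.mem_nhds hb] with c hc
  have h1 : c ∈ U := hc
  simp [extend, res, h1, h h1]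

variable (A) in
/-- A sheaf of abelian groups whose sections over `U` are certain families `(s_b ∈ A_b)_{b ∈ U}`:
the condition on the family is stable under restriction and local. -/
structure LocalSections where
  carrier : ∀ U : Opens B, AddSubgroup (∀ b : U, A b)
  res_mem : ∀ {U V : Opens B} (h : U ≤ V) (s : ∀ b : V, A b),
    s ∈ carrier V → res h s ∈ carrier U
  local_mem : ∀ {U : Opens B} (s : ∀ b : U, A b),
    (∀ b : U, ∃ (V : Opens B) (h : V ≤ U), (b : B) ∈ V ∧ res h s ∈ carrier V) → s ∈ carrier U

/-- Sections whose germ at every point satisfies a condition `Q`. -/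
def LocalSections.ofGerm (Q : ∀ _ : B, (∀ c : B, A c) → Prop) (h0 : ∀ b, Q b 0)
    (ha : ∀ b s t, Q b s → Q b t → Q b (s + t)) (hn : ∀ b s, Q b s → Q b (-s))
    (hc : ∀ (b : B) (s t : ∀ c : B, A c), (∀ᶠ c in nhds b, s c = t c) → Q b s → Q b t) : LocalSections A where
  carrier U :=
    { carrier := {s | ∀ b : U, Q b (extend s)}
      zero_mem' := fun b => by rw [extend_zero]; exact h0 b
      add_mem' := fun {s t} hs ht b => by rw [extend_add]; exact ha b _ _ (hs b) (ht b)
      neg_mem' := fun {s} hs b => by rw [extend_neg]; exact hn b _ (hs b) }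
  res_mem := fun h s hs b => hc b _ _ ((extend_res h s b.2).mono fun _ e => e.symm) (hs ⟨b, h b.2⟩)
  local_mem := fun s hs b => by
    obtain ⟨V, h, hb, hV⟩ := hs b
    exact hc b _ _ (extend_res h s hb) (hV ⟨b, hb⟩)

/-- The underlying presheaf of abelian groups. -/
def LocalSections.presheaf (S : LocalSections A) :
    TopCat.Presheaf AddCommGrpCat.{u} (TopCat.of B) where
  obj U := AddCommGrpCat.of (S.carrier U.unop)
  map i := AddCommGrpCat.ofHom
    { toFun := fun s => ⟨res i.unop.le s.1, S.res_mem _ _ s.2⟩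
      map_zero' := rfl
      map_add' := fun _ _ => rfl }

theorem LocalSections.isSheaf (S : LocalSections A) : S.presheaf.IsSheaf := by
  rw [TopCat.Presheaf.isSheaf_iff_isSheafUniqueGluing]
  intro ι U sf hsf
  have hmem : ∀ b : (iSup U : Opens B), ∃ i, (b : B) ∈ U i := fun b => Opens.mem_iSup.1 b.2
  choose idx hidx using hmem
  let g : ∀ i, ∀ b : U i, A b := fun i => (show S.carrier (U i) from sf i).1
  have hcomp : ∀ i j (b : B) (hi : b ∈ U i) (hj : b ∈ U j), g i ⟨b, hi⟩ = g j ⟨b, hj⟩ := by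
    intro i j b hi hj
    have h1 := congrArg Subtype.val (hsf i j)
    exact congrFun h1 (⟨b, hi, hj⟩ : (U i ⊓ U j : Opens B))
  let s : ∀ b : (iSup U : Opens B), A b := fun b => g (idx b) ⟨b, hidx b⟩
  have hres : ∀ i, res (le_iSup U i) s = g i := by
    intro i; funext b; exact hcomp _ _ _ _ _
  have hs : s ∈ S.carrier (iSup U) := by
    refine S.local_mem s fun b => ⟨U (idx b), le_iSup U _, hidx b, ?_⟩
    rw [hres]
    exact (show S.carrier (U (idx b)) from sf (idx b)).2
  refine ⟨(⟨s, hs⟩ : S.carrier (iSup U)), fun i => Subtype.ext (hres i), ?_⟩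
  intro t ht
  apply Subtype.ext
  funext b
  have h1 := congrArg Subtype.val (ht (idx b))
  exact congrFun h1 (⟨b, hidx b⟩ : U (idx b))

/-- The sheaf of abelian groups of a `LocalSections`. -/
def LocalSections.sheaf (S : LocalSections A) :
    TopCat.Sheaf AddCommGrpCat.{u} (TopCat.of B) := ⟨S.presheaf, S.isSheaf⟩

end Sections

/-- An abelian group written additively, as a group. -/
def mulGrp : AddCommGrpCat.{u} ⥤ GrpCat.{u} where
  obj G := GrpCat.of (Multiplicative G)
  map f := GrpCat.ofHom (AddMonoidHom.toMultiplicative f.hom)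

theorem mulGrp_isSheaf {X : TopCat.{u}} (F : TopCat.Sheaf AddCommGrpCat.{u} X) :
    TopCat.Presheaf.IsSheaf (F.presheaf ⋙ mulGrp.{u}) := by
  rw [TopCat.Presheaf.isSheaf_iff_isSheaf_comp' (forget GrpCat.{u})]
  exact (TopCat.Presheaf.isSheaf_iff_isSheaf_comp' (forget AddCommGrpCat.{u}) F.presheaf).1 F.2

/-- A sheaf of abelian groups, regarded as a sheaf of (multiplicative) groups. -/
def asGroups {X : TopCat.{u}} (F : TopCat.Sheaf AddCommGrpCat.{u} X) :
    TopCat.Sheaf GrpCat.{u} X := ⟨F.presheaf ⋙ mulGrp, mulGrp_isSheaf F⟩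

/-- A morphism of sheaves of abelian groups, regarded as a morphism of sheaves of groups. -/
def asGroupsMap {X : TopCat.{u}} {F G : TopCat.Sheaf AddCommGrpCat.{u} X} (f : F ⟶ G) :
    asGroups F ⟶ asGroups G := ⟨Functor.whiskerRight f.hom mulGrp⟩


/-- `1 → F → G → H → 1` is a short exact sequence of sheaves of groups: `i` is injective, the
kernel of `p` is the image of `i`, and `p` is locally surjective. -/
structure IsShortExact {X : TopCat.{u}} {F G H : TopCat.Sheaf GrpCat.{u} X} (i : F ⟶ G)
    (p : G ⟶ H) : Prop where
  injective : ∀ U : Opens X, Function.Injective (i.hom.app (op U)).hom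
  exact : ∀ (U : Opens X) (s : G.presheaf.obj (op U)),
    (p.hom.app (op U)).hom s = 1 ↔ ∃ r, (i.hom.app (op U)).hom r = s
  locally_surjective : TopCat.Presheaf.IsLocallySurjective p.hom

/-! ### The sheaves attached to a regular twisted Poisson manifold -/

section Base

variable {k : ℕ} {B : Type u} [TopologicalSpace B] [ChartedSpace (EuclideanSpace ℝ (Fin k)) B]

theorem inChart_congr {α β : ∀ b : B, Covec k b} {b : B} (h : ∀ᶠ c in nhds b, α c = β c) :
    DiffForm.inChart (oneForm α) b =ᶠ[nhds (extChartAt (𝓡 k) b b)]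
      DiffForm.inChart (oneForm β) b := by
  have h1 : Filter.Tendsto (extChartAt (𝓡 k) b).symm (nhds (extChartAt (𝓡 k) b b)) (nhds b) := by
    have := continuousAt_extChartAt_symm (I := 𝓡 k) b
    rwa [ContinuousAt, extChartAt_to_inv] at this
  filter_upwards [h1.eventually h] with y hy
  simp only [DiffForm.inChart, oneForm, hy]

theorem inChart_zero (b : B) : DiffForm.inChart (oneForm (0 : ∀ b : B, Covec k b)) b = 0 := by
  funext y; ext v; rfl

theorem inChart_add (α β : ∀ b : B, Covec k b) (b : B) :
    DiffForm.inChart (oneForm (α + β)) b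
      = DiffForm.inChart (oneForm α) b + DiffForm.inChart (oneForm β) b := by
  funext y; ext v; rfl

theorem inChart_neg (α : ∀ b : B, Covec k b) (b : B) :
    DiffForm.inChart (oneForm (-α)) b = (-1 : ℝ) • DiffForm.inChart (oneForm α) b := by
  funext y; ext v
  exact (neg_one_mul _).symm

theorem smoothAt_zero (b : B) : DiffForm.SmoothAt (oneForm (0 : ∀ b : B, Covec k b)) b := by
  rw [DiffForm.SmoothAt, inChart_zero]; exact contDiffAt_const

theorem smoothAt_add {α β : ∀ b : B, Covec k b} {b : B} (hα : DiffForm.SmoothAt (oneForm α) b)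
    (hβ : DiffForm.SmoothAt (oneForm β) b) : DiffForm.SmoothAt (oneForm (α + β)) b := by
  rw [DiffForm.SmoothAt, inChart_add]; exact hα.add hβ

theorem smoothAt_neg {α : ∀ b : B, Covec k b} {b : B} (hα : DiffForm.SmoothAt (oneForm α) b) :
    DiffForm.SmoothAt (oneForm (-α)) b := by
  rw [DiffForm.SmoothAt, inChart_neg]; exact contDiffAt_const.smul hα

theorem smoothAt_congr {α β : ∀ b : B, Covec k b} {b : B} (h : ∀ᶠ c in nhds b, α c = β c)
    (hα : DiffForm.SmoothAt (oneForm α) b) : DiffForm.SmoothAt (oneForm β) b :=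
  hα.congr_of_eventuallyEq (inChart_congr h).symm

theorem d_zero (b : B) : DiffForm.d (oneForm (0 : ∀ b : B, Covec k b)) b = 0 := by
  rw [DiffForm.d, inChart_zero]
  have h : extDeriv (0 : EuclideanSpace ℝ (Fin k) → EuclideanSpace ℝ (Fin k) [⋀^Fin 1]→L[ℝ] ℝ)
      (extChartAt (𝓡 k) b b) = 0 := by
    have := extDeriv_smul (0 : ℝ)
      (0 : EuclideanSpace ℝ (Fin k) → EuclideanSpace ℝ (Fin k) [⋀^Fin 1]→L[ℝ] ℝ)
      (x := extChartAt (𝓡 k) b b)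
    rwa [zero_smul, zero_smul] at this
  rw [h]; rfl

theorem smoothAt_differentiable {α : ∀ b : B, Covec k b} {b : B}
    (hα : DiffForm.SmoothAt (oneForm α) b) :
    DifferentiableAt ℝ (DiffForm.inChart (oneForm α) b) (extChartAt (𝓡 k) b b) :=
  ContDiffAt.differentiableAt hα (by simp)

theorem d_add {α β : ∀ b : B, Covec k b} {b : B} (hα : DiffForm.SmoothAt (oneForm α) b)
    (hβ : DiffForm.SmoothAt (oneForm β) b) :
    DiffForm.d (oneForm (α + β)) b = DiffForm.d (oneForm α) b + DiffForm.d (oneForm β) b := by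
  simp only [DiffForm.d, inChart_add]
  rw [extDeriv_add (smoothAt_differentiable hα) (smoothAt_differentiable hβ)]
  rfl

theorem d_neg (α : ∀ b : B, Covec k b) (b : B) :
    DiffForm.d (oneForm (-α)) b = (-1 : ℝ) • DiffForm.d (oneForm α) b := by
  simp only [DiffForm.d, inChart_neg]
  rw [extDeriv_smul]
  rfl

theorem d_congr {α β : ∀ b : B, Covec k b} {b : B} (h : ∀ᶠ c in nhds b, α c = β c) :
    DiffForm.d (oneForm α) b = DiffForm.d (oneForm β) b := by
  simp only [DiffForm.d]
  rw [(inChart_congr h).extDeriv_eq]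

/-- The sheaf `Z¹_F` of closed `1`-forms vanishing on the leaves. -/
def Z1 (Λ : BivectorField k B) : LocalSections (fun b : B => Covec k b) :=
  LocalSections.ofGerm
    (fun b α => DiffForm.SmoothAt (oneForm α) b ∧ α b ∈ conormal Λ b ∧
      DiffForm.d (oneForm α) b = 0)
    (fun b => ⟨smoothAt_zero b, (conormal Λ b).zero_mem, d_zero b⟩)
    (fun b α β hα hβ => ⟨smoothAt_add hα.1 hβ.1, (conormal Λ b).add_mem hα.2.1 hβ.2.1, by
      rw [d_add hα.1 hβ.1, hα.2.2, hβ.2.2, add_zero]⟩)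
    (fun b α hα => ⟨smoothAt_neg hα.1, (conormal Λ b).neg_mem hα.2.1, by
      rw [d_neg, hα.2.2, smul_zero]⟩)
    (fun b α β h hα => ⟨smoothAt_congr h hα.1, h.self_of_nhds ▸ hα.2.1, by
      rw [← d_congr h]; exact hα.2.2⟩)

/-- The sheaf `𝒫` of smooth sections of `P`. -/
def periodSections (P : ∀ b : B, AddSubgroup (Covec k b)) :
    LocalSections (fun b : B => Covec k b) :=
  LocalSections.ofGerm
    (fun b α => DiffForm.SmoothAt (oneForm α) b ∧ α b ∈ P b)
    (fun b => ⟨smoothAt_zero b, (P b).zero_mem⟩)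
    (fun b _ _ hα hβ => ⟨smoothAt_add hα.1 hβ.1, (P b).add_mem hα.2 hβ.2⟩)
    (fun b _ hα => ⟨smoothAt_neg hα.1, (P b).neg_mem hα.2⟩)
    (fun _ _ _ h hα => ⟨smoothAt_congr h hα.1, h.self_of_nhds ▸ hα.2⟩)

/-- The sheaf `C^∞` of smooth functions. -/
def smoothFunctions (k : ℕ) (B : Type u) [TopologicalSpace B]
    [ChartedSpace (EuclideanSpace ℝ (Fin k)) B] : LocalSections (fun _ : B => ℝ) :=
  LocalSections.ofGerm
    (fun b f => ContMDiffAt (𝓡 k) 𝓘(ℝ, ℝ) ∞ f b)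
    (fun _ => contMDiffAt_const)
    (fun _ _ _ hf hg => hf.add hg)
    (fun _ _ hf => hf.neg)
    (fun _ _ _ h hf => hf.congr_of_eventuallyEq (h.mono fun _ e => e.symm))

theorem LeafStep.mono {Λ : BivectorField k B} {U V : Set B} (h : U ⊆ V) {x y : B}
    (hxy : LeafStep Λ U x y) : LeafStep Λ V x y := by
  obtain ⟨γ, s, t, hst, h1, h2, h3⟩ := hxy
  exact ⟨γ, s, t, hst, h1, h2, fun r hr => ⟨h (h3 r hr).1, (h3 r hr).2⟩⟩

/-- The sheaf `Ω⁰_F` of smooth functions constant on the leaves: over `U`, these are the smooth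
functions on `U` constant on each leaf of the foliation of `U`. -/
def Omega0 (Λ : BivectorField k B) : LocalSections (fun _ : B => ℝ) where
  carrier U :=
    { carrier := {f | f ∈ (smoothFunctions k B).carrier U ∧
        ∀ x y : U, (y : B) ∈ leaf Λ U (x : B) → f x = f y}
      zero_mem' := ⟨AddSubgroup.zero_mem _, fun _ _ _ => rfl⟩
      add_mem' := fun {f g} hf hg => ⟨AddSubgroup.add_mem _ hf.1 hg.1, fun x y h => by
        change f x + g x = f y + g y
        rw [hf.2 x y h, hg.2 x y h]⟩
      neg_mem' := fun hf => ⟨AddSubgroup.neg_mem _ hf.1, fun x y h => by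
        change - _ = - _
        rw [hf.2 x y h]⟩ }
  res_mem := fun {U V} h f hf => ⟨(smoothFunctions k B).res_mem h f hf.1, fun x y hxy =>
    hf.2 ⟨x, h x.2⟩ ⟨y, h y.2⟩ (Relation.ReflTransGen.mono
      (r := LeafStep Λ (U : Set B)) (p := LeafStep Λ (V : Set B))
      (fun _ _ => LeafStep.mono h) _ _ hxy)⟩
  local_mem := fun {U} f hf => by
    refine ⟨(smoothFunctions k B).local_mem f fun b => ?_, ?_⟩
    · obtain ⟨V, h, hb, hV⟩ := hf b
      exact ⟨V, h, hb, hV.1⟩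
    have hstep : ∀ x y : U, LeafStep Λ U x y → f x = f y := by
      rintro x y ⟨γ, s, t, hst, hx, hy, hγ⟩
      have hs : s ∈ Set.Icc s t := ⟨le_rfl, hst⟩
      have ht : t ∈ Set.Icc s t := ⟨hst, le_rfl⟩
      let g : Set.Icc s t → ℝ := fun r => f ⟨γ r, (hγ r r.2).1⟩
      have hg : IsLocallyConstant g := by
        rw [IsLocallyConstant.iff_eventually_eq]
        intro r
        obtain ⟨V, h, hb, hV⟩ := hf ⟨γ r, (hγ r r.2).1⟩
        have h1 : ∀ᶠ q in nhds (r : ℝ), γ q ∈ V :=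
          (hγ r r.2).2.1.continuousAt.eventually (V.2.mem_nhds hb)
        obtain ⟨ε, hε, hball⟩ := Metric.eventually_nhds_iff.1 h1
        filter_upwards [Metric.ball_mem_nhds r hε] with q hq
        have hq' : |(q : ℝ) - r| < ε := hq
        have hV' : ∀ p ∈ Set.uIcc (q : ℝ) r, γ p ∈ V := by
          intro p hp
          apply hball
          rw [Real.dist_eq, abs_sub_comm]
          exact (Set.abs_sub_right_of_mem_uIcc hp).trans_lt (by rwa [abs_sub_comm])
        have key : ∀ p p' : Set.Icc s t, (p : ℝ) ≤ p' →
            (∀ a ∈ Set.Icc (p : ℝ) p', γ a ∈ V) → g p = g p' := by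
          intro p p' hpp ha
          refine hV.2 ⟨γ p, ha p ⟨le_rfl, hpp⟩⟩ ⟨γ p', ha p' ⟨hpp, le_rfl⟩⟩
            (Relation.ReflTransGen.single ⟨γ, p, p', hpp, rfl, rfl, fun a haa => ⟨ha a haa, ?_⟩⟩)
          exact (hγ a ⟨p.2.1.trans haa.1, haa.2.trans p'.2.2⟩).2
        rcases le_total (q : ℝ) r with hqr | hqr
        · exact key q r hqr fun a ha => hV' a (by rwa [Set.uIcc_of_le hqr])
        · exact (key r q hqr fun a ha => hV' a (by rwa [Set.uIcc_of_ge hqr])).symm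
      have : PreconnectedSpace (Set.Icc s t) :=
        Subtype.preconnectedSpace isPreconnected_Icc
      have h1 := hg.apply_eq_of_preconnectedSpace ⟨s, hs⟩ ⟨t, ht⟩
      have e1 : (⟨γ s, (hγ s hs).1⟩ : U) = x := Subtype.ext hx
      have e2 : (⟨γ t, (hγ t ht).1⟩ : U) = y := Subtype.ext hy
      simpa only [g, e1, e2] using h1
    have hend : ∀ {a b : B}, LeafStep Λ U a b → a ∈ U ∧ b ∈ U := by
      rintro a b ⟨γ, s, t, hst, rfl, rfl, hγ⟩
      exact ⟨(hγ s ⟨le_rfl, hst⟩).1, (hγ t ⟨hst, le_rfl⟩).1⟩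
    rintro ⟨x, hx⟩ ⟨y, hy⟩ hxy
    have hxy' : Relation.ReflTransGen (LeafStep Λ U) x y := hxy
    clear hxy
    induction hxy' with
    | refl => rfl
    | tail _ hbc ih => exact (ih (hend hbc).1).trans (hstep ⟨_, (hend hbc).1⟩ ⟨_, hy⟩ hbc)

/-- The differential of a function on `U`. -/
def dSection {U : Opens B} (f : ∀ _ : U, ℝ) : ∀ b : U, Covec k (b : B) :=
  fun b => diffl (extend (A := fun _ : B => ℝ) f) b

theorem dSection_res {U V : Opens B} (h : U ≤ V) (f : ∀ _ : V, ℝ) :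
    dSection (k := k) (res (A := fun _ : B => ℝ) h f)
      = res (A := fun b : B => Covec k b) h (dSection f) := by
  funext b
  exact Filter.EventuallyEq.mfderiv_eq (extend_res (A := fun _ : B => ℝ) h f b.2)

theorem dSection_zero {U : Opens B} : dSection (k := k) (0 : ∀ _ : U, ℝ) = 0 := by
  funext b
  simp only [dSection, diffl]
  rw [extend_zero (A := fun _ : B => ℝ)]
  exact mfderiv_const

theorem dSection_add {U : Opens B} {f g : ∀ _ : U, ℝ}
    (hf : f ∈ (smoothFunctions k B).carrier U) (hg : g ∈ (smoothFunctions k B).carrier U) :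
    dSection (k := k) (f + g) = dSection f + dSection g := by
  funext b
  simp only [dSection, diffl]
  rw [extend_add (A := fun _ : B => ℝ)]
  exact mfderiv_add ((hf b).mdifferentiableAt (by simp)) ((hg b).mdifferentiableAt (by simp))

theorem dSection_neg {U : Opens B} (f : ∀ _ : U, ℝ) :
    dSection (k := k) (-f) = -dSection f := by
  funext b
  simp only [dSection, diffl]
  rw [extend_neg (A := fun _ : B => ℝ)]
  exact mfderiv_neg

/-- The sheaf `O_P` of smooth functions `f` such that `df` is a section of `P`. -/
def structureSheaf (P : ∀ b : B, AddSubgroup (Covec k b)) : LocalSections (fun _ : B => ℝ) where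
  carrier U :=
    { carrier := {f | f ∈ (smoothFunctions k B).carrier U ∧
        dSection f ∈ (periodSections P).carrier U}
      zero_mem' := ⟨AddSubgroup.zero_mem _, by
        rw [dSection_zero]; exact AddSubgroup.zero_mem _⟩
      add_mem' := fun hf hg => ⟨AddSubgroup.add_mem _ hf.1 hg.1, by
        rw [dSection_add hf.1 hg.1]; exact AddSubgroup.add_mem _ hf.2 hg.2⟩
      neg_mem' := fun hf => ⟨AddSubgroup.neg_mem _ hf.1, by
        rw [dSection_neg]; exact AddSubgroup.neg_mem _ hf.2⟩ }
  res_mem := fun h f hf => ⟨(smoothFunctions k B).res_mem h f hf.1, by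
    rw [dSection_res]; exact (periodSections P).res_mem h _ hf.2⟩
  local_mem := fun f hf => by
    refine ⟨(smoothFunctions k B).local_mem f fun b => ?_,
      (periodSections P).local_mem _ fun b => ?_⟩
    · obtain ⟨V, h, hb, hV⟩ := hf b
      exact ⟨V, h, hb, hV.1⟩
    · obtain ⟨V, h, hb, hV⟩ := hf b
      refine ⟨V, h, hb, ?_⟩
      rw [← dSection_res]
      exact hV.2

/-- The presheaf quotient `U ↦ Z¹_F(U) / 𝒫(U)`. -/
def quotientPresheaf (Λ : BivectorField k B) (P : ∀ b : B, AddSubgroup (Covec k b)) :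
    TopCat.Presheaf AddCommGrpCat.{u} (TopCat.of B) where
  obj U := AddCommGrpCat.of ((Z1 Λ).carrier U.unop ⧸
    ((periodSections P).carrier U.unop).addSubgroupOf ((Z1 Λ).carrier U.unop))
  map {U V} i := AddCommGrpCat.ofHom (QuotientAddGroup.map _ _ ((Z1 Λ).presheaf.map i).hom
    (fun s hs => (periodSections P).res_mem i.unop.le s.1 hs))
  map_id U := by
    ext s
    rfl
  map_comp i j := by
    ext s
    rfl

/-- The projection of `Z¹_F` onto the presheaf quotient. -/
def toQuotientPresheaf (Λ : BivectorField k B) (P : ∀ b : B, AddSubgroup (Covec k b)) :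
    (Z1 Λ).presheaf ⟶ quotientPresheaf Λ P where
  app U := AddCommGrpCat.ofHom (QuotientAddGroup.mk' _)

/-- The quotient sheaf `K_F = Z¹_F / 𝒫`: the sheafification of the presheaf quotient. -/
def KSheaf (Λ : BivectorField k B) (P : ∀ b : B, AddSubgroup (Covec k b)) :
    TopCat.Sheaf AddCommGrpCat.{u} (TopCat.of B) :=
  (presheafToSheaf (Opens.grothendieckTopology (TopCat.of B)) AddCommGrpCat.{u}).obj
    (quotientPresheaf Λ P)

/-- The projection `Z¹_F → K_F`. -/
def toKSheaf (Λ : BivectorField k B) (P : ∀ b : B, AddSubgroup (Covec k b)) :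
    (Z1 Λ).sheaf ⟶ KSheaf Λ P :=
  ⟨toQuotientPresheaf Λ P ≫
    toSheafify (Opens.grothendieckTopology (TopCat.of B)) (quotientPresheaf Λ P)⟩

end Base

/-! ### Realizations -/

section Realization

variable {k d : ℕ} {B M : Type u}
  [TopologicalSpace B] [ChartedSpace (EuclideanSpace ℝ (Fin k)) B]
  [TopologicalSpace M] [ChartedSpace (EuclideanSpace ℝ (Fin d)) M]

/-- The pullback of a form along a map. -/
def DiffForm.pullback {j : ℕ} (f : M → B) (σ : DiffForm k B j) : DiffForm d M j :=
  fun m => (σ (f m)).compContinuousLinearMap (mfderiv (𝓡 d) (𝓡 k) f m)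

theorem comp_congr (σ : DiffForm d M 2) {x y : M} (h : x = y)
    {A A' : EuclideanSpace ℝ (Fin d) →L[ℝ] EuclideanSpace ℝ (Fin d)} (hA : A = A') :
    ContinuousAlternatingMap.compContinuousLinearMap
      (σ x : EuclideanSpace ℝ (Fin d) [⋀^Fin 2]→L[ℝ] ℝ) A
    = ContinuousAlternatingMap.compContinuousLinearMap
      (σ y : EuclideanSpace ℝ (Fin d) [⋀^Fin 2]→L[ℝ] ℝ) A' := by
  subst h; subst hA; rfl

/-- `(M, σ)` with the smooth map `π` is an almost symplectically complete isotropic realization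
of `(B, Π)` with twisting form `η`. -/
structure IsASCIR (Λ : BivectorField k B) (π : C^∞⟮𝓡 d, M; 𝓡 k, B⟯) (σ : DiffForm d M 2)
    (η : DiffForm k B 3) : Prop where
  surjective : Function.Surjective π
  submersion : ∀ m, Function.Surjective (mfderiv (𝓡 d) (𝓡 k) π m)
  compact_fiber : ∀ b, IsCompact (π ⁻¹' {b})
  connected_fiber : ∀ b, IsConnected (π ⁻¹' {b})
  smooth : ∀ m, DiffForm.SmoothAt σ m
  nondegenerate : ∀ (m : M) (v : TangentSpace (𝓡 d) m), (∀ w, σ m ![v, w] = 0) → v = 0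
  isotropic : ∀ (m : M) (v w : TangentSpace (𝓡 d) m),
    mfderiv (𝓡 d) (𝓡 k) π m v = 0 → mfderiv (𝓡 d) (𝓡 k) π m w = 0 → σ m ![v, w] = 0
  /-- `π` is an almost Poisson map, the bivector field of `M` being
  `Π_M (ι_v σ, ι_w σ) = σ (v, w)`. -/
  almost_poisson : ∀ (m : M) (α β : Covec k (π m)) (v w : TangentSpace (𝓡 d) m),
    (∀ x, σ m ![v, x] = α (mfderiv (𝓡 d) (𝓡 k) π m x)) →
    (∀ x, σ m ![w, x] = β (mfderiv (𝓡 d) (𝓡 k) π m x)) → σ m ![v, w] = β (Λ (π m) α)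
  twisting_smooth : ∀ b, DiffForm.SmoothAt η b
  twisting_closed : DiffForm.d η = 0
  twisting : DiffForm.d σ = DiffForm.pullback π η

/-- The point `m'` is the image of `m` under the time-one flow, inside the fiber of `m`, of the
vector field `X = σ♯ (π^* α)`, i.e. `ι_X σ = π^* α`. Only the value of `α` at `π m` matters. -/
def FlowsTo (π : C^∞⟮𝓡 d, M; 𝓡 k, B⟯) (σ : DiffForm d M 2) (α : ∀ b : B, Covec k b)
    (m m' : M) : Prop :=
  ∃ γ : ℝ → M, γ 0 = m ∧ γ 1 = m' ∧ ∀ t : ℝ, π (γ t) = π m ∧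
    ∃ v : TangentSpace (𝓡 d) (γ t),
      HasMFDerivAt 𝓘(ℝ, ℝ) (𝓡 d) γ t ((1 : ℝ →L[ℝ] ℝ).smulRight v) ∧
      ∀ w : TangentSpace (𝓡 d) (γ t),
        σ (γ t) ![v, w] = α (π (γ t)) (mfderiv (𝓡 d) (𝓡 k) π (γ t) w)

/-- `P` is the period bundle of the realization: `P_b` is the stabilizer of the action `φ_b` of
`ν*_b F` on the fiber over `b` by time-one flows. -/
def IsPeriodBundle (Λ : BivectorField k B) (π : C^∞⟮𝓡 d, M; 𝓡 k, B⟯) (σ : DiffForm d M 2)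
    (P : ∀ b : B, AddSubgroup (Covec k b)) : Prop :=
  ∀ (b : B) (a : Covec k b), a ∈ P b ↔ a ∈ conormal Λ b ∧
    ∀ α : (∀ c : B, Covec k c), α b = a → ∀ m : M, π m = b → FlowsTo π σ α m m

/-- `(M, σ)` is an object of `ASCIR₀ (B, Π, P, Θ)`: its period bundle is `P` and its twisting
form is `dΘ`. -/
structure IsASCIR0 (Λ : BivectorField k B) (P : ∀ b : B, AddSubgroup (Covec k b))
    (Θ : DiffForm k B 2) (π : C^∞⟮𝓡 d, M; 𝓡 k, B⟯) (σ : DiffForm d M 2) : Prop where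
  isASCIR : IsASCIR Λ π σ (DiffForm.d Θ)
  period : IsPeriodBundle Λ π σ P

/-- The open set `π⁻¹(U)`. -/
def pre (π : C^∞⟮𝓡 d, M; 𝓡 k, B⟯) (U : Opens B) : Opens M :=
  ⟨π ⁻¹' U, U.2.preimage π.contMDiff.continuous⟩

open Classical in
/-- A bijection of `π⁻¹(U)`, extended by the identity to `M`; only its restriction to the open
set `π⁻¹(U)` is ever used. -/
def extendPerm {W : Opens M} (f : Equiv.Perm W) : Equiv.Perm M :=
  Equiv.Perm.ofSubtype (p := fun m => m ∈ W) f

theorem extendPerm_coe {W : Opens M} (f : Equiv.Perm W) (m : W) : extendPerm f m = f m := by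
  classical
  exact Equiv.Perm.ofSubtype_apply_coe (p := fun m => m ∈ W) f m

theorem extendPerm_mul {W : Opens M} (f g : Equiv.Perm W) :
    extendPerm (f * g) = extendPerm f * extendPerm g := by
  classical
  exact map_mul _ _ _

theorem extendPerm_one {W : Opens M} : extendPerm (1 : Equiv.Perm W) = 1 := by
  classical
  exact map_one _

/-- `f` is smooth on `W`, covers the identity of `B` and preserves `σ`. -/
structure IsAutMap (π : C^∞⟮𝓡 d, M; 𝓡 k, B⟯) (σ : DiffForm d M 2) {W : Opens M}
    (f : Equiv.Perm W) : Prop where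
  smooth : ContMDiffOn (𝓡 d) (𝓡 d) ∞ (extendPerm f) W
  proj : ∀ m : W, π (f m) = π m
  preserves : ∀ m ∈ W, DiffForm.pullback (extendPerm f) σ m = σ m

theorem IsAutMap.mdiff {π : C^∞⟮𝓡 d, M; 𝓡 k, B⟯} {σ : DiffForm d M 2} {W : Opens M}
    {f : Equiv.Perm W} (hf : IsAutMap π σ f) {m : M} (hm : m ∈ W) :
    MDifferentiableAt (𝓡 d) (𝓡 d) (extendPerm f) m :=
  (hf.smooth.contMDiffAt (W.2.mem_nhds hm)).mdifferentiableAt (by simp)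

theorem extendPerm_mem {W : Opens M} (f : Equiv.Perm W) {m : M} (hm : m ∈ W) :
    extendPerm f m ∈ W := by
  rw [extendPerm_coe f ⟨m, hm⟩]; exact (f _).2

theorem IsAutMap.one {π : C^∞⟮𝓡 d, M; 𝓡 k, B⟯} {σ : DiffForm d M 2} {W : Opens M} :
    IsAutMap π σ (1 : Equiv.Perm W) where
  smooth := by rw [extendPerm_one]; exact contMDiffOn_id
  proj := fun _ => rfl
  preserves := fun m _ => by
    rw [extendPerm_one]
    change (σ m).compContinuousLinearMap (mfderiv (𝓡 d) (𝓡 d) id m) = σ m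
    rw [mfderiv_id]
    rfl

theorem IsAutMap.mul {π : C^∞⟮𝓡 d, M; 𝓡 k, B⟯} {σ : DiffForm d M 2} {W : Opens M}
    {f g : Equiv.Perm W} (hf : IsAutMap π σ f) (hg : IsAutMap π σ g) : IsAutMap π σ (f * g) where
  smooth := by
    rw [extendPerm_mul]
    exact hf.smooth.comp hg.smooth fun m hm => extendPerm_mem g hm
  proj := fun m => (hf.proj (g m)).trans (hg.proj m)
  preserves := fun m hm => by
    have h1 : mfderiv (𝓡 d) (𝓡 d) (extendPerm (f * g)) m
        = (mfderiv (𝓡 d) (𝓡 d) (extendPerm f) (extendPerm g m)).comp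
          (mfderiv (𝓡 d) (𝓡 d) (extendPerm g) m) := by
      rw [extendPerm_mul]
      exact mfderiv_comp m (hf.mdiff (extendPerm_mem g hm)) (hg.mdiff hm)
    have h4 : extendPerm (f * g) m = extendPerm f (extendPerm g m) := by
      rw [extendPerm_mul]; rfl
    have h2 := hf.preserves _ (extendPerm_mem g hm)
    refine (comp_congr σ h4 h1).trans (Eq.trans ?_ (hg.preserves m hm))
    ext v
    exact congrArg (fun τ : EuclideanSpace ℝ (Fin d) [⋀^Fin 2]→L[ℝ] ℝ =>
      τ (fun i => (mfderiv (𝓡 d) (𝓡 d) (extendPerm g) m) (v i))) h2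

theorem IsAutMap.res {π : C^∞⟮𝓡 d, M; 𝓡 k, B⟯} {σ : DiffForm d M 2} {W W' : Opens M}
    (h : W ≤ W') {f : Equiv.Perm W'} (hf : IsAutMap π σ f) {g : Equiv.Perm W}
    (hg : ∀ m : W, (g m : M) = f ⟨m, h m.2⟩) : IsAutMap π σ g := by
  have heq : ∀ m ∈ W, extendPerm g m = extendPerm f m := fun m hm => by
    rw [extendPerm_coe g ⟨m, hm⟩, hg, extendPerm_coe f ⟨m, h hm⟩]
  refine ⟨(hf.smooth.mono h).congr heq, fun m => by rw [hg]; exact hf.proj ⟨m, h m.2⟩,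
    fun m hm => ?_⟩
  have h1 : extendPerm g =ᶠ[nhds m] extendPerm f :=
    Filter.eventually_of_mem (W.2.mem_nhds hm) heq
  exact (comp_congr σ (heq m hm) h1.mfderiv_eq).trans (hf.preserves m (h hm))

/-- The group of automorphisms of `(M, σ)` over `U`: the diffeomorphisms `f` of `π⁻¹(U)` with
`π ∘ f = π` and `f^* σ = σ`. -/
def autGroup (π : C^∞⟮𝓡 d, M; 𝓡 k, B⟯) (σ : DiffForm d M 2) (U : Opens B) :
    Subgroup (Equiv.Perm (pre π U)) where
  carrier := {f | IsAutMap π σ f ∧ IsAutMap π σ f⁻¹}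
  one_mem' := ⟨IsAutMap.one, by rw [inv_one]; exact IsAutMap.one⟩
  mul_mem' := fun hf hg => ⟨hf.1.mul hg.1, by rw [mul_inv_rev]; exact hg.2.mul hf.2⟩
  inv_mem' := fun hf => ⟨hf.2, by rw [inv_inv]; exact hf.1⟩

/-- The restriction of an automorphism over `V` to `π⁻¹(U)`, `U ⊆ V`. -/
def resPerm (π : C^∞⟮𝓡 d, M; 𝓡 k, B⟯) (σ : DiffForm d M 2) {U V : Opens B} (h : U ≤ V)
    (f : autGroup π σ V) : Equiv.Perm (pre π U) where
  toFun m := ⟨f.1 ⟨m, h m.2⟩, by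
    change π (f.1 ⟨m, h m.2⟩) ∈ U
    rw [f.2.1.proj]; exact m.2⟩
  invFun m := ⟨f.1⁻¹ ⟨m, h m.2⟩, by
    change π (f.1⁻¹ ⟨m, h m.2⟩ : pre π V) ∈ U
    rw [f.2.2.proj]; exact m.2⟩
  left_inv m := by
    have h1 := congrArg Subtype.val (f.1.symm_apply_apply ⟨m, h m.2⟩)
    exact Subtype.ext h1
  right_inv m := by
    have h1 := congrArg Subtype.val (f.1.apply_symm_apply ⟨m, h m.2⟩)
    exact Subtype.ext h1

theorem resPerm_mem (π : C^∞⟮𝓡 d, M; 𝓡 k, B⟯) (σ : DiffForm d M 2) {U V : Opens B} (h : U ≤ V)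
    (f : autGroup π σ V) : resPerm π σ h f ∈ autGroup π σ U :=
  have h' : pre π U ≤ pre π V := fun _ hm => h hm
  ⟨f.2.1.res h' fun _ => rfl, f.2.2.res h' fun _ => rfl⟩

/-- The presheaf of automorphisms of `(M, σ)`. -/
def autPresheaf (π : C^∞⟮𝓡 d, M; 𝓡 k, B⟯) (σ : DiffForm d M 2) :
    TopCat.Presheaf GrpCat.{u} (TopCat.of B) where
  obj U := GrpCat.of (autGroup π σ U.unop)
  map i := GrpCat.ofHom
    { toFun := fun f => ⟨resPerm π σ i.unop.le f, resPerm_mem π σ i.unop.le f⟩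
      map_one' := rfl
      map_mul' := fun _ _ => rfl }

theorem autGroup_local (π : C^∞⟮𝓡 d, M; 𝓡 k, B⟯) (σ : DiffForm d M 2) {W : Opens M}
    (f : Equiv.Perm W) (hf : ∀ m : W, ∃ (W' : Opens M) (h : W' ≤ W) (g : Equiv.Perm W'),
      (m : M) ∈ W' ∧ IsAutMap π σ g ∧ ∀ x : W', (g x : M) = f ⟨x, h x.2⟩) :
    IsAutMap π σ f := by
  refine ⟨fun m hm => ?_, fun m => ?_, fun m hm => ?_⟩
  · obtain ⟨W', h, g, hm', hg, hgf⟩ := hf ⟨m, hm⟩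
    have heq : ∀ x ∈ W', extendPerm f x = extendPerm g x := fun x hx => by
      rw [extendPerm_coe g ⟨x, hx⟩, hgf, extendPerm_coe f ⟨x, h hx⟩]
    exact (((hg.smooth.congr heq).contMDiffAt (W'.2.mem_nhds hm'))).contMDiffWithinAt
  · obtain ⟨W', h, g, hm', hg, hgf⟩ := hf m
    exact (congrArg π (hgf ⟨m, hm'⟩)).symm.trans (hg.proj ⟨m, hm'⟩)
  · obtain ⟨W', h, g, hm', hg, hgf⟩ := hf ⟨m, hm⟩
    have heq : ∀ x ∈ W', extendPerm f x = extendPerm g x := fun x hx => by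
      rw [extendPerm_coe g ⟨x, hx⟩, hgf, extendPerm_coe f ⟨x, h hx⟩]
    have h1 : extendPerm f =ᶠ[nhds m] extendPerm g :=
      Filter.eventually_of_mem (W'.2.mem_nhds hm') heq
    exact (comp_congr σ (heq m hm') h1.mfderiv_eq).trans (hg.preserves m hm')

theorem autPresheaf_isSheaf (π : C^∞⟮𝓡 d, M; 𝓡 k, B⟯) (σ : DiffForm d M 2) :
    (autPresheaf π σ).IsSheaf := by
  rw [TopCat.Presheaf.isSheaf_iff_isSheafUniqueGluing]
  intro ι U sf hsf
  have hmem : ∀ m : pre π (iSup U), ∃ i, π (m : M) ∈ U i := fun m => Opens.mem_iSup.1 m.2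
  choose idx hidx using hmem
  let g : ∀ i, autGroup π σ (U i) := fun i => (show autGroup π σ (U i) from sf i)
  have hcomp : ∀ i j (m : M) (hi : m ∈ pre π (U i)) (hj : m ∈ pre π (U j)),
      ((g i).1 ⟨m, hi⟩ : M) = (g j).1 ⟨m, hj⟩ := by
    intro i j m hi hj
    have h1 := congrArg Subtype.val (hsf i j)
    exact congrArg Subtype.val (Equiv.congr_fun h1 (⟨m, hi, hj⟩ : pre π (U i ⊓ U j)))
  have hcomp' : ∀ i j (m : M) (hi : m ∈ pre π (U i)) (hj : m ∈ pre π (U j)),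
      ((g i).1⁻¹ ⟨m, hi⟩ : pre π (U i)).1 = ((g j).1⁻¹ ⟨m, hj⟩ : pre π (U j)).1 := by
    intro i j m hi hj
    have h1 := congrArg Subtype.val (hsf i j)
    have h2 := congrArg (fun e : Equiv.Perm (pre π (U i ⊓ U j)) => e⁻¹) h1
    exact congrArg Subtype.val (Equiv.congr_fun h2 (⟨m, hi, hj⟩ : pre π (U i ⊓ U j)))
  have hle : ∀ i, pre π (U i) ≤ pre π (iSup U) := fun i m hm => le_iSup U i hm
  let F : Equiv.Perm (pre π (iSup U)) :=
    { toFun := fun m => ⟨(g (idx m)).1 ⟨m, hidx m⟩, hle _ ((g (idx m)).1 _).2⟩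
      invFun := fun m => ⟨((g (idx m)).1⁻¹ ⟨m, hidx m⟩ : pre π (U (idx m))).1,
        hle _ ((g (idx m)).1⁻¹ _).2⟩
      left_inv := fun m => by
        apply Subtype.ext
        refine (hcomp' _ (idx m) _ _ ((g (idx m)).1 _).2).trans ?_
        exact congrArg Subtype.val ((g (idx m)).1.symm_apply_apply ⟨m, hidx m⟩)
      right_inv := fun m => by
        apply Subtype.ext
        refine (hcomp _ (idx m) _ _ ((g (idx m)).1⁻¹ _).2).trans ?_
        exact congrArg Subtype.val ((g (idx m)).1.apply_symm_apply ⟨m, hidx m⟩) }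
  have hF : F ∈ autGroup π σ (iSup U) := by
    refine ⟨autGroup_local π σ F fun m => ?_, autGroup_local π σ F⁻¹ fun m => ?_⟩
    · exact ⟨pre π (U (idx m)), hle _, (g (idx m)).1, hidx m, (g (idx m)).2.1,
        fun x => hcomp _ _ _ _ _⟩
    · exact ⟨pre π (U (idx m)), hle _, (g (idx m)).1⁻¹, hidx m, (g (idx m)).2.2,
        fun x => hcomp' _ _ _ _ _⟩
  refine ⟨(⟨F, hF⟩ : autGroup π σ (iSup U)), fun i => Subtype.ext (Equiv.ext fun m =>
    Subtype.ext ?_), ?_⟩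
  · exact hcomp (idx ⟨m, hle i m.2⟩) i m _ m.2
  intro t ht
  apply Subtype.ext
  refine Equiv.ext fun m => Subtype.ext ?_
  have h1 := congrArg Subtype.val (ht (idx m))
  have h2 := congrArg Subtype.val (Equiv.congr_fun h1 (⟨m, hidx m⟩ : pre π (U (idx m))))
  exact h2

/-- The sheaf `Aut` of automorphisms of `(M, σ)`, a sheaf of groups under composition. -/
def autSheaf (π : C^∞⟮𝓡 d, M; 𝓡 k, B⟯) (σ : DiffForm d M 2) :
    TopCat.Sheaf GrpCat.{u} (TopCat.of B) := ⟨autPresheaf π σ, autPresheaf_isSheaf π σ⟩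

/-- `ι : O_P → Ω⁰_F` is the inclusion. -/
def IsInclusion {Λ : BivectorField k B} {P : ∀ b : B, AddSubgroup (Covec k b)}
    (ι : (structureSheaf P).sheaf ⟶ (Omega0 Λ).sheaf) : Prop :=
  ∀ (U : Opens B) (f : (structureSheaf P).carrier U),
    ((ι.hom.app (op U)).hom f : (Omega0 Λ).carrier U).1 = f.1

/-- `δ : Ω⁰_F → Z¹_F` is the exterior differential. -/
def IsDifferential {Λ : BivectorField k B} (δ : (Omega0 Λ).sheaf ⟶ (Z1 Λ).sheaf) : Prop :=
  ∀ (U : Opens B) (f : (Omega0 Λ).carrier U),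
    ((δ.hom.app (op U)).hom f : (Z1 Λ).carrier U).1 = dSection f.1

/-- `φ : Z¹_F → Aut` sends `α` to the time-one flow of `σ♯ (π^* α)`. -/
def IsTimeOneFlow {Λ : BivectorField k B} {π : C^∞⟮𝓡 d, M; 𝓡 k, B⟯} {σ : DiffForm d M 2}
    (φ : asGroups (Z1 Λ).sheaf ⟶ autSheaf π σ) : Prop :=
  ∀ (U : Opens B) (α : (Z1 Λ).carrier U) (m : pre π U),
    FlowsTo π σ (extend α.1) m
      (((φ.hom.app (op U)).hom (Multiplicative.ofAdd α) : autGroup π σ U).1 m)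

end Realization

end

end ASCIR

/-! The key formula is `φ(α)^*σ = σ + π^*dα` for every smooth field of covectors `α` vanishing on
the leaves, closed or not. It shows that closed forms flow by automorphisms and that any `α` whose
flow is an automorphism is closed.

It is proved in coordinates. Write `M` locally as `S × Z` with `π` the first projection. Contracting
`σ` with vertical vectors gives a one-form along each fibre with values in the covectors of the
base; isotropy and `dσ = π^*η` make it closed, so it has a primitive `U` along the fibres
(`FlatModel.exists_primitive`). Read `U` as a horizontal one-form on `S × Z`. Then `σ - dU` is basic
(`sub_dPrimitive_eq`), so a fibre-preserving map with `U ∘ G = U + α` changes `σ` by exactly `dα`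
(`pullback_eq`). The vertical field `X` with `ι_X σ = π^*a` moves `U` at the constant velocity `a`.
A linear projection `p` that is injective on the conormal spaces turns `U` into fibre coordinates
`pU`, in which all these flows are translations (`exists_actionChart`).

The almost Poisson condition says that `X` is vertical exactly when `a` is conormal. Compactness of
the fibres makes the local translations into an action of the conormal space `ν*_b F` on the whole
fibre (`exists_fiber_action`), and connectedness makes this action transitive (`exists_act_eq`). The
formula passes from small multiples of `α` to `α` by iteration (`shiftsForm_act`).

An automorphism commutes with this abelian transitive action, so on each fibre it is the action of
one covector. Comparing a local section with its image shows that the covector can be chosen smooth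
in the base point, and the formula makes the resulting form closed (`IsSymmetry.exists_eq_act`).
Thus `φ` is locally surjective. Its kernel is `𝒫` by the definition of the period bundle, and
sections of `P` are closed by the formula with `φ(α) = id`. By the Poincaré lemma `d : Ω⁰_F → Z¹_F`
is locally surjective too. This gives the exact sequence, and the isomorphism follows because `Z¹_F
→ K_F` and `φ` are locally surjective with the same kernel (`exists_iso_of_ker_eq`). -/

namespace ASCIR

/-! ### Smoothness of integrals over `[0, 1]` depending on a parameter. -/

section ParametricIntegral

open MeasureTheory Set

variable {H G : Type u} [NormedAddCommGroup H] [NormedAddCommGroup G]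

/-- The tube lemma around the compact set `{x₀} × [0, 1]` gives a bound uniform in the time and in
nearby parameters: the dominating constant needed for continuity and differentiation under the
integral. -/
theorem exists_nhds_norm_le {f : H × ℝ → G} {Ω : Set (H × ℝ)} (hΩ : IsOpen Ω)
    (hf : ContinuousOn f Ω) {x₀ : H} (hx₀ : ∀ t ∈ Icc (0 : ℝ) 1, (x₀, t) ∈ Ω) :
    ∃ C : ℝ, ∃ u ∈ nhds x₀, ∀ x ∈ u, ∀ t ∈ Icc (0 : ℝ) 1, (x, t) ∈ Ω ∧ ‖f (x, t)‖ ≤ C := by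
  have hcomp : IsCompact (({x₀} : Set H) ×ˢ Icc (0 : ℝ) 1) := isCompact_singleton.prod isCompact_Icc
  have hsub : ({x₀} : Set H) ×ˢ Icc (0 : ℝ) 1 ⊆ Ω := by
    rintro ⟨x, t⟩ ⟨hx, ht⟩
    obtain rfl : x = x₀ := hx
    exact hx₀ t ht
  obtain ⟨C, hC⟩ := hcomp.exists_bound_of_continuousOn (hf.mono hsub)
  have hopen : IsOpen (Ω ∩ (fun z => ‖f z‖) ⁻¹' Iio (C + 1)) :=
    hf.norm.isOpen_inter_preimage hΩ isOpen_Iio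
  have hsub' : ({x₀} : Set H) ×ˢ Icc (0 : ℝ) 1 ⊆ Ω ∩ (fun z => ‖f z‖) ⁻¹' Iio (C + 1) :=
    fun z hz => ⟨hsub hz, (hC z hz).trans_lt (lt_add_one C)⟩
  obtain ⟨u, v, hu, -, hxu, hv, huv⟩ :=
    generalized_tube_lemma isCompact_singleton isCompact_Icc hopen hsub'
  refine ⟨C + 1, u, hu.mem_nhds (hxu rfl), fun x hx t ht => ?_⟩
  have h := huv (mk_mem_prod hx (hv ht))
  exact ⟨h.1, (show ‖f (x, t)‖ < C + 1 from h.2).le⟩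

theorem intervalIntegrable_slice {f : H × ℝ → G} {Ω : Set (H × ℝ)}
    (hf : ContinuousOn f Ω) {x : H} (hx : ∀ t ∈ Icc (0 : ℝ) 1, (x, t) ∈ Ω) :
    IntervalIntegrable (fun t => f (x, t)) volume 0 1 := by
  apply ContinuousOn.intervalIntegrable
  rw [uIcc_of_le zero_le_one]
  exact hf.comp (by fun_prop) hx

variable [NormedSpace ℝ G]

theorem continuousOn_intervalIntegral {f : H × ℝ → G} {Ω : Set (H × ℝ)} (hΩ : IsOpen Ω)
    (hf : ContinuousOn f Ω) {S : Set H} (hS : ∀ x ∈ S, ∀ t ∈ Icc (0 : ℝ) 1, (x, t) ∈ Ω) :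
    ContinuousOn (fun x => ∫ t in (0 : ℝ)..1, f (x, t)) S := by
  intro x₀ hx₀
  obtain ⟨C, u, hu, hC⟩ := exists_nhds_norm_le hΩ hf (hS x₀ hx₀)
  apply ContinuousAt.continuousWithinAt
  apply intervalIntegral.continuousAt_of_dominated_interval (bound := fun _ => C)
  · filter_upwards [hu] with x hx
    exact (intervalIntegrable_iff.1
      (intervalIntegrable_slice hf fun t ht => (hC x hx t ht).1)).aestronglyMeasurable
  · filter_upwards [hu] with x hx
    refine Filter.Eventually.of_forall fun t ht => (hC x hx t ?_).2
    rw [uIoc_of_le zero_le_one] at ht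
    exact ⟨ht.1.le, ht.2⟩
  · exact intervalIntegrable_const
  · refine Filter.Eventually.of_forall fun t ht => ?_
    rw [uIoc_of_le zero_le_one] at ht
    exact ContinuousAt.comp (hf.continuousAt (hΩ.mem_nhds (hS x₀ hx₀ t ⟨ht.1.le, ht.2⟩)))
      (by fun_prop : ContinuousAt (fun x : H => (x, t)) x₀)

variable [NormedSpace ℝ H]

theorem hasFDerivAt_intervalIntegral {f : H × ℝ → G} {Ω : Set (H × ℝ)} (hΩ : IsOpen Ω)
    (hf : ContDiffOn ℝ 1 f Ω) {x₀ : H} (hx₀ : ∀ t ∈ Icc (0 : ℝ) 1, (x₀, t) ∈ Ω) :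
    HasFDerivAt (fun x => ∫ t in (0 : ℝ)..1, f (x, t))
      (∫ t in (0 : ℝ)..1, (fderiv ℝ f (x₀, t)).comp (ContinuousLinearMap.inl ℝ H ℝ)) x₀ := by
  have hf' : ContinuousOn
      (fun z => (fderiv ℝ f z).comp (ContinuousLinearMap.inl ℝ H ℝ)) Ω :=
    ((ContinuousLinearMap.compL ℝ H (H × ℝ) G).flip
      (ContinuousLinearMap.inl ℝ H ℝ)).continuous.comp_continuousOn
      (hf.continuousOn_fderiv_of_isOpen hΩ le_rfl)
  obtain ⟨C, u, hu, hC⟩ := exists_nhds_norm_le hΩ hf' hx₀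
  have hIoc : ∀ t, t ∈ Set.uIoc (0 : ℝ) 1 → t ∈ Icc (0 : ℝ) 1 := fun t ht => by
    rw [uIoc_of_le zero_le_one] at ht
    exact ⟨ht.1.le, ht.2⟩
  apply intervalIntegral.hasFDerivAt_integral_of_dominated_of_fderiv_le
    (F := fun x t => f (x, t))
    (F' := fun x t => (fderiv ℝ f (x, t)).comp (ContinuousLinearMap.inl ℝ H ℝ))
    (bound := fun _ => C) hu
  · filter_upwards [hu] with x hx
    exact (intervalIntegrable_iff.1 (intervalIntegrable_slice hf.continuousOn
      fun t ht => (hC x hx t ht).1)).aestronglyMeasurable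
  · exact intervalIntegrable_slice hf.continuousOn hx₀
  · exact (intervalIntegrable_iff.1 (intervalIntegrable_slice hf' hx₀)).aestronglyMeasurable
  · exact Filter.Eventually.of_forall fun t ht x hx => (hC x hx t (hIoc t ht)).2
  · exact intervalIntegrable_const
  · refine Filter.Eventually.of_forall fun t ht x hx => ?_
    have h1 : HasFDerivAt f (fderiv ℝ f (x, t)) (x, t) :=
      ((hf.differentiableOn one_ne_zero).differentiableAt
        (hΩ.mem_nhds (hC x hx t (hIoc t ht)).1)).hasFDerivAt
    exact h1.comp x (hasFDerivAt_prodMk_left x t)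

/-- Induction on the order: the derivative of the integral is the integral of the partial
derivative, an integral of the same kind. The target space is quantified inside the induction
because that derivative takes values in `H →L[ℝ] G`. -/
theorem contDiffOn_nat_intervalIntegral (n : ℕ) : ∀ {G : Type u} [NormedAddCommGroup G]
    [NormedSpace ℝ G] {f : H × ℝ → G} {Ω : Set (H × ℝ)} (_ : IsOpen Ω)
    (_ : ContDiffOn ℝ n f Ω) {S : Set H} (_ : IsOpen S)
    (_ : ∀ x ∈ S, ∀ t ∈ Icc (0 : ℝ) 1, (x, t) ∈ Ω),
    ContDiffOn ℝ n (fun x => ∫ t in (0 : ℝ)..1, f (x, t)) S := by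
  induction n with
  | zero =>
    intro G _ _ f Ω hΩ hf S hS hSΩ
    exact contDiffOn_zero.2 (continuousOn_intervalIntegral hΩ hf.continuousOn hSΩ)
  | succ n ih =>
    intro G _ _ f Ω hΩ hf S hS hSΩ
    have h1 : ContDiffOn ℝ 1 f Ω := hf.of_le (by exact_mod_cast Nat.le_add_left 1 n)
    have hd := fun x (hx : x ∈ S) => hasFDerivAt_intervalIntegral hΩ h1 (hSΩ x hx)
    push_cast
    rw [contDiffOn_succ_iff_fderiv_of_isOpen hS]
    refine ⟨fun x hx => (hd x hx).differentiableAt.differentiableWithinAt, by simp, ?_⟩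
    have hf' : ContDiffOn ℝ n
        (fun z => (fderiv ℝ f z).comp (ContinuousLinearMap.inl ℝ H ℝ)) Ω :=
      ((ContinuousLinearMap.compL ℝ H (H × ℝ) G).flip
        (ContinuousLinearMap.inl ℝ H ℝ)).contDiff.comp_contDiffOn
        (hf.fderiv_of_isOpen hΩ (by push_cast; exact le_rfl))
    exact (ih hΩ hf' hS hSΩ).congr fun x hx => (hd x hx).fderiv

theorem contDiffOn_intervalIntegral {f : H × ℝ → G} {Ω : Set (H × ℝ)} (hΩ : IsOpen Ω)
    (hf : ContDiffOn ℝ ∞ f Ω) {S : Set H} (hS : IsOpen S)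
    (hSΩ : ∀ x ∈ S, ∀ t ∈ Icc (0 : ℝ) 1, (x, t) ∈ Ω) :
    ContDiffOn ℝ ∞ (fun x => ∫ t in (0 : ℝ)..1, f (x, t)) S :=
  contDiffOn_infty.2 fun n =>
    contDiffOn_nat_intervalIntegral n hΩ (contDiffOn_infty.1 hf n) hS hSΩ

end ParametricIntegral


/-! ### Alternating forms of low degree as multilinear maps. -/

section Forms

variable {X : Type*} [NormedAddCommGroup X] [NormedSpace ℝ X]

/-- An alternating `2`-form as a bilinear form. -/
noncomputable def asBilin (c : X [⋀^Fin 2]→L[ℝ] ℝ) : X →L[ℝ] X →L[ℝ] ℝ :=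
  ((ContinuousAlternatingMap.ofSubsingletonLIE (𝕜 := ℝ) (E := X) (F := ℝ)
    (0 : Fin 1)).symm.toContinuousLinearEquiv.toContinuousLinearMap).comp c.curryLeft

theorem asBilin_apply (c : X [⋀^Fin 2]→L[ℝ] ℝ) (v w : X) : asBilin c v w = c ![v, w] := by
  change c (Matrix.vecCons v fun _ : Fin 1 => w) = _
  congr 1
  ext i
  fin_cases i <;> rfl

theorem form_eq_vecCons (c : X [⋀^Fin 2]→L[ℝ] ℝ) (v : Fin 2 → X) : c v = c ![v 0, v 1] := by
  congr 1
  ext i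
  fin_cases i <;> rfl

theorem asBilin_injective : Function.Injective (asBilin (X := X)) := by
  intro c c' h
  ext v
  rw [form_eq_vecCons, form_eq_vecCons c', ← asBilin_apply, h, asBilin_apply]

theorem form_swap (c : X [⋀^Fin 2]→L[ℝ] ℝ) (v w : X) : c ![v, w] = - c ![w, v] := by
  have h : c (![w, v] ∘ Equiv.swap 0 1) = - c ![w, v] :=
    c.toAlternatingMap.map_swap ![w, v] (i := 0) (j := 1) (by decide)
  rw [← h]
  congr 1
  ext i
  fin_cases i <;> rfl

theorem extDeriv_one_form {s : X → X →L[ℝ] ℝ} {x : X} (hs : DifferentiableAt ℝ s x)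
    (v : Fin 2 → X) :
    extDeriv (fun y => ContinuousAlternatingMap.ofSubsingleton ℝ X ℝ (0 : Fin 1) (s y)) x v
      = fderiv ℝ s x (v 0) (v 1) - fderiv ℝ s x (v 1) (v 0) := by
  have h1 : HasFDerivAt
      (fun y => ContinuousAlternatingMap.ofSubsingleton ℝ X ℝ (0 : Fin 1) (s y))
      (((ContinuousAlternatingMap.ofSubsingletonLIE (𝕜 := ℝ) (E := X) (F := ℝ)
        (0 : Fin 1)).toContinuousLinearEquiv.toContinuousLinearMap).comp (fderiv ℝ s x)) x :=
    (ContinuousAlternatingMap.ofSubsingletonLIE (𝕜 := ℝ) (E := X) (F := ℝ)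
        (0 : Fin 1)).toContinuousLinearEquiv.toContinuousLinearMap.hasFDerivAt.comp x
        hs.hasFDerivAt
  have key : ∀ (w : Fin 1 → X) (z : X), fderiv ℝ (fun y =>
      ContinuousAlternatingMap.ofSubsingleton ℝ X ℝ (0 : Fin 1) (s y) w) x z
      = fderiv ℝ s x z (w 0) := by
    intro w z
    have := hs.hasFDerivAt.clm_apply (hasFDerivAt_const (w 0) x)
    change fderiv ℝ (fun y => s y (w 0)) x z = _
    rw [this.fderiv]
    simp
  rw [extDeriv_apply h1.differentiableAt, Fin.sum_univ_two, key, key]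
  simp [Fin.removeNth]
  ring

variable {H : Type*} [NormedAddCommGroup H] [NormedSpace ℝ H]

theorem contDiffAt_one_form {n : ℕ∞ω} {s : H → X →L[ℝ] ℝ} {x : H} :
    ContDiffAt ℝ n
      (fun y => ContinuousAlternatingMap.ofSubsingleton ℝ X ℝ (0 : Fin 1) (s y)) x
      ↔ ContDiffAt ℝ n s x :=
  (ContinuousAlternatingMap.ofSubsingletonLIE (𝕜 := ℝ) (E := X) (F := ℝ)
    (0 : Fin 1)).toContinuousLinearEquiv.comp_contDiffAt_iff

variable [FiniteDimensional ℝ X]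

theorem contDiffAt_clm_apply_iff {F : Type*} [NormedAddCommGroup F] [NormedSpace ℝ F] {n : ℕ∞ω}
    {f : H → X →L[ℝ] F} {x : H} :
    ContDiffAt ℝ n f x ↔ ∀ v, ContDiffAt ℝ n (fun y => f y v) x := by
  refine ⟨fun h v => h.clm_apply contDiffAt_const, fun h => ?_⟩
  let e := (ContinuousLinearEquiv.ofFinrankEq
    (Module.finrank_fin_fun ℝ (n := Module.finrank ℝ X)).symm : X ≃L[ℝ] _)
  let e₂ := (e.arrowCongr (1 : F ≃L[ℝ] F)).trans (ContinuousLinearEquiv.piRing (Fin _))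
  rw [← Function.id_comp f, ← e₂.symm_comp_self]
  exact e₂.symm.contDiff.contDiffAt.comp x (contDiffAt_pi.2 fun i => h _)

theorem contDiffAt_asBilin {n : ℕ∞ω} {s : H → X [⋀^Fin 2]→L[ℝ] ℝ} {x : H}
    (h : ContDiffAt ℝ n s x) : ContDiffAt ℝ n (fun y => asBilin (s y)) x := by
  rw [contDiffAt_clm_apply_iff]
  intro v
  rw [contDiffAt_clm_apply_iff]
  intro w
  simp only [asBilin_apply]
  exact (ContinuousAlternatingMap.apply ℝ X ℝ ![v, w]).contDiff.contDiffAt.comp x h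

/-- Finite dimension enters here: the injective linear map `asBilin` has a linear left inverse,
which is automatically continuous, so smoothness can be tested on the bilinear form. -/
theorem contDiffAt_two_form {n : ℕ∞ω} {s : H → X [⋀^Fin 2]→L[ℝ] ℝ} {x : H}
    (h : ContDiffAt ℝ n (fun y => asBilin (s y)) x) : ContDiffAt ℝ n s x := by
  let b : (X [⋀^Fin 2]→L[ℝ] ℝ) →ₗ[ℝ] (X →L[ℝ] X →L[ℝ] ℝ) :=
    { toFun := asBilin
      map_add' := fun _ _ => rfl
      map_smul' := fun _ _ => rfl }
  obtain ⟨g, hg⟩ := LinearMap.exists_leftInverse_of_injective (K := ℝ)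
    (V := X [⋀^Fin 2]→L[ℝ] ℝ) (V' := X →L[ℝ] X →L[ℝ] ℝ) b (LinearMap.ker_eq_bot.2 asBilin_injective)
  have h1 := (LinearMap.toContinuousLinearMap g).contDiff.contDiffAt.comp x h
  refine h1.congr_of_eventuallyEq (Filter.Eventually.of_forall fun y => ?_)
  exact (LinearMap.congr_fun hg (s y)).symm

theorem extDeriv_two_form {s : X → X [⋀^Fin 2]→L[ℝ] ℝ} {x : X} (hs : ContDiffAt ℝ 1 s x)
    (v : Fin 3 → X) :
    extDeriv s x v = fderiv ℝ (fun y => asBilin (s y)) x (v 0) (v 1) (v 2)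
      - fderiv ℝ (fun y => asBilin (s y)) x (v 1) (v 0) (v 2)
      + fderiv ℝ (fun y => asBilin (s y)) x (v 2) (v 0) (v 1) := by
  have hB := ((contDiffAt_asBilin hs).differentiableAt one_ne_zero).hasFDerivAt
  have key : ∀ (w : Fin 2 → X) (z : X), fderiv ℝ (fun y => s y w) x z
      = fderiv ℝ (fun y => asBilin (s y)) x z (w 0) (w 1) := by
    intro w z
    have h : (fun y => s y w) = fun y => asBilin (s y) (w 0) (w 1) := by
      funext y
      rw [asBilin_apply, ← form_eq_vecCons]
    rw [h]
    have := (hB.clm_apply (hasFDerivAt_const (w 0) x)).clm_apply (hasFDerivAt_const (w 1) x)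
    rw [this.fderiv]
    simp
  rw [extDeriv_apply (hs.differentiableAt one_ne_zero), Fin.sum_univ_three, key, key, key]
  have h2 : Fin.succAbove (2 : Fin 3) (1 : Fin 2) = 1 := rfl
  simp [Fin.removeNth, h2]
  ring

theorem contDiffAt_two_form_pullback {Y : Type*} [NormedAddCommGroup Y] [NormedSpace ℝ Y]
    [FiniteDimensional ℝ Y] {n : ℕ∞ω} {s : H → X [⋀^Fin 2]→L[ℝ] ℝ} {A : H → Y →L[ℝ] X} {x : H}
    (hs : ContDiffAt ℝ n s x) (hA : ContDiffAt ℝ n A x) :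
    ContDiffAt ℝ n (fun y => (s y).compContinuousLinearMap (A y)) x := by
  apply contDiffAt_two_form
  have h1 := contDiffAt_asBilin hs
  rw [contDiffAt_clm_apply_iff]
  intro v
  rw [contDiffAt_clm_apply_iff]
  intro w
  have h2 : (fun y => asBilin ((s y).compContinuousLinearMap (A y)) v w) =
      fun y => asBilin (s y) (A y v) (A y w) := by
    funext y
    rw [asBilin_apply, asBilin_apply, ContinuousAlternatingMap.compContinuousLinearMap_apply]
    congr 1
    ext i
    fin_cases i <;> rfl
  rw [h2]
  exact (h1.clm_apply (hA.clm_apply contDiffAt_const)).clm_apply (hA.clm_apply contDiffAt_const)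

end Forms


/-! ### The local model `S × Z` and the fibrewise primitive of the form. -/

section Flat

open Set

variable {E K : Type} [NormedAddCommGroup E] [NormedSpace ℝ E]
  [NormedAddCommGroup K] [NormedSpace ℝ K]

/-- A nondegenerate `2`-form `β` on `S × Z` for which the fibers of the projection to `S` are
isotropic, `N y` consisting of the covectors `β (v, ·)` with `v` vertical, and whose differential
vanishes when contracted with a vertical vector. -/
structure FlatModel (S : Set E) (Z : Set K) (β : E × K → E × K →L[ℝ] E × K →L[ℝ] ℝ)
    (N : E → Submodule ℝ (E →L[ℝ] ℝ)) : Prop where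
  isOpen_base : IsOpen S
  isOpen_fiber : IsOpen Z
  convex_fiber : Convex ℝ Z
  smooth : ∀ x ∈ S ×ˢ Z, ContDiffAt ℝ ∞ β x
  skew : ∀ x v w, β x v w = - β x w v
  isotropic : ∀ x ∈ S ×ˢ Z, ∀ ζ ζ', β x (0, ζ) (0, ζ') = 0
  nondegenerate : ∀ x ∈ S ×ˢ Z, ∀ v, (∀ w, β x v w = 0) → v = 0
  mem_iff : ∀ x ∈ S ×ˢ Z, ∀ a : E →L[ℝ] ℝ, a ∈ N x.1 ↔ ∃ ζ, ∀ w, β x (0, ζ) w = a w.1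
  closed : ∀ x ∈ S ×ˢ Z, ∀ ζ v w, fderiv ℝ β x (0, ζ) v w - fderiv ℝ β x v (0, ζ) w
    + fderiv ℝ β x w (0, ζ) v = 0

/-- The contraction of `b` with vertical vectors, a covector on the base. -/
noncomputable def vert (b : E × K →L[ℝ] E × K →L[ℝ] ℝ) : K →L[ℝ] E →L[ℝ] ℝ :=
  ((ContinuousLinearMap.compL ℝ E (E × K) ℝ).flip (ContinuousLinearMap.inl ℝ E K)).comp
    (b.comp (ContinuousLinearMap.inr ℝ E K))

theorem vert_apply (β : E × K →L[ℝ] E × K →L[ℝ] ℝ) (ζ : K) (η : E) :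
    vert β ζ η = β (0, ζ) (η, 0) := rfl

theorem fderiv_clm_apply_const {H X F : Type*} [NormedAddCommGroup H] [NormedSpace ℝ H]
    [NormedAddCommGroup X] [NormedSpace ℝ X] [NormedAddCommGroup F] [NormedSpace ℝ F]
    {f : H → X →L[ℝ] F} {x : H} (hf : DifferentiableAt ℝ f x) (v : X) (z : H) :
    fderiv ℝ (fun y => f y v) x z = fderiv ℝ f x z v := by
  rw [(hf.hasFDerivAt.clm_apply (hasFDerivAt_const v x)).fderiv]
  simp

namespace FlatModel

variable {S : Set E} {Z : Set K} {β : E × K → E × K →L[ℝ] E × K →L[ℝ] ℝ}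
    {N : E → Submodule ℝ (E →L[ℝ] ℝ)} (h : FlatModel S Z β N)

include h

theorem isOpen_prod : IsOpen (S ×ˢ Z) := h.isOpen_base.prod h.isOpen_fiber

theorem vert_eq {x : E × K} (hx : x ∈ S ×ˢ Z) (ζ : K) (w : E × K) :
    β x (0, ζ) w = vert (β x) ζ w.1 := by
  have : w = (w.1, 0) + (0, w.2) := by simp
  conv_lhs => rw [this]
  rw [map_add, h.isotropic x hx, add_zero, vert_apply]

theorem mem_iff_vert {x : E × K} (hx : x ∈ S ×ˢ Z) (a : E →L[ℝ] ℝ) :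
    a ∈ N x.1 ↔ ∃ ζ, vert (β x) ζ = a := by
  rw [h.mem_iff x hx]
  refine exists_congr fun ζ => ⟨fun H => ?_, fun H w => ?_⟩
  · ext η
    rw [vert_apply, H]
  · rw [h.vert_eq hx, H]

theorem vert_mem {x : E × K} (hx : x ∈ S ×ˢ Z) (ζ : K) : vert (β x) ζ ∈ N x.1 :=
  (h.mem_iff_vert hx _).2 ⟨ζ, rfl⟩

theorem vert_injective {x : E × K} (hx : x ∈ S ×ˢ Z) {ζ : K} (hζ : vert (β x) ζ = 0) : ζ = 0 := by
  have := h.nondegenerate x hx (0, ζ) fun w => by rw [h.vert_eq hx, hζ]; rfl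
  exact congrArg Prod.snd this

theorem differentiableAt_form {x : E × K} (hx : x ∈ S ×ˢ Z) : DifferentiableAt ℝ β x :=
  (h.smooth x hx).differentiableAt (by simp)

theorem fderiv_form_apply {x : E × K} (hx : x ∈ S ×ˢ Z) (v w z : E × K) :
    fderiv ℝ (fun y => β y v w) x z = fderiv ℝ β x z v w := by
  have hβ := h.differentiableAt_form hx
  rw [fderiv_clm_apply_const (hβ.clm_apply (differentiableAt_const v)),
    fderiv_clm_apply_const hβ]

theorem fderiv_isotropic {x : E × K} (hx : x ∈ S ×ˢ Z) (ζ ζ' : K) (z : E × K) :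
    fderiv ℝ β x z (0, ζ) (0, ζ') = 0 := by
  rw [← h.fderiv_form_apply hx]
  have : (fun y => β y (0, ζ) (0, ζ')) =ᶠ[nhds x] fun _ => 0 :=
    Filter.eventually_of_mem (h.isOpen_prod.mem_nhds hx) fun y hy => h.isotropic y hy ζ ζ'
  rw [this.fderiv_eq]
  simp

variable [FiniteDimensional ℝ E] [FiniteDimensional ℝ K]

theorem contDiffAt_vert {x : E × K} (hx : x ∈ S ×ˢ Z) :
    ContDiffAt ℝ ∞ (fun y => vert (β y)) x := by
  rw [contDiffAt_clm_apply_iff]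
  intro ζ
  rw [contDiffAt_clm_apply_iff]
  intro η
  exact ((h.smooth x hx).clm_apply contDiffAt_const).clm_apply contDiffAt_const

theorem fderiv_vert {x : E × K} (hx : x ∈ S ×ˢ Z) (z : E × K) (ζ : K) (η : E) :
    fderiv ℝ (fun y => vert (β y)) x z ζ η = fderiv ℝ β x z (0, ζ) (η, 0) := by
  have hd : DifferentiableAt ℝ (fun y => vert (β y)) x :=
    (h.contDiffAt_vert hx).differentiableAt (by simp)
  rw [← h.fderiv_form_apply hx, ← fderiv_clm_apply_const hd,
    ← fderiv_clm_apply_const (hd.clm_apply (differentiableAt_const ζ))]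
  rfl

/-- The covector-valued primitive of `vert β` along the fibers. -/
theorem exists_primitive {z₀ : K} (hz₀ : z₀ ∈ Z) :
    ∃ U : E × K → E →L[ℝ] ℝ, (∀ x ∈ S ×ˢ Z, ContDiffAt ℝ ∞ U x) ∧
      (∀ x ∈ S ×ˢ Z, ∀ ζ, fderiv ℝ U x (0, ζ) = vert (β x) ζ) ∧ ∀ x ∈ S ×ˢ Z, U x ∈ N x.1 := by
  -- The Poincaré primitive: over each `y`, the one-form `vert β` is integrated along the segment
  -- from `(y, z₀)` to the given point of the fibre.
  let f : (E × K) × ℝ → E →L[ℝ] ℝ := fun q =>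
    vert (β (q.1.1, AffineMap.lineMap z₀ q.1.2 q.2)) (q.1.2 - z₀)
  have hline : ∀ x ∈ S ×ˢ Z, ∀ t ∈ Icc (0 : ℝ) 1, (x.1, AffineMap.lineMap z₀ x.2 t) ∈ S ×ˢ Z :=
    fun x hx t ht => ⟨hx.1, h.convex_fiber.lineMap_mem hz₀ hx.2 ht⟩
  let g : (E × K) × ℝ → E × K := fun q => (q.1.1, AffineMap.lineMap z₀ q.1.2 q.2)
  have hg : ContDiff ℝ ∞ g := by
    simp only [g, AffineMap.lineMap_apply]
    simp only [vsub_eq_sub, vadd_eq_add]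
    fun_prop
  let Ω : Set ((E × K) × ℝ) := g ⁻¹' (S ×ˢ Z)
  have hΩ : IsOpen Ω := h.isOpen_prod.preimage hg.continuous
  have hf : ContDiffOn ℝ ∞ f Ω := fun q hq => by
    apply ContDiffAt.contDiffWithinAt
    have h1 : ContDiffAt ℝ ∞ (fun q => vert (β (g q))) q :=
      ContDiffAt.comp (g := fun y => vert (β y)) q (h.contDiffAt_vert hq) hg.contDiffAt
    exact h1.clm_apply (by fun_prop)
  have hU : ContDiffOn ℝ ∞ (fun x => ∫ t in (0 : ℝ)..1, f (x, t)) (S ×ˢ Z) :=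
    contDiffOn_intervalIntegral hΩ hf h.isOpen_prod hline
  have hUat : ∀ x ∈ S ×ˢ Z, ContDiffAt ℝ ∞ (fun x => ∫ t in (0 : ℝ)..1, f (x, t)) x :=
    fun x hx => hU.contDiffAt (h.isOpen_prod.mem_nhds hx)
  refine ⟨fun x => ∫ t in (0 : ℝ)..1, f (x, t), hUat, fun x hx ζ => ?_, fun x hx => ?_⟩
  · have hω : ∀ z ∈ Z, HasFDerivAt (fun z => vert (β (x.1, z)))
        ((fderiv ℝ (fun y => vert (β y)) (x.1, z)).comp (ContinuousLinearMap.inr ℝ E K)) z := by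
      intro z hz
      exact HasFDerivAt.comp (g := fun y => vert (β y)) z
        ((h.contDiffAt_vert (x := (x.1, z)) ⟨hx.1, hz⟩).differentiableAt (by simp)).hasFDerivAt
        (hasFDerivAt_prodMk_right (𝕜 := ℝ) x.1 z)
    -- The Poincaré lemma on the convex fibre. Its symmetry condition is `closed` on two vertical
    -- vectors and one horizontal vector, where the third term drops out by isotropy.
    have key := h.convex_fiber.hasFDerivWithinAt_curveIntegral_segment_of_hasFDerivWithinAt_symmetric
      (fun z hz => (hω z hz).hasFDerivWithinAt) (fun z hz ζ _ ζ' _ => by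
        have hz' : (x.1, z) ∈ S ×ˢ Z := ⟨hx.1, hz⟩
        ext η
        change fderiv ℝ (fun y => vert (β y)) (x.1, z) (0, ζ) ζ' η
          = fderiv ℝ (fun y => vert (β y)) (x.1, z) (0, ζ') ζ η
        have := h.closed _ hz' ζ (0, ζ') (η, 0)
        rw [h.fderiv_isotropic hz', add_zero] at this
        rw [h.fderiv_vert hz', h.fderiv_vert hz']
        exact sub_eq_zero.1 this) hz₀ hx.2
    simp only [curveIntegral_segment] at key
    have key' := key.hasFDerivAt (h.isOpen_fiber.mem_nhds hx.2)
    have h2 := HasFDerivAt.comp (g := fun x => ∫ t in (0 : ℝ)..1, f (x, t)) x.2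
      ((hUat x hx).differentiableAt (by simp)).hasFDerivAt
      (hasFDerivAt_prodMk_right (𝕜 := ℝ) x.1 x.2)
    have h3 := congrArg (fun A => A ζ) (h2.unique key')
    exact h3
  · have hx' : ∀ t ∈ Icc (0 : ℝ) 1, (x, t) ∈ Ω := hline x hx
    change ∫ t in (0 : ℝ)..1, f (x, t) ∈ N x.1
    rw [intervalIntegral.integral_of_le zero_le_one]
    have : MeasureTheory.IsProbabilityMeasure
        (MeasureTheory.volume.restrict (Ioc (0 : ℝ) 1)) := ⟨by simp⟩
    -- The integrand lies in the single subspace `N x.1`, since the segment stays over `x.1`. An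
    -- average over a probability measure remains in this closed convex set.
    refine (N x.1).convex.integral_mem (Submodule.closed_of_finiteDimensional _) ?_ ?_
    · refine (MeasureTheory.ae_restrict_iff' measurableSet_Ioc).2
        (Filter.Eventually.of_forall fun t ht => ?_)
      exact h.vert_mem (hline x hx t ⟨ht.1.le, ht.2⟩) _
    · have := intervalIntegrable_iff.1 (intervalIntegrable_slice hf.continuousOn hx')
      rwa [uIoc_of_le zero_le_one] at this

end FlatModel

end Flat


/-! ### The form minus the differential of its primitive is basic. -/

section Flat

open Set

variable {E K : Type} [NormedAddCommGroup E] [NormedSpace ℝ E]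
  [NormedAddCommGroup K] [NormedSpace ℝ K]

namespace FlatModel

variable {S : Set E} {Z : Set K} {β : E × K → E × K →L[ℝ] E × K →L[ℝ] ℝ}
    {N : E → Submodule ℝ (E →L[ℝ] ℝ)} (h : FlatModel S Z β N)

include h

theorem restrict {S' : Set E} {Z' : Set K} (hS : IsOpen S') (hZ : IsOpen Z') (hZc : Convex ℝ Z')
    (hSS : S' ⊆ S) (hZZ : Z' ⊆ Z) : FlatModel S' Z' β N where
  isOpen_base := hS
  isOpen_fiber := hZ
  convex_fiber := hZc
  smooth x hx := h.smooth x (prod_mono hSS hZZ hx)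
  skew := h.skew
  isotropic x hx := h.isotropic x (prod_mono hSS hZZ hx)
  nondegenerate x hx := h.nondegenerate x (prod_mono hSS hZZ hx)
  mem_iff x hx := h.mem_iff x (prod_mono hSS hZZ hx)
  closed x hx := h.closed x (prod_mono hSS hZZ hx)

variable [FiniteDimensional ℝ E] [FiniteDimensional ℝ K]

/-- Read `U` as a one-form on `S × Z`, evaluated on base components. Since `∂U/∂ζ = vert β`, the
form `β - dU` kills vertical vectors. By `closed` and the symmetry of `D²U` its coefficients have no
derivative along the fibre, so they are constant on the convex set `Z`. -/
theorem sub_dPrimitive_eq {U : E × K → E →L[ℝ] ℝ} (hU : ∀ x ∈ S ×ˢ Z, ContDiffAt ℝ ∞ U x)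
    (hDU : ∀ x ∈ S ×ˢ Z, ∀ ζ, fderiv ℝ U x (0, ζ) = vert (β x) ζ)
    {x x' : E × K} (hx : x ∈ S ×ˢ Z) (hx' : x' ∈ S ×ˢ Z) (hxx' : x'.1 = x.1)
    {v w v' w' : E × K} (hv : v'.1 = v.1) (hw : w'.1 = w.1) :
    β x v w - fderiv ℝ U x v w.1 + fderiv ℝ U x w v.1
      = β x' v' w' - fderiv ℝ U x' v' w'.1 + fderiv ℝ U x' w' v'.1 := by
  -- The vertical parts of `v` and `w` contribute to `dU` exactly what they contribute to `β`, so
  -- only horizontal vectors remain.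
  have hred : ∀ x ∈ S ×ˢ Z, ∀ v w : E × K,
      β x v w - fderiv ℝ U x v w.1 + fderiv ℝ U x w v.1
        = β x (v.1, 0) (w.1, 0) - fderiv ℝ U x (v.1, 0) w.1 + fderiv ℝ U x (w.1, 0) v.1 := by
    intro x hx v w
    have ev : v = (v.1, 0) + (0, v.2) := by simp
    have ew : w = (w.1, 0) + (0, w.2) := by simp
    have h1 : fderiv ℝ U x v = fderiv ℝ U x (v.1, 0) + vert (β x) v.2 := by
      conv_lhs => rw [ev]
      rw [map_add, hDU x hx]
    have h2 : fderiv ℝ U x w = fderiv ℝ U x (w.1, 0) + vert (β x) w.2 := by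
      conv_lhs => rw [ew]
      rw [map_add, hDU x hx]
    have h3 : β x v w = β x (v.1, 0) (w.1, 0) - vert (β x) w.2 v.1 + vert (β x) v.2 w.1 := by
      conv_lhs => rw [ev]
      rw [map_add, add_apply, h.vert_eq hx, h.skew x (v.1, 0) w]
      conv_lhs => rw [ew]
      rw [map_add, add_apply, h.vert_eq hx, h.skew x (w.1, 0) (v.1, 0)]
      simp
      ring
    rw [h1, h2, h3]
    simp only [add_apply]
    ring
  rw [hred x hx, hred x' hx', hv, hw]
  obtain ⟨y, z⟩ := x
  obtain ⟨y', z'⟩ := x'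
  obtain rfl : y' = y := hxx'
  generalize v.1 = η₁
  generalize w.1 = η₂
  have hd : ∀ c ∈ Z, HasFDerivAt (fun c => β (y', c) (η₁, 0) (η₂, 0) -
      fderiv ℝ U (y', c) (η₁, 0) η₂ + fderiv ℝ U (y', c) (η₂, 0) η₁) (0 : K →L[ℝ] ℝ) c := by
    intro c hc
    have hcx : (y', c) ∈ S ×ˢ Z := ⟨hx.1, hc⟩
    have hβ := h.differentiableAt_form hcx
    have hUd : DifferentiableAt ℝ (fderiv ℝ U) (y', c) :=
      ((hU _ hcx).fderiv_right (m := 1) (by norm_cast)).differentiableAt one_ne_zero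
    have hq : DifferentiableAt ℝ (fun x => β x (η₁, 0) (η₂, 0) -
      fderiv ℝ U x (η₁, 0) η₂ + fderiv ℝ U x (η₂, 0) η₁) (y', c) := by fun_prop
    have hcomp := HasFDerivAt.comp (g := fun x => β x (η₁, 0) (η₂, 0) -
      fderiv ℝ U x (η₁, 0) η₂ + fderiv ℝ U x (η₂, 0) η₁) c hq.hasFDerivAt
      (hasFDerivAt_prodMk_right (𝕜 := ℝ) y' c)
    refine hcomp.congr_fderiv ?_
    ext ζ
    change fderiv ℝ (fun x => β x (η₁, 0) (η₂, 0) - fderiv ℝ U x (η₁, 0) η₂ +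
      fderiv ℝ U x (η₂, 0) η₁) (y', c) (0, ζ) = 0
    have hsymm : IsSymmSndFDerivAt ℝ U (y', c) :=
      (hU _ hcx).isSymmSndFDerivAt (by
        rw [minSmoothness_of_isRCLikeNormedField]
        exact WithTop.coe_le_coe.2 le_top)
    -- Exchanging the two derivatives of `U` turns a vertical derivative of its horizontal
    -- differential into a horizontal derivative of `vert β`, the shape in which `closed` applies.
    have hvertd : ∀ (η η' : E), fderiv ℝ (fderiv ℝ U) (y', c) (0, ζ) (η, 0) η'
        = fderiv ℝ β (y', c) (η, 0) (0, ζ) (η', 0) := by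
      intro η η'
      rw [hsymm.eq, ← h.fderiv_vert hcx]
      have e1 : (fun x => fderiv ℝ U x (0, ζ)) =ᶠ[nhds (y', c)] fun x => vert (β x) ζ :=
        Filter.eventually_of_mem (h.isOpen_prod.mem_nhds hcx) fun x hx => hDU x hx ζ
      have hd : DifferentiableAt ℝ (fun y => vert (β y)) (y', c) :=
        (h.contDiffAt_vert hcx).differentiableAt (by simp)
      rw [← fderiv_clm_apply_const hUd, e1.fderiv_eq, fderiv_clm_apply_const hd]
    have hβ' : ∀ v w : E × K, HasFDerivAt (fun x => β x v w)
        (fderiv ℝ (fun x => β x v w) (y', c)) (y', c) := fun v w =>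
      ((hβ.clm_apply (differentiableAt_const v)).clm_apply (differentiableAt_const w)).hasFDerivAt
    have hU' : ∀ (v : E × K) (η : E), HasFDerivAt (fun x => fderiv ℝ U x v η)
        (fderiv ℝ (fun x => fderiv ℝ U x v η) (y', c)) (y', c) := fun v w =>
      ((hUd.clm_apply (differentiableAt_const v)).clm_apply (differentiableAt_const w)).hasFDerivAt
    have hU'' : ∀ (v z : E × K) (η : E), fderiv ℝ (fun x => fderiv ℝ U x v η) (y', c) z
        = fderiv ℝ (fderiv ℝ U) (y', c) z v η := fun v z η => by
      rw [fderiv_clm_apply_const (hUd.clm_apply (differentiableAt_const v)),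
        fderiv_clm_apply_const hUd]
    rw [(((hβ' _ _).fun_sub (hU' _ _)).fun_add (hU' _ _)).fderiv]
    simp only [add_apply, sub_apply]
    rw [h.fderiv_form_apply hcx, hU'', hU'', hvertd, hvertd]
    exact h.closed _ hcx ζ (η₁, 0) (η₂, 0)
  have hconst := h.isOpen_fiber.is_const_of_fderiv_eq_zero h.convex_fiber.isPreconnected
    (fun c hc => (hd c hc).differentiableAt.differentiableWithinAt)
    (fun c hc => (hd c hc).fderiv) hx.2 hx'.2
  exact hconst

/-- The basic form `β - dU` agrees at `x` and at `G x`, so `β` changes only by the change of `dU`.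
With `U ∘ G = U + α` this change is `dα`. -/
theorem pullback_eq {U : E × K → E →L[ℝ] ℝ} (hU : ∀ x ∈ S ×ˢ Z, ContDiffAt ℝ ∞ U x)
    (hDU : ∀ x ∈ S ×ˢ Z, ∀ ζ, fderiv ℝ U x (0, ζ) = vert (β x) ζ)
    {G : E × K → E × K} {α : E → E →L[ℝ] ℝ} {x : E × K} (hx : x ∈ S ×ˢ Z) (hGx : G x ∈ S ×ˢ Z)
    (hG : DifferentiableAt ℝ G x) (hα : DifferentiableAt ℝ α x.1)
    (hfst : ∀ᶠ x' in nhds x, (G x').1 = x'.1)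
    (hUG : ∀ᶠ x' in nhds x, U (G x') = U x' + α x'.1) (v w : E × K) :
    β (G x) (fderiv ℝ G x v) (fderiv ℝ G x w)
      = β x v w + (fderiv ℝ α x.1 v.1 w.1 - fderiv ℝ α x.1 w.1 v.1) := by
  have hG1 : ∀ v, (fderiv ℝ G x v).1 = v.1 := by
    intro v
    have e : (fun x' => (G x').1) =ᶠ[nhds x] fun x' => x'.1 := hfst
    have h1 := hG.hasFDerivAt.fst
    have h2 := h1.unique (hasFDerivAt_fst.congr_of_eventuallyEq e)
    exact congrArg (fun A => A v) h2
  have hUG' : ∀ v, fderiv ℝ U (G x) (fderiv ℝ G x v) = fderiv ℝ U x v + fderiv ℝ α x.1 v.1 := by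
    intro v
    have e : (fun x' => U (G x')) =ᶠ[nhds x] fun x' => U x' + α x'.1 := hUG
    have h1 := HasFDerivAt.comp (g := U) x
      ((hU _ hGx).differentiableAt (by simp)).hasFDerivAt hG.hasFDerivAt
    have h2 := ((hU _ hx).differentiableAt (by simp)).hasFDerivAt.add
      (HasFDerivAt.comp (g := α) x hα.hasFDerivAt hasFDerivAt_fst)
    have h3 := h1.unique (h2.congr_of_eventuallyEq e)
    exact congrArg (fun A => A v) h3
  have key := h.sub_dPrimitive_eq hU hDU hx hGx hfst.self_of_nhds (hG1 v) (hG1 w)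
  rw [hUG', hUG', hG1, hG1] at key
  simp only [add_apply] at key
  linarith

end FlatModel

end Flat


/-! ### Coordinates on the local model in which the vertical flows are translations. -/

section Flat

open Set

variable {E K : Type} [NormedAddCommGroup E] [NormedSpace ℝ E]
  [NormedAddCommGroup K] [NormedSpace ℝ K]

/-- Coordinates `(y, w)` in which the vertical field `X` with `β (X, ·) = a` is the constant
field `p a` in the direction of `w`. -/
structure FlatChart (Q : Set (E × K)) (β : E × K → E × K →L[ℝ] E × K →L[ℝ] ℝ)
    (N : E → Submodule ℝ (E →L[ℝ] ℝ)) where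
  coord : OpenPartialHomeomorph (E × K) (E × K)
  p : (E →L[ℝ] ℝ) →L[ℝ] K
  split : E → K →L[ℝ] E →L[ℝ] ℝ
  source_subset : coord.source ⊆ Q
  smooth : ∀ x ∈ coord.source, ContDiffAt ℝ ∞ coord x
  smooth_symm : ∀ x ∈ coord.target, ContDiffAt ℝ ∞ coord.symm x
  fst : ∀ x ∈ coord.source, (coord x).1 = x.1
  flow_iff : ∀ x ∈ coord.source, ∀ a ∈ N x.1, ∀ v,
    (∀ w, β x v w = a w.1) ↔ fderiv ℝ coord x v = (0, p a)
  injective : ∀ x ∈ coord.source, ∀ a ∈ N x.1, p a = 0 → a = 0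
  split_smooth : ∀ x ∈ coord.source, ContDiffAt ℝ ∞ split x.1
  split_mem : ∀ x ∈ coord.source, ∀ w, split x.1 w ∈ N x.1
  p_split : ∀ x ∈ coord.source, ∀ w, p (split x.1 w) = w
  pullback : ∀ (G : E × K → E × K) (α : E → E →L[ℝ] ℝ), ∀ x ∈ coord.source, G x ∈ coord.source →
    DifferentiableAt ℝ G x → DifferentiableAt ℝ α x.1 → (∀ᶠ x' in nhds x, (G x').1 = x'.1) →
    (∀ᶠ x' in nhds x, α x'.1 ∈ N x'.1) →
    (∀ᶠ x' in nhds x, (coord (G x')).2 = (coord x').2 + p (α x'.1)) → ∀ v w,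
      β (G x) (fderiv ℝ G x v) (fderiv ℝ G x w)
        = β x v w + (fderiv ℝ α x.1 v.1 w.1 - fderiv ℝ α x.1 w.1 v.1)

variable [FiniteDimensional ℝ E] [FiniteDimensional ℝ K]

namespace FlatModel

variable {S : Set E} {Z : Set K} {β : E × K → E × K →L[ℝ] E × K →L[ℝ] ℝ}
    {N : E → Submodule ℝ (E →L[ℝ] ℝ)}

/-- By nondegeneracy `vert (β x₀)` is injective; `p` is a left inverse of it. Then `p ∘ vert β` is
the identity at `x₀`, and invertibility is an open condition. The fibre is shrunk to a ball to keep
it convex. -/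
theorem exists_split (h : FlatModel S Z β N) {x₀ : E × K} (hx₀ : x₀ ∈ S ×ˢ Z) :
    ∃ (p : (E →L[ℝ] ℝ) →L[ℝ] K) (S' : Set E) (Z' : Set K), S' ⊆ S ∧ Z' ⊆ Z ∧ x₀ ∈ S' ×ˢ Z' ∧
      IsOpen S' ∧ IsOpen Z' ∧ Convex ℝ Z' ∧
      ∀ x ∈ S' ×ˢ Z', (p.comp (vert (β x))).IsInvertible := by
  obtain ⟨p, hp⟩ := LinearMap.exists_leftInverse_of_injective (vert (β x₀)).toLinearMap
    (LinearMap.ker_eq_bot'.2 fun ζ hζ => h.vert_injective hx₀ hζ)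
  let p' : (E →L[ℝ] ℝ) →L[ℝ] K := LinearMap.toContinuousLinearMap p
  have hp' : p'.comp (vert (β x₀)) = ((ContinuousLinearEquiv.refl ℝ K : K ≃L[ℝ] K) : K →L[ℝ] K) := by
    ext ζ
    exact LinearMap.congr_fun hp ζ
  have hcont : ContinuousAt (fun x => p'.comp (vert (β x))) x₀ :=
    (contDiffAt_const.clm_comp (h.contDiffAt_vert hx₀)).continuousAt
  have hev : ∀ᶠ x in nhds x₀, (p'.comp (vert (β x))).IsInvertible := by
    have := ContinuousLinearEquiv.nhds (ContinuousLinearEquiv.refl ℝ K)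
    rw [← hp'] at this
    exact hcont.eventually this
  obtain ⟨u, v, hu, hxu, hv, hxv, huv⟩ := mem_nhds_prod_iff'.1 hev
  obtain ⟨r, hr, hrv⟩ := Metric.isOpen_iff.1 (hv.inter h.isOpen_fiber) x₀.2 ⟨hxv, hx₀.2⟩
  exact ⟨p', u ∩ S, Metric.ball x₀.2 r, inter_subset_right, fun z hz => (hrv hz).2,
    ⟨⟨hxu, hx₀.1⟩, Metric.mem_ball_self hr⟩, hu.inter h.isOpen_base, Metric.isOpen_ball,
    convex_ball _ _, fun x hx => huv ⟨hx.1.1, (hrv hx.2).1⟩⟩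

/-- The coordinates are `(y, p U)`. Along a vertical `ζ` their derivative is `(0, p (vert β ζ))`, so
the field whose contraction is `a` has the velocity `(0, p a)`, independent of the point of the
fibre. This derivative is injective, hence the inverse function theorem applies. -/
theorem exists_chart_of_split (h : FlatModel S Z β N) {x₀ : E × K} (hx₀ : x₀ ∈ S ×ˢ Z)
    (p : (E →L[ℝ] ℝ) →L[ℝ] K) (hp : ∀ x ∈ S ×ˢ Z, (p.comp (vert (β x))).IsInvertible) :
    ∃ c : FlatChart (S ×ˢ Z) β N, x₀ ∈ c.coord.source := by
  obtain ⟨U, hU, hDU, hUN⟩ := h.exists_primitive hx₀.2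
  have hpi : ∀ x ∈ S ×ˢ Z, ∀ ζ, p (vert (β x) ζ) = 0 → ζ = 0 := fun x hx ζ hζ =>
    (hp x hx).injective (hζ.trans (map_zero (p.comp (vert (β x)))).symm)
  have hinj : ∀ x ∈ S ×ˢ Z, ∀ a ∈ N x.1, p a = 0 → a = 0 := by
    intro x hx a ha hpa
    obtain ⟨ζ, rfl⟩ := (h.mem_iff_vert hx a).1 ha
    rw [hpi x hx ζ hpa, map_zero]
  let Ψ : E × K → E × K := fun x => (x.1, p (U x))
  have hΨ : ∀ x ∈ S ×ˢ Z, ContDiffAt ℝ ∞ Ψ x := fun x hx =>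
    contDiffAt_fst.prodMk (p.contDiff.contDiffAt.comp x (hU x hx))
  have hDΨ : ∀ x ∈ S ×ˢ Z, ∀ v, fderiv ℝ Ψ x v = (v.1, p (fderiv ℝ U x v)) := by
    intro x hx v
    have h1 : HasFDerivAt Ψ ((ContinuousLinearMap.fst ℝ E K).prod (p.comp (fderiv ℝ U x))) x :=
      hasFDerivAt_fst.prodMk (HasFDerivAt.comp (g := p) x p.hasFDerivAt
        ((hU x hx).differentiableAt (by simp)).hasFDerivAt)
    rw [h1.fderiv]
    rfl
  have hDΨ0 : ∀ x ∈ S ×ˢ Z, ∀ ζ, fderiv ℝ Ψ x (0, ζ) = (0, p (vert (β x) ζ)) := by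
    intro x hx ζ
    rw [hDΨ x hx, hDU x hx]
  have hDΨi : ∀ x ∈ S ×ˢ Z, Function.Injective (fderiv ℝ Ψ x) := by
    intro x hx
    rw [injective_iff_map_eq_zero]
    rintro ⟨η, ζ⟩ hv
    have h1 : η = 0 := by
      rw [hDΨ x hx] at hv
      exact congrArg Prod.fst hv
    subst h1
    rw [hDΨ0 x hx] at hv
    rw [hpi x hx ζ (congrArg Prod.snd hv)]
    rfl
  have hDΨe : ∀ x ∈ S ×ˢ Z, ∃ e : (E × K) ≃L[ℝ] (E × K), HasFDerivAt Ψ (e : E × K →L[ℝ] E × K) x := by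
    intro x hx
    refine ⟨(LinearEquiv.ofInjectiveEndo (fderiv ℝ Ψ x).toLinearMap
      (hDΨi x hx)).toContinuousLinearEquiv, ?_⟩
    refine ((hΨ x hx).differentiableAt (by simp)).hasFDerivAt.congr_fderiv ?_
    ext v <;> rfl
  obtain ⟨e₀, he₀⟩ := hDΨe x₀ hx₀
  let Φ := ((hΨ x₀ hx₀).toOpenPartialHomeomorph Ψ he₀ (by simp)).restrOpen (S ×ˢ Z) h.isOpen_prod
  have hΦ : (Φ : E × K → E × K) = Ψ := rfl
  have hsub : Φ.source ⊆ S ×ˢ Z := fun x hx => hx.2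
  have hmem : x₀ ∈ Φ.source := ⟨(hΨ x₀ hx₀).mem_toOpenPartialHomeomorph_source he₀ (by simp), hx₀⟩
  have hflow : ∀ x ∈ S ×ˢ Z, ∀ a ∈ N x.1, ∀ v,
      (∀ w, β x v w = a w.1) ↔ fderiv ℝ Ψ x v = (0, p a) := by
    intro x hx a ha v
    obtain ⟨ζ, rfl⟩ := (h.mem_iff_vert hx a).1 ha
    rw [← hDΨ0 x hx]
    constructor
    · intro H
      congr 1
      refine sub_eq_zero.1 (h.nondegenerate x hx _ fun w => ?_)
      rw [map_sub, sub_apply, H, h.vert_eq hx, sub_self]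
    · intro H w
      rw [hDΨi x hx H, h.vert_eq hx]
  -- A section of `p` with values in `N y` that depends on `y` alone: the fibre coordinate of `vert
  -- β` is frozen at `x₀.2`.
  have hsplit : ∀ x ∈ S ×ˢ Z, ContDiffAt ℝ ∞ (fun y => (vert (β (y, x₀.2))).comp
      (p.comp (vert (β (y, x₀.2)))).inverse) x.1 := by
    intro x hx
    have hx' : (x.1, x₀.2) ∈ S ×ˢ Z := ⟨hx.1, hx₀.2⟩
    have h1 : ContDiffAt ℝ ∞ (fun y => vert (β (y, x₀.2))) x.1 :=
      ContDiffAt.comp (g := fun x => vert (β x)) x.1 (h.contDiffAt_vert hx')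
        (contDiffAt_id.prodMk contDiffAt_const)
    refine h1.clm_comp ?_
    exact ContDiffAt.comp (g := ContinuousLinearMap.inverse) x.1
      (hp _ hx').contDiffAt_map_inverse (contDiffAt_const.clm_comp h1)
  refine ⟨{
    coord := Φ
    p := p
    split := fun y => (vert (β (y, x₀.2))).comp (p.comp (vert (β (y, x₀.2)))).inverse
    source_subset := hsub
    smooth := fun x hx => hΨ x (hsub hx)
    smooth_symm := fun x hx => ?_
    fst := fun x hx => rfl
    flow_iff := fun x hx => hflow x (hsub hx)
    injective := fun x hx => hinj x (hsub hx)
    split_smooth := fun x hx => hsplit x (hsub hx)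
    split_mem := fun x hx w => ?_
    p_split := fun x hx w => ?_
    pullback := ?_ }, hmem⟩
  · have hx' := hsub (Φ.map_target hx)
    obtain ⟨e, he⟩ := hDΨe _ hx'
    exact Φ.contDiffAt_symm hx he (hΨ _ hx')
  · exact h.vert_mem (x := (x.1, x₀.2)) ⟨(hsub hx).1, hx₀.2⟩ _
  · obtain ⟨e, he⟩ := hp (x.1, x₀.2) ⟨(hsub hx).1, hx₀.2⟩
    change (p.comp (vert (β (x.1, x₀.2)))) ((p.comp (vert (β (x.1, x₀.2)))).inverse w) = w
    rw [← he]
    simp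
  · intro G α x hx hGx hG hα hfst hαN hcoord v w
    refine h.pullback_eq hU hDU (hsub hx) (hsub hGx) hG hα hfst ?_ v w
    have hxs : ∀ᶠ x' in nhds x, x' ∈ Φ.source := Φ.open_source.mem_nhds hx
    have hGs : ∀ᶠ x' in nhds x, G x' ∈ Φ.source :=
      hG.continuousAt.eventually (Φ.open_source.mem_nhds hGx)
    filter_upwards [hfst, hαN, hcoord, hxs, hGs] with x' h1 h2 h3 h4 h5
    -- The chart records only the `p`-image of `U (G x') = U x' + α`. All terms lie in `N x'.1`,
    -- because `G` preserves the base point, and `p` is injective there.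
    have h6 : p (U (G x')) = p (U x') + p (α x'.1) := h3
    refine sub_eq_zero.1 (hinj x' (hsub h4) _ ?_ ?_)
    · exact (N x'.1).sub_mem (h1 ▸ hUN _ (hsub h5)) ((N x'.1).add_mem (hUN _ (hsub h4)) h2)
    · rw [map_sub, map_add, h6, sub_self]

theorem exists_chart (h : FlatModel S Z β N) {x₀ : E × K} (hx₀ : x₀ ∈ S ×ˢ Z) :
    ∃ c : FlatChart (S ×ˢ Z) β N, x₀ ∈ c.coord.source := by
  obtain ⟨p, S', Z', hS, hZ, hx, hSo, hZo, hZc, hp⟩ := h.exists_split hx₀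
  obtain ⟨c, hc⟩ := (h.restrict hSo hZo hZc hS hZ).exists_chart_of_split hx p hp
  exact ⟨{ c with source_subset := c.source_subset.trans (prod_mono hS hZ) }, hc⟩

end FlatModel

end Flat


/-! ### Pulling forms on a manifold back to vector spaces. -/

section FormPull

variable {d : ℕ} {M : Type u} [TopologicalSpace M] [ChartedSpace (EuclideanSpace ℝ (Fin d)) M]
  {X : Type} [NormedAddCommGroup X] [NormedSpace ℝ X]

/-- The pullback of a form along a map from a normed space. -/
noncomputable def formPull {j : ℕ} (g : X → M) (σ : DiffForm d M j) (y : X) : X [⋀^Fin j]→L[ℝ] ℝ :=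
  ContinuousAlternatingMap.compContinuousLinearMap
    (σ (g y) : EuclideanSpace ℝ (Fin d) [⋀^Fin j]→L[ℝ] ℝ)
    (mfderiv 𝓘(ℝ, X) (𝓡 d) g y : X →L[ℝ] EuclideanSpace ℝ (Fin d))

theorem formPull_congr {j : ℕ} {g g' : X → M} (σ : DiffForm d M j) {y : X}
    (h : g =ᶠ[nhds y] g') : formPull g σ y = formPull g' σ y := by
  have h1 : ∀ {m m' : M} (_ : m = m') {A A' : X →L[ℝ] EuclideanSpace ℝ (Fin d)} (_ : A = A'),
      ContinuousAlternatingMap.compContinuousLinearMap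
        (σ m : EuclideanSpace ℝ (Fin d) [⋀^Fin j]→L[ℝ] ℝ) A
      = ContinuousAlternatingMap.compContinuousLinearMap
        (σ m' : EuclideanSpace ℝ (Fin d) [⋀^Fin j]→L[ℝ] ℝ) A' := by
    rintro m _ rfl A _ rfl; rfl
  exact h1 h.self_of_nhds h.mfderiv_eq

variable [IsManifold (𝓡 d) ∞ M]

theorem contMDiffAt_extChartAt_symm {x : M} {y : EuclideanSpace ℝ (Fin d)}
    (hy : y ∈ (extChartAt (𝓡 d) x).target) :
    ContMDiffAt (𝓡 d) (𝓡 d) ∞ (extChartAt (𝓡 d) x).symm y :=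
  (contMDiffOn_extChartAt_symm x).contMDiffAt ((isOpen_extChartAt_target x).mem_nhds hy)

theorem contMDiffAt_extChartAt_of_mem {x m : M} (hm : m ∈ (extChartAt (𝓡 d) x).source) :
    ContMDiffAt (𝓡 d) (𝓡 d) ∞ (extChartAt (𝓡 d) x) m := by
  rw [extChartAt_source] at hm
  exact contMDiffAt_extChartAt' hm

variable {g : X → M} {x : X}

theorem contDiffAt_extChartAt_comp {x₀ : M} (hg : ContMDiffAt 𝓘(ℝ, X) (𝓡 d) ∞ g x)
    (hx : g x ∈ (extChartAt (𝓡 d) x₀).source) :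
    ContDiffAt ℝ ∞ (fun y => extChartAt (𝓡 d) x₀ (g y)) x := by
  have := (contMDiffAt_extChartAt_of_mem hx).comp x hg
  exact this.contDiffAt

theorem formPull_extChartAt_symm_comp {j : ℕ} (σ : DiffForm d M j) {x₀ : M}
    (hg : ContMDiffAt 𝓘(ℝ, X) (𝓡 d) ∞ g x) (hx : g x ∈ (extChartAt (𝓡 d) x₀).source) :
    formPull g σ x = (DiffForm.inChart σ x₀ (extChartAt (𝓡 d) x₀ (g x))).compContinuousLinearMap
      (fderiv ℝ (fun y => extChartAt (𝓡 d) x₀ (g y)) x) := by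
  have hc := contDiffAt_extChartAt_comp hg hx
  have hs := contMDiffAt_extChartAt_symm ((extChartAt (𝓡 d) x₀).map_source hx)
  have he : g =ᶠ[nhds x]
      (extChartAt (𝓡 d) x₀).symm ∘ (fun y => extChartAt (𝓡 d) x₀ (g y)) := by
    filter_upwards [hg.continuousAt.eventually ((isOpen_extChartAt_source (I := 𝓡 d) x₀).mem_nhds hx)]
      with y hy
    exact ((extChartAt (𝓡 d) x₀).left_inv hy).symm
  rw [formPull_congr σ he]
  have h1 := mfderiv_comp x (hs.mdifferentiableAt (by simp))
    (hc.contMDiffAt.mdifferentiableAt (by simp))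
  unfold formPull
  rw [h1, mfderiv_eq_fderiv]
  rfl

theorem formPull_eventuallyEq {j : ℕ} (σ : DiffForm d M j)
    (hg : ∀ᶠ y in nhds x, ContMDiffAt 𝓘(ℝ, X) (𝓡 d) ∞ g y) :
    formPull g σ =ᶠ[nhds x] fun y =>
      (DiffForm.inChart σ (g x) (extChartAt (𝓡 d) (g x) (g y))).compContinuousLinearMap
      (fderiv ℝ (fun y => extChartAt (𝓡 d) (g x) (g y)) y) := by
  filter_upwards [hg, hg.self_of_nhds.continuousAt.eventually
    ((isOpen_extChartAt_source (I := 𝓡 d) (g x)).mem_nhds (mem_extChartAt_source (g x)))] with y hy hys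
  exact formPull_extChartAt_symm_comp σ hy hys

/-- `DiffForm.d` at a point is defined through the preferred chart at that point, so `g` is factored
through the chart at `g x` and the statement becomes the naturality of `extDeriv` on vector spaces.
Applied to the inverse of another chart, it shows that the exterior derivative does not depend on
the chart. -/
theorem extDeriv_formPull {j : ℕ} {σ : DiffForm d M j}
    (hg : ∀ᶠ y in nhds x, ContMDiffAt 𝓘(ℝ, X) (𝓡 d) ∞ g y) (hσ : DiffForm.SmoothAt σ (g x)) :
    extDeriv (formPull g σ) x = formPull g (DiffForm.d σ) x := by
  have hc := contDiffAt_extChartAt_comp hg.self_of_nhds (mem_extChartAt_source (g x))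
  rw [(formPull_eventuallyEq σ hg).extDeriv_eq]
  rw [extDeriv_pullback (f := fun y => extChartAt (𝓡 d) (g x) (g y)) (r := ∞)
    (ContDiffAt.differentiableAt hσ (by simp)) hc
    (by rw [minSmoothness_of_isRCLikeNormedField]; exact WithTop.coe_le_coe.2 le_top)]
  have h1 := mfderiv_comp x
    ((contMDiffAt_extChartAt_of_mem (mem_extChartAt_source (g x))).mdifferentiableAt (by simp))
    (hg.self_of_nhds.mdifferentiableAt (by simp))
  have h2 : fderiv ℝ (fun y => extChartAt (𝓡 d) (g x) (g y)) x
      = (mfderiv (𝓡 d) (𝓡 d) (extChartAt (𝓡 d) (g x)) (g x)).comp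
        (mfderiv 𝓘(ℝ, X) (𝓡 d) g x) := by
    rw [← h1, ← mfderiv_eq_fderiv]
    rfl
  rw [h2]
  rfl

/-- Since `SmoothAt` refers only to the chart at the point itself, this is also what makes
smoothness usable in every other chart. -/
theorem contDiffAt_formPull_two [FiniteDimensional ℝ X] {σ : DiffForm d M 2}
    (hg : ∀ᶠ y in nhds x, ContMDiffAt 𝓘(ℝ, X) (𝓡 d) ∞ g y) (hσ : DiffForm.SmoothAt σ (g x)) :
    ContDiffAt ℝ ∞ (formPull g σ) x := by
  have hc := contDiffAt_extChartAt_comp hg.self_of_nhds (mem_extChartAt_source (g x))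
  refine ContDiffAt.congr_of_eventuallyEq ?_ (formPull_eventuallyEq σ hg)
  exact contDiffAt_two_form_pullback
    (ContDiffAt.comp (g := DiffForm.inChart σ (g x)) x hσ hc) (hc.fderiv_right (by simp))

/-- The pullback of a field of covectors along a map from a normed space. -/
noncomputable def covPull (g : X → M) (α : ∀ m : M, Covec d m) (y : X) : X →L[ℝ] ℝ :=
  (α (g y)).comp (mfderiv 𝓘(ℝ, X) (𝓡 d) g y)

omit [IsManifold (𝓡 d) ∞ M] in
theorem formPull_oneForm (g : X → M) (α : ∀ m : M, Covec d m) (y : X) :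
    formPull g (oneForm α) y
      = ContinuousAlternatingMap.ofSubsingleton ℝ X ℝ (0 : Fin 1) (covPull g α y) := rfl

omit [IsManifold (𝓡 d) ∞ M] in
theorem inChart_oneForm (α : ∀ m : M, Covec d m) (m : M) :
    DiffForm.inChart (oneForm α) m = fun y => ContinuousAlternatingMap.ofSubsingleton ℝ
      (EuclideanSpace ℝ (Fin d)) ℝ (0 : Fin 1) (covPull (extChartAt (𝓡 d) m).symm α y) := rfl

omit [IsManifold (𝓡 d) ∞ M] in
theorem smoothAt_oneForm_iff {α : ∀ m : M, Covec d m} {m : M} :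
    DiffForm.SmoothAt (oneForm α) m ↔
      ContDiffAt ℝ ∞ (covPull (extChartAt (𝓡 d) m).symm α) (extChartAt (𝓡 d) m m) := by
  rw [DiffForm.SmoothAt, inChart_oneForm]
  exact contDiffAt_one_form

theorem contDiffAt_covPull {α : ∀ m : M, Covec d m}
    (hg : ∀ᶠ y in nhds x, ContMDiffAt 𝓘(ℝ, X) (𝓡 d) ∞ g y)
    (hα : DiffForm.SmoothAt (oneForm α) (g x)) : ContDiffAt ℝ ∞ (covPull g α) x := by
  have hc := contDiffAt_extChartAt_comp hg.self_of_nhds (mem_extChartAt_source (g x))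
  have he : covPull g α =ᶠ[nhds x] fun y =>
      (covPull (extChartAt (𝓡 d) (g x)).symm α (extChartAt (𝓡 d) (g x) (g y))).comp
      (fderiv ℝ (fun y => extChartAt (𝓡 d) (g x) (g y)) y) := by
    filter_upwards [formPull_eventuallyEq (oneForm α) hg] with y hy
    rw [inChart_oneForm, formPull_oneForm] at hy
    exact (ContinuousAlternatingMap.ofSubsingleton ℝ X ℝ (0 : Fin 1)).injective hy
  refine ContDiffAt.congr_of_eventuallyEq ?_ he
  exact (ContDiffAt.comp (g := covPull (extChartAt (𝓡 d) (g x)).symm α) x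
    (smoothAt_oneForm_iff.1 hα) hc).clm_comp (hc.fderiv_right (by simp))

theorem d_oneForm_pull {α : ∀ m : M, Covec d m}
    (hg : ∀ᶠ y in nhds x, ContMDiffAt 𝓘(ℝ, X) (𝓡 d) ∞ g y)
    (hα : DiffForm.SmoothAt (oneForm α) (g x)) (v w : X) :
    fderiv ℝ (covPull g α) x v w - fderiv ℝ (covPull g α) x w v
      = DiffForm.d (oneForm α) (g x)
        ![mfderiv 𝓘(ℝ, X) (𝓡 d) g x v, mfderiv 𝓘(ℝ, X) (𝓡 d) g x w] := by
  have h1 := extDeriv_formPull hg hα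
  have h2 := extDeriv_one_form ((contDiffAt_covPull hg hα).differentiableAt (by simp)) ![v, w]
  change extDeriv (formPull g (oneForm α)) x ![v, w] = _ at h2
  rw [h1] at h2
  refine h2.symm.trans ?_
  change (DiffForm.d (oneForm α) (g x)) (fun i => mfderiv 𝓘(ℝ, X) (𝓡 d) g x (![v, w] i)) = _
  congr 1
  ext i
  fin_cases i <;> rfl

theorem smoothAt_oneForm_of_map {f : M → X} {a : X → X →L[ℝ] ℝ} {m : M}
    (hf : ∀ᶠ m' in nhds m, ContMDiffAt (𝓡 d) 𝓘(ℝ, X) ∞ f m') (ha : ContDiffAt ℝ ∞ a (f m)) :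
    DiffForm.SmoothAt (oneForm fun m' => (a (f m')).comp (mfderiv (𝓡 d) 𝓘(ℝ, X) f m')) m := by
  rw [smoothAt_oneForm_iff]
  set χ := extChartAt (𝓡 d) m
  have hχm : χ.symm (χ m) = m := extChartAt_to_inv m
  have hcont : ContinuousAt χ.symm (χ m) := continuousAt_extChartAt_symm m
  have hfe : ∀ᶠ y in nhds (χ m), ContMDiffAt (𝓡 d) 𝓘(ℝ, X) ∞ f (χ.symm y) :=
    hcont.eventually (by rwa [hχm])
  have hte : ∀ᶠ y in nhds (χ m), y ∈ χ.target :=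
    (isOpen_extChartAt_target m).mem_nhds (mem_extChartAt_target m)
  have hc : ContDiffAt ℝ ∞ (fun y => f (χ.symm y)) (χ m) :=
    (hfe.self_of_nhds.comp _ (contMDiffAt_extChartAt_symm hte.self_of_nhds)).contDiffAt
  have he : covPull χ.symm (fun m' => (a (f m')).comp (mfderiv (𝓡 d) 𝓘(ℝ, X) f m'))
      =ᶠ[nhds (χ m)] fun y => (a (f (χ.symm y))).comp (fderiv ℝ (fun y => f (χ.symm y)) y) := by
    filter_upwards [hfe, hte] with y hy hyt
    have h1 := mfderiv_comp y (hy.mdifferentiableAt (by simp))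
      ((contMDiffAt_extChartAt_symm hyt).mdifferentiableAt (by simp))
    have h2 : fderiv ℝ (fun y => f (χ.symm y)) y = _ := (mfderiv_eq_fderiv.symm).trans h1
    rw [h2]
    rfl
  refine ContDiffAt.congr_of_eventuallyEq ?_ he
  refine (ContDiffAt.comp (g := a) (χ m) ?_ hc).clm_comp (hc.fderiv_right (by simp))
  rwa [hχm]

end FormPull


/-! ### The submersion theorem on vector spaces. -/

section Straighten

open Set

variable {D E K : Type} [NormedAddCommGroup D] [NormedSpace ℝ D] [FiniteDimensional ℝ D]
  [NormedAddCommGroup E] [NormedSpace ℝ E]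
  [NormedAddCommGroup K] [NormedSpace ℝ K] [FiniteDimensional ℝ K]

/-- `q` is a linear projection onto the kernel of `F'`, identified with `K` by equality of
dimensions; a vector killed by both `F'` and `q` is zero. -/
theorem exists_complement (F' : D →L[ℝ] E) (hF' : Function.Surjective F')
    (hK : Module.finrank ℝ E + Module.finrank ℝ K = Module.finrank ℝ D) :
    ∃ q : D →L[ℝ] K, Function.Injective (F'.prod q) := by
  have hker : Module.finrank ℝ (LinearMap.ker F'.toLinearMap) = Module.finrank ℝ K := by
    have h1 := LinearMap.finrank_range_add_finrank_ker F'.toLinearMap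
    rw [LinearMap.range_eq_top.2 hF', finrank_top] at h1
    omega
  let e := LinearEquiv.ofFinrankEq _ _ hker
  obtain ⟨q, hq⟩ := (LinearMap.ker F'.toLinearMap).subtype.exists_leftInverse_of_injective
    (Submodule.ker_subtype _)
  refine ⟨LinearMap.toContinuousLinearMap (e.toLinearMap.comp q), ?_⟩
  rw [injective_iff_map_eq_zero]
  intro v hv
  have h1 : F' v = 0 := congrArg Prod.fst hv
  have h2 : e (q v) = 0 := congrArg Prod.snd hv
  have h3 : q v = 0 := by simpa using h2
  have h4 := LinearMap.congr_fun hq ⟨v, h1⟩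
  have h5 : q v = ⟨v, h1⟩ := h4
  rw [h3] at h5
  exact (congrArg Subtype.val h5).symm

variable [FiniteDimensional ℝ E]

/-- The inverse function theorem for `(F, q)`, with `q` a projection onto the kernel of the
derivative at `y₀`. The target is cut down to a product with a convex second factor, as `FlatModel`
requires. -/
theorem exists_straightening {F : D → E} {O : Set D} (hO : IsOpen O)
    (hF : ∀ y ∈ O, ContDiffAt ℝ ∞ F y) {y₀ : D} (hy₀ : y₀ ∈ O)
    (hF' : Function.Surjective (fderiv ℝ F y₀))
    (hK : Module.finrank ℝ E + Module.finrank ℝ K = Module.finrank ℝ D) :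
    ∃ (e : OpenPartialHomeomorph D (E × K)) (S : Set E) (Z : Set K), y₀ ∈ e.source ∧
      e.source ⊆ O ∧ e.target = S ×ˢ Z ∧ IsOpen S ∧ IsOpen Z ∧ Convex ℝ Z ∧
      (∀ y ∈ e.source, ContDiffAt ℝ ∞ e y) ∧ (∀ x ∈ e.target, ContDiffAt ℝ ∞ e.symm x) ∧
      ∀ y ∈ e.source, (e y).1 = F y := by
  obtain ⟨q, hq⟩ := exists_complement (K := K) (fderiv ℝ F y₀) hF' hK
  let f : D → E × K := fun y => (F y, q y)
  have hf : ∀ y ∈ O, ContDiffAt ℝ ∞ f y := fun y hy =>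
    (hF y hy).prodMk q.contDiff.contDiffAt
  have hf' : ∀ y ∈ O, HasFDerivAt f ((fderiv ℝ F y).prod q) y := fun y hy =>
    ((hF y hy).differentiableAt (by simp)).hasFDerivAt.prodMk q.hasFDerivAt
  have hfr : Module.finrank ℝ D = Module.finrank ℝ (E × K) := by
    rw [Module.finrank_prod, hK]
  let e₀ : D ≃L[ℝ] E × K := (LinearEquiv.ofInjectiveOfFinrankEq
    ((fderiv ℝ F y₀).prod q).toLinearMap hq hfr).toContinuousLinearEquiv
  have he₀ : (e₀ : D →L[ℝ] E × K) = (fderiv ℝ F y₀).prod q := by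
    ext v <;> rfl
  have hcont : ContinuousAt (fun y => (fderiv ℝ F y).prod q) y₀ := by
    have h1 : ContinuousAt (fderiv ℝ F) y₀ :=
      ((hF y₀ hy₀).fderiv_right (m := 0) (by simp)).continuousAt
    have h2 : ContinuousAt (fun y => (ContinuousLinearMap.inl ℝ E K).comp (fderiv ℝ F y)
      + (ContinuousLinearMap.inr ℝ E K).comp q) y₀ :=
      ((ContinuousLinearMap.compL ℝ D E (E × K)
        (ContinuousLinearMap.inl ℝ E K)).continuous.continuousAt.comp h1).add continuousAt_const
    refine h2.congr (Filter.Eventually.of_forall fun y => ?_)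
    ext v <;> simp
  -- Invertibility is needed at every point of the source, since the inverse has to be smooth on the
  -- whole target and not only at the image of `y₀`.
  have hinv : ∀ᶠ y in nhds y₀, y ∈ O ∧ ((fderiv ℝ F y).prod q).IsInvertible := by
    refine (Filter.eventually_of_mem (hO.mem_nhds hy₀) fun _ h => h).and ?_
    have := ContinuousLinearEquiv.nhds e₀
    rw [he₀] at this
    exact hcont.eventually this
  obtain ⟨O', hO', hO'o, hyO'⟩ := eventually_nhds_iff.1 hinv
  let e₁ := (hf y₀ hy₀).toOpenPartialHomeomorph f (f' := e₀) (by rw [he₀]; exact hf' y₀ hy₀)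
    (by simp)
  have he₁ : y₀ ∈ e₁.source := (hf y₀ hy₀).mem_toOpenPartialHomeomorph_source _ _
  let e₂ := e₁.restrOpen O' hO'o
  have he₂ : y₀ ∈ e₂.source := ⟨he₁, hyO'⟩
  obtain ⟨u, v, hu, hxu, hv, hxv, huv⟩ := mem_nhds_prod_iff'.1
    (e₂.open_target.mem_nhds (e₂.map_source he₂))
  obtain ⟨r, hr, hrv⟩ := Metric.isOpen_iff.1 hv _ hxv
  -- Restricting the inverse, and inverting again, is what makes the target a product.
  let e := (e₂.symm.restrOpen (u ×ˢ Metric.ball (e₂ y₀).2 r) (hu.prod Metric.isOpen_ball)).symm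
  have htarget : e.target = u ×ˢ Metric.ball (e₂ y₀).2 r :=
    inter_eq_self_of_subset_right ((prod_mono subset_rfl hrv).trans huv)
  have hsource : ∀ y ∈ e.source, y ∈ O' := by
    intro y hy
    have h1 : y ∈ e₂.source := e₂.symm.map_source (e.map_source hy).1 |> fun h => by
      have h2 : e.symm (e y) = y := e.left_inv hy
      have h3 : e₂.symm (e y) = y := h2
      exact h3 ▸ h
    exact h1.2
  have hmem : y₀ ∈ e.source := by
    have h1 : e₂ y₀ ∈ e.target := by
      rw [htarget]
      exact ⟨hxu, Metric.mem_ball_self hr⟩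
    have h2 := e.map_target h1
    have h3 : e.symm (e₂ y₀) = y₀ := e₂.left_inv he₂
    rwa [h3] at h2
  refine ⟨e, u, Metric.ball (e₂ y₀).2 r, hmem, fun y hy => (hO' y (hsource y hy)).1, htarget, hu,
    Metric.isOpen_ball, convex_ball _ _, fun y hy => hf y (hO' y (hsource y hy)).1,
    fun x hx => ?_, fun y _ => rfl⟩
  have hy := hO' _ (hsource _ (e.map_target hx))
  obtain ⟨ey, hey⟩ := hy.2
  refine e.contDiffAt_symm (f₀' := ey) hx ?_ (hf _ hy.1)
  rw [hey]
  exact hf' _ hy.1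

end Straighten

/-! ### Linear algebra of a realization at one point. -/

section Pointwise

variable {k d : ℕ} {B M : Type u}
  [TopologicalSpace B] [ChartedSpace (EuclideanSpace ℝ (Fin k)) B]
  [TopologicalSpace M] [ChartedSpace (EuclideanSpace ℝ (Fin d)) M]
  {Λ : BivectorField k B} {π : C^∞⟮𝓡 d, M; 𝓡 k, B⟯} {σ : DiffForm d M 2} {η : DiffForm k B 3}

theorem eq_zero_of_forall_covec {b : B} {v : TangentSpace (𝓡 k) b}
    (h : ∀ a : Covec k b, a v = 0) : v = 0 := by
  by_contra hv
  have h1 : ∀ u : EuclideanSpace ℝ (Fin k), u ≠ 0 → ∃ a : EuclideanSpace ℝ (Fin k) →L[ℝ] ℝ,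
      a u ≠ 0 := fun u hu => SeparatingDual.exists_ne_zero hu
  obtain ⟨a, ha⟩ := h1 v hv
  exact ha (h a)

/-- By skew-symmetry the annihilator of the image of `Π♯` is its kernel. -/
theorem mem_conormal_iff (hΛ : ∀ (b : B) (α β : Covec k b), β (Λ b α) = - α (Λ b β)) {b : B}
    {a : Covec k b} : a ∈ conormal Λ b ↔ Λ b a = 0 := by
  constructor
  · intro h
    refine eq_zero_of_forall_covec fun β => ?_
    rw [hΛ]
    exact (congrArg Neg.neg (h _ ⟨β, rfl⟩)).trans neg_zero
  · rintro h _ ⟨β, rfl⟩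
    change a (Λ b β) = 0
    rw [hΛ, h, map_zero, neg_zero]

theorem IsASCIR.exists_contraction (h : IsASCIR Λ π σ η) (m : M) (a : Covec k (π m)) :
    ∃ v : TangentSpace (𝓡 d) m, ∀ w, σ m ![v, w] = a (mfderiv (𝓡 d) (𝓡 k) π m w) := by
  let b : EuclideanSpace ℝ (Fin d) →ₗ[ℝ] Module.Dual ℝ (EuclideanSpace ℝ (Fin d)) :=
    { toFun := fun v => (asBilin (X := EuclideanSpace ℝ (Fin d)) (σ m) v).toLinearMap
      map_add' := fun v w => by rw [map_add]; rfl
      map_smul' := fun c v => by rw [map_smul]; rfl }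
  have hb : Function.Injective b := by
    rw [injective_iff_map_eq_zero]
    intro v hv
    refine h.nondegenerate m v fun w => ?_
    have := LinearMap.congr_fun hv w
    exact (asBilin_apply (X := EuclideanSpace ℝ (Fin d)) (σ m) v w).symm.trans this
  have hs : Function.Surjective b :=
    (LinearMap.injective_iff_surjective_of_finrank_eq_finrank
      (Subspace.dual_finrank_eq).symm).1 hb
  obtain ⟨v, hv⟩ := hs (a.comp (mfderiv (𝓡 d) (𝓡 k) π m)).toLinearMap
  exact ⟨v, fun w => (asBilin_apply (X := EuclideanSpace ℝ (Fin d)) (σ m) v w).symm.trans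
    (LinearMap.congr_fun hv w)⟩

/-- Pair with a covector `β` and let `ι_w σ = π^*β`. Then `β (Dπ v) = σ (w, v) = - σ (v, w)`, which
equals `- β (Λ a)` because `π` is almost Poisson. -/
theorem IsASCIR.mfderiv_contraction (h : IsASCIR Λ π σ η) {m : M} {a : Covec k (π m)}
    {v : TangentSpace (𝓡 d) m} (hv : ∀ w, σ m ![v, w] = a (mfderiv (𝓡 d) (𝓡 k) π m w)) :
    mfderiv (𝓡 d) (𝓡 k) π m v = - Λ (π m) a := by
  rw [← add_eq_zero_iff_eq_neg]
  refine eq_zero_of_forall_covec fun β => ?_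
  obtain ⟨w, hw⟩ := h.exists_contraction m β
  have h1 := h.almost_poisson m a β v w hv hw
  have h2 := form_swap (X := EuclideanSpace ℝ (Fin d)) (σ m) v w
  rw [map_add, ← h1, ← hw v]
  exact (congrArg (fun c : ℝ => (σ m) ![w, v] + c) h2).trans (add_neg_cancel _)

theorem IsASCIR.contraction_vertical_iff (h : IsASCIR Λ π σ η)
    (hΛ : ∀ (b : B) (α β : Covec k b), β (Λ b α) = - α (Λ b β)) {m : M} {a : Covec k (π m)}
    {v : TangentSpace (𝓡 d) m} (hv : ∀ w, σ m ![v, w] = a (mfderiv (𝓡 d) (𝓡 k) π m w)) :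
    mfderiv (𝓡 d) (𝓡 k) π m v = 0 ↔ a ∈ conormal Λ (π m) := by
  rw [h.mfderiv_contraction hv, mem_conormal_iff hΛ, neg_eq_zero]

end Pointwise


/-! ### Differentials of a chart and its inverse are inverse to each other. -/

section ChartDerivatives

variable {d : ℕ} {M : Type u} [TopologicalSpace M] [ChartedSpace (EuclideanSpace ℝ (Fin d)) M]
  {X : Type} [NormedAddCommGroup X] [NormedSpace ℝ X]

theorem mfderiv_symm_mfderiv (C : OpenPartialHomeomorph M X) {m : M} (hm : m ∈ C.source)
    (h : ContMDiffAt (𝓡 d) 𝓘(ℝ, X) ∞ C m)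
    (h' : ContMDiffAt 𝓘(ℝ, X) (𝓡 d) ∞ C.symm (C m)) (v : TangentSpace (𝓡 d) m) :
    mfderiv 𝓘(ℝ, X) (𝓡 d) C.symm (C m) (mfderiv (𝓡 d) 𝓘(ℝ, X) C m v) = v := by
  have h1 := mfderiv_comp m (h'.mdifferentiableAt (by simp)) (h.mdifferentiableAt (by simp))
  have h2 : C.symm ∘ C =ᶠ[nhds m] id := by
    filter_upwards [C.open_source.mem_nhds hm] with y hy
    exact C.left_inv hy
  rw [h2.mfderiv_eq, mfderiv_id] at h1
  exact (congrArg (fun A : EuclideanSpace ℝ (Fin d) →L[ℝ] EuclideanSpace ℝ (Fin d) => A v) h1).symm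

theorem mfderiv_mfderiv_symm (C : OpenPartialHomeomorph M X) {x : X} (hx : x ∈ C.target)
    (h : ContMDiffAt (𝓡 d) 𝓘(ℝ, X) ∞ C (C.symm x))
    (h' : ContMDiffAt 𝓘(ℝ, X) (𝓡 d) ∞ C.symm x) (v : X) :
    mfderiv (𝓡 d) 𝓘(ℝ, X) C (C.symm x) (mfderiv 𝓘(ℝ, X) (𝓡 d) C.symm x v) = v := by
  have h1 := mfderiv_comp x (h.mdifferentiableAt (by simp)) (h'.mdifferentiableAt (by simp))
  have h2 : C ∘ C.symm =ᶠ[nhds x] id := by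
    filter_upwards [C.open_target.mem_nhds hx] with y hy
    exact C.right_inv hy
  rw [h2.mfderiv_eq, mfderiv_id] at h1
  exact (congrArg (fun A : X →L[ℝ] X => A v) h1).symm

variable [IsManifold (𝓡 d) ∞ M]

theorem mfderiv_extChartAt_symm_mfderiv {m₀ m : M} (hm : m ∈ (extChartAt (𝓡 d) m₀).source)
    (v : TangentSpace (𝓡 d) m) :
    mfderiv (𝓡 d) (𝓡 d) (extChartAt (𝓡 d) m₀).symm (extChartAt (𝓡 d) m₀ m)
      (mfderiv (𝓡 d) (𝓡 d) (extChartAt (𝓡 d) m₀) m v) = v := by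
  have h1 := mfderiv_comp m ((contMDiffAt_extChartAt_symm
    ((extChartAt (𝓡 d) m₀).map_source hm)).mdifferentiableAt (by simp))
    ((contMDiffAt_extChartAt_of_mem hm).mdifferentiableAt (by simp))
  have h2 : (extChartAt (𝓡 d) m₀).symm ∘ (extChartAt (𝓡 d) m₀) =ᶠ[nhds m] id := by
    filter_upwards [(isOpen_extChartAt_source (I := 𝓡 d) m₀).mem_nhds hm] with y hy
    exact (extChartAt (𝓡 d) m₀).left_inv hy
  rw [h2.mfderiv_eq, mfderiv_id] at h1
  exact (congrArg (fun A : EuclideanSpace ℝ (Fin d) →L[ℝ] EuclideanSpace ℝ (Fin d) => A v) h1).symm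

theorem mfderiv_extChartAt_mfderiv_symm {m₀ : M} {y : EuclideanSpace ℝ (Fin d)}
    (hy : y ∈ (extChartAt (𝓡 d) m₀).target) (v : EuclideanSpace ℝ (Fin d)) :
    mfderiv (𝓡 d) (𝓡 d) (extChartAt (𝓡 d) m₀) ((extChartAt (𝓡 d) m₀).symm y)
      (mfderiv (𝓡 d) (𝓡 d) (extChartAt (𝓡 d) m₀).symm y v) = v := by
  have h1 := mfderiv_comp y
    ((contMDiffAt_extChartAt_of_mem ((extChartAt (𝓡 d) m₀).map_target hy)).mdifferentiableAt
      (by simp))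
    ((contMDiffAt_extChartAt_symm hy).mdifferentiableAt (by simp))
  have h2 : (extChartAt (𝓡 d) m₀) ∘ (extChartAt (𝓡 d) m₀).symm =ᶠ[nhds y] id := by
    filter_upwards [(isOpen_extChartAt_target (I := 𝓡 d) m₀).mem_nhds hy] with y hy
    exact (extChartAt (𝓡 d) m₀).right_inv hy
  rw [h2.mfderiv_eq, mfderiv_id] at h1
  exact (congrArg (fun A : EuclideanSpace ℝ (Fin d) →L[ℝ] EuclideanSpace ℝ (Fin d) => A v) h1).symm

end ChartDerivatives

/-! ### Charts of the total space adapted to the submersion. -/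

section SubmersionChart

open Set

variable {k d : ℕ} {B M : Type u}
  [TopologicalSpace B] [ChartedSpace (EuclideanSpace ℝ (Fin k)) B] [IsManifold (𝓡 k) ∞ B]
  [TopologicalSpace M] [ChartedSpace (EuclideanSpace ℝ (Fin d)) M] [IsManifold (𝓡 d) ∞ M]

/-- Base directions and fiber directions. -/
abbrev Model (k d : ℕ) : Type := EuclideanSpace ℝ (Fin k) × EuclideanSpace ℝ (Fin (d - k))

/-- A chart near `m₀` of the total space of a submersion in which the submersion is the first
projection. -/
structure SubmersionChart (π : C^∞⟮𝓡 d, M; 𝓡 k, B⟯) (m₀ : M) where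
  coord : OpenPartialHomeomorph M (Model k d)
  mem_source : m₀ ∈ coord.source
  smooth : ∀ m ∈ coord.source, ContMDiffAt (𝓡 d) 𝓘(ℝ, Model k d) ∞ coord m
  smooth_symm : ∀ x ∈ coord.target, ContMDiffAt 𝓘(ℝ, Model k d) (𝓡 d) ∞ coord.symm x
  base_mem : ∀ m ∈ coord.source, π m ∈ (extChartAt (𝓡 k) (π m₀)).source
  fst : ∀ m ∈ coord.source, (coord m).1 = extChartAt (𝓡 k) (π m₀) (π m)

variable {π : C^∞⟮𝓡 d, M; 𝓡 k, B⟯} {m₀ : M}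

theorem exists_submersionChart (h : Function.Surjective (mfderiv (𝓡 d) (𝓡 k) π m₀)) :
    ∃ (c : SubmersionChart π m₀) (S : Set (EuclideanSpace ℝ (Fin k)))
      (Z : Set (EuclideanSpace ℝ (Fin (d - k)))),
      c.coord.target = S ×ˢ Z ∧ IsOpen S ∧ IsOpen Z ∧ Convex ℝ Z := by
  set ψ := extChartAt (𝓡 k) (π m₀)
  set χ := extChartAt (𝓡 d) m₀
  let F : EuclideanSpace ℝ (Fin d) → EuclideanSpace ℝ (Fin k) := fun y => ψ (π (χ.symm y))
  let O : Set (EuclideanSpace ℝ (Fin d)) := χ.target ∩ χ.symm ⁻¹' (π ⁻¹' ψ.source)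
  have hO : IsOpen O := (continuousOn_extChartAt_symm m₀).isOpen_inter_preimage
    (isOpen_extChartAt_target m₀)
    ((isOpen_extChartAt_source (I := 𝓡 k) (π m₀)).preimage π.contMDiff.continuous)
  have hχm : χ.symm (χ m₀) = m₀ := extChartAt_to_inv m₀
  have hmO : χ m₀ ∈ O := ⟨mem_extChartAt_target m₀, by
    change π (χ.symm (χ m₀)) ∈ ψ.source
    rw [hχm]
    exact mem_extChartAt_source (π m₀)⟩
  have hF : ∀ y ∈ O, ContDiffAt ℝ ∞ F y := fun y hy =>
    ((contMDiffAt_extChartAt_of_mem hy.2).comp y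
      (π.contMDiff.contMDiffAt.comp y (contMDiffAt_extChartAt_symm hy.1))).contDiffAt
  have hFd : ∀ v, fderiv ℝ F (χ m₀) (mfderiv (𝓡 d) (𝓡 d) χ m₀ v)
      = mfderiv (𝓡 k) (𝓡 k) ψ (π m₀) (mfderiv (𝓡 d) (𝓡 k) π m₀ v) := by
    intro v
    have h1 : ContMDiffAt (𝓡 d) (𝓡 k) ∞ F (χ m₀) := (hF _ hmO).contMDiffAt
    have h2 := mfderiv_comp m₀ (h1.mdifferentiableAt (by simp))
      ((contMDiffAt_extChartAt_of_mem (mem_extChartAt_source m₀)).mdifferentiableAt (by simp))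
    have h3 : F ∘ χ =ᶠ[nhds m₀] ψ ∘ π := by
      filter_upwards [(isOpen_extChartAt_source (I := 𝓡 d) m₀).mem_nhds
        (mem_extChartAt_source m₀)] with y hy
      change ψ (π (χ.symm (χ y))) = ψ (π y)
      rw [χ.left_inv hy]
    have h4 := mfderiv_comp m₀ ((contMDiffAt_extChartAt_of_mem
      (mem_extChartAt_source (π m₀))).mdifferentiableAt (by simp))
      (π.contMDiff.contMDiffAt.mdifferentiableAt (x := m₀) (by simp))
    rw [h3.mfderiv_eq, h4, mfderiv_eq_fderiv] at h2
    exact (congrArg (fun A : EuclideanSpace ℝ (Fin d) →L[ℝ] EuclideanSpace ℝ (Fin k) => A v)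
      h2).symm
  have hsurj : Function.Surjective (fderiv ℝ F (χ m₀)) := by
    intro w
    obtain ⟨v, hv⟩ := h (mfderiv (𝓡 k) (𝓡 k) ψ.symm (ψ (π m₀)) w)
    refine ⟨mfderiv (𝓡 d) (𝓡 d) χ m₀ v, (hFd v).trans ?_⟩
    rw [hv]
    have h1 := mfderiv_extChartAt_mfderiv_symm (mem_extChartAt_target (I := 𝓡 k) (π m₀)) w
    rwa [extChartAt_to_inv] at h1
  -- The fibre dimension `d - k` is a truncated subtraction; surjectivity of the differential makes
  -- it the true difference.
  have hle : k ≤ d := by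
    have := LinearMap.finrank_le_finrank_of_surjective (f := (fderiv ℝ F (χ m₀)).toLinearMap) hsurj
    simpa using this
  obtain ⟨e, S, Z, hme, heO, het, hS, hZ, hZc, hes, hess, hefst⟩ :=
    exists_straightening (K := EuclideanSpace ℝ (Fin (d - k))) hO hF hmO hsurj (by simp; omega)
  let Φ : OpenPartialHomeomorph M (Model k d) :=
    (chartAt (EuclideanSpace ℝ (Fin d)) m₀).trans e
  have hΦs : ∀ m ∈ Φ.source, m ∈ χ.source ∧ χ m ∈ e.source := by
    intro m hm
    have hm' : m ∈ ((chartAt (EuclideanSpace ℝ (Fin d)) m₀).trans e).source := hm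
    rw [OpenPartialHomeomorph.trans_source] at hm'
    refine ⟨?_, hm'.2⟩
    rw [extChartAt_source]
    exact hm'.1
  have hΦt : Φ.target = S ×ˢ Z := by
    have h1 : Φ.target = e.target ∩ e.symm ⁻¹' (chartAt (EuclideanSpace ℝ (Fin d)) m₀).target :=
      OpenPartialHomeomorph.trans_target _ _
    rw [h1, ← het, inter_eq_left]
    intro x hx
    have h2 := (heO (e.map_target hx)).1
    have h3 : χ.target = (chartAt (EuclideanSpace ℝ (Fin d)) m₀).target := by
      simp [χ, extChartAt]
    rw [h3] at h2
    exact h2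
  refine ⟨{
    coord := Φ
    mem_source := ?_
    smooth := ?_
    smooth_symm := ?_
    base_mem := ?_
    fst := ?_ }, S, Z, hΦt, hS, hZ, hZc⟩
  · change m₀ ∈ ((chartAt (EuclideanSpace ℝ (Fin d)) m₀).trans e).source
    rw [OpenPartialHomeomorph.trans_source]
    exact ⟨mem_chart_source _ m₀, hme⟩
  · intro m hm
    exact (hes _ (hΦs m hm).2).contMDiffAt.comp m (contMDiffAt_extChartAt_of_mem (hΦs m hm).1)
  · intro x hx
    rw [hΦt, ← het] at hx
    exact (contMDiffAt_extChartAt_symm (heO (e.map_target hx)).1).comp x (hess x hx).contMDiffAt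
  · intro m hm
    have := (heO (hΦs m hm).2).2
    change π (χ.symm (χ m)) ∈ ψ.source at this
    rwa [χ.left_inv (hΦs m hm).1] at this
  · intro m hm
    refine (hefst _ (hΦs m hm).2).trans ?_
    change ψ (π (χ.symm (χ m))) = ψ (π m)
    rw [χ.left_inv (hΦs m hm).1]

namespace SubmersionChart

variable (c : SubmersionChart π m₀)

omit [IsManifold (𝓡 d) ∞ M] in
theorem mfderiv_fst {m : M} (hm : m ∈ c.coord.source) (v : TangentSpace (𝓡 d) m) :
    (mfderiv (𝓡 d) 𝓘(ℝ, Model k d) c.coord m v : Model k d).1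
      = mfderiv (𝓡 k) (𝓡 k) (extChartAt (𝓡 k) (π m₀)) (π m) (mfderiv (𝓡 d) (𝓡 k) π m v) := by
  have h1 := mfderiv_comp m
    ((contMDiffAt_extChartAt_of_mem (c.base_mem m hm)).mdifferentiableAt (by simp))
    (π.contMDiff.contMDiffAt.mdifferentiableAt (x := m) (by simp))
  have h2 : (fun x : Model k d => x.1) ∘ c.coord =ᶠ[nhds m] extChartAt (𝓡 k) (π m₀) ∘ π := by
    filter_upwards [c.coord.open_source.mem_nhds hm] with y hy
    exact c.fst y hy
  have h3 : ContMDiffAt 𝓘(ℝ, Model k d) (𝓡 k) ∞ (fun x : Model k d => x.1) (c.coord m) :=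
    contDiffAt_fst.contMDiffAt
  have h4 := mfderiv_comp m (h3.mdifferentiableAt (by simp))
    ((c.smooth m hm).mdifferentiableAt (by simp))
  have h5 : mfderiv 𝓘(ℝ, Model k d) (𝓡 k) (fun x : Model k d => x.1) (c.coord m)
      = ContinuousLinearMap.fst ℝ (EuclideanSpace ℝ (Fin k)) (EuclideanSpace ℝ (Fin (d - k))) := by
    rw [mfderiv_eq_fderiv]
    exact fderiv_fst
  rw [h2.mfderiv_eq, h1, h5] at h4
  exact (congrArg (fun A : EuclideanSpace ℝ (Fin d) →L[ℝ] EuclideanSpace ℝ (Fin k) => A v) h4).symm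

omit [IsManifold (𝓡 d) ∞ M] in
theorem mfderiv_proj {m : M} (hm : m ∈ c.coord.source) (v : TangentSpace (𝓡 d) m) :
    mfderiv (𝓡 k) (𝓡 k) (extChartAt (𝓡 k) (π m₀)).symm (extChartAt (𝓡 k) (π m₀) (π m))
      (mfderiv (𝓡 d) 𝓘(ℝ, Model k d) c.coord m v : Model k d).1
      = mfderiv (𝓡 d) (𝓡 k) π m v := by
  rw [c.mfderiv_fst hm, mfderiv_extChartAt_symm_mfderiv (c.base_mem m hm)]

omit [IsManifold (𝓡 d) ∞ M] in
theorem mfderiv_proj_eq_zero_iff {m : M} (hm : m ∈ c.coord.source) (v : TangentSpace (𝓡 d) m) :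
    mfderiv (𝓡 d) (𝓡 k) π m v = 0
      ↔ (mfderiv (𝓡 d) 𝓘(ℝ, Model k d) c.coord m v : Model k d).1 = 0 := by
  constructor
  · intro h
    rw [c.mfderiv_fst hm, h, map_zero]
    rfl
  · intro h
    rw [← c.mfderiv_proj hm, h]
    exact map_zero (mfderiv (𝓡 k) (𝓡 k) (extChartAt (𝓡 k) (π m₀)).symm
      (extChartAt (𝓡 k) (π m₀) (π m)))

omit [IsManifold (𝓡 d) ∞ M] [IsManifold (𝓡 k) ∞ B] in
theorem fst_symm {x : Model k d} (hx : x ∈ c.coord.target) :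
    extChartAt (𝓡 k) (π m₀) (π (c.coord.symm x)) = x.1 := by
  rw [← c.fst _ (c.coord.map_target hx), c.coord.right_inv hx]

end SubmersionChart

end SubmersionChart


/-! ### A realization in a submersion chart is a flat model. -/

section ToFlat

open Set

variable {k d : ℕ} {B M : Type u}
  [TopologicalSpace B] [ChartedSpace (EuclideanSpace ℝ (Fin k)) B]
  [TopologicalSpace M] [ChartedSpace (EuclideanSpace ℝ (Fin d)) M]

/-- The conormal spaces of the foliation in the preferred chart at `b₀`. -/
noncomputable def chartConormal (Λ : BivectorField k B) (b₀ : B) (y : EuclideanSpace ℝ (Fin k)) :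
    Submodule ℝ (EuclideanSpace ℝ (Fin k) →L[ℝ] ℝ) :=
  LinearMap.ker ((Λ ((extChartAt (𝓡 k) b₀).symm y)).comp (ContinuousLinearMap.precomp ℝ
    (mfderiv (𝓡 k) (𝓡 k) (extChartAt (𝓡 k) b₀) ((extChartAt (𝓡 k) b₀).symm y)))).toLinearMap

theorem mem_chartConormal {Λ : BivectorField k B}
    (hΛ : ∀ (b : B) (α β : Covec k b), β (Λ b α) = - α (Λ b β)) {b₀ b : B}
    (hb : b ∈ (extChartAt (𝓡 k) b₀).source) {a : EuclideanSpace ℝ (Fin k) →L[ℝ] ℝ} :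
    a ∈ chartConormal Λ b₀ (extChartAt (𝓡 k) b₀ b)
      ↔ a.comp (mfderiv (𝓡 k) (𝓡 k) (extChartAt (𝓡 k) b₀) b) ∈ conormal Λ b := by
  rw [mem_conormal_iff hΛ]
  unfold chartConormal
  rw [(extChartAt (𝓡 k) b₀).left_inv hb]
  rfl

variable [IsManifold (𝓡 k) ∞ B] [IsManifold (𝓡 d) ∞ M]
  {Λ : BivectorField k B} {π : C^∞⟮𝓡 d, M; 𝓡 k, B⟯} {σ : DiffForm d M 2} {η : DiffForm k B 3}
  {m₀ : M}

namespace SubmersionChart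

variable (c : SubmersionChart π m₀)

/-- The `2`-form of the total space in a submersion chart. -/
noncomputable def flatForm (σ : DiffForm d M 2) (x : Model k d) :
    Model k d →L[ℝ] Model k d →L[ℝ] ℝ :=
  asBilin (formPull c.coord.symm σ x)

omit [IsManifold (𝓡 k) ∞ B] [IsManifold (𝓡 d) ∞ M] in
theorem flatForm_apply (x v w : Model k d) : c.flatForm σ x v w =
    σ (c.coord.symm x) ![mfderiv 𝓘(ℝ, Model k d) (𝓡 d) c.coord.symm x v,
      mfderiv 𝓘(ℝ, Model k d) (𝓡 d) c.coord.symm x w] := by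
  refine (asBilin_apply _ _ _).trans ?_
  change (σ (c.coord.symm x)) (fun i => mfderiv 𝓘(ℝ, Model k d) (𝓡 d) c.coord.symm x (![v, w] i)) = _
  congr 1
  ext i
  fin_cases i <;> rfl

omit [IsManifold (𝓡 k) ∞ B] [IsManifold (𝓡 d) ∞ M] in
theorem mfderiv_coord_symm {x : Model k d} (hx : x ∈ c.coord.target) (v : Model k d) :
    mfderiv (𝓡 d) 𝓘(ℝ, Model k d) c.coord (c.coord.symm x)
      (mfderiv 𝓘(ℝ, Model k d) (𝓡 d) c.coord.symm x v) = v :=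
  mfderiv_mfderiv_symm c.coord hx (c.smooth _ (c.coord.map_target hx)) (c.smooth_symm x hx) v

omit [IsManifold (𝓡 k) ∞ B] [IsManifold (𝓡 d) ∞ M] in
theorem mfderiv_symm_coord {x : Model k d} (hx : x ∈ c.coord.target)
    (v : TangentSpace (𝓡 d) (c.coord.symm x)) :
    mfderiv 𝓘(ℝ, Model k d) (𝓡 d) c.coord.symm x
      (mfderiv (𝓡 d) 𝓘(ℝ, Model k d) c.coord (c.coord.symm x) v) = v := by
  have h := mfderiv_symm_mfderiv c.coord (c.coord.map_target hx)
    (c.smooth _ (c.coord.map_target hx))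
    (by rw [c.coord.right_inv hx]; exact c.smooth_symm x hx) v
  have hr := c.coord.right_inv hx
  have h2 : ∀ y, y = x → ∀ u : Model k d,
      (mfderiv 𝓘(ℝ, Model k d) (𝓡 d) c.coord.symm y u : EuclideanSpace ℝ (Fin d))
        = mfderiv 𝓘(ℝ, Model k d) (𝓡 d) c.coord.symm x u := by
    rintro y rfl u; rfl
  exact (h2 _ hr _).symm.trans h

omit [IsManifold (𝓡 k) ∞ B] [IsManifold (𝓡 d) ∞ M] in
theorem exists_mfderiv_symm_eq {x : Model k d} (hx : x ∈ c.coord.target)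
    (v : TangentSpace (𝓡 d) (c.coord.symm x)) :
    ∃ u : Model k d, mfderiv 𝓘(ℝ, Model k d) (𝓡 d) c.coord.symm x u = v :=
  ⟨_, c.mfderiv_symm_coord hx v⟩

omit [IsManifold (𝓡 d) ∞ M] in
theorem mfderiv_fst_symm {x : Model k d} (hx : x ∈ c.coord.target) (v : Model k d) :
    mfderiv (𝓡 k) (𝓡 k) (extChartAt (𝓡 k) (π m₀)) (π (c.coord.symm x))
      (mfderiv (𝓡 d) (𝓡 k) π (c.coord.symm x)
        (mfderiv 𝓘(ℝ, Model k d) (𝓡 d) c.coord.symm x v)) = v.1 := by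
  rw [← c.mfderiv_fst (c.coord.map_target hx), c.mfderiv_coord_symm hx]

omit [IsManifold (𝓡 d) ∞ M] in
theorem vertical_symm_iff {x : Model k d} (hx : x ∈ c.coord.target) (v : Model k d) :
    mfderiv (𝓡 d) (𝓡 k) π (c.coord.symm x)
        (mfderiv 𝓘(ℝ, Model k d) (𝓡 d) c.coord.symm x v) = 0 ↔ v.1 = 0 := by
  rw [c.mfderiv_proj_eq_zero_iff (c.coord.map_target hx), c.mfderiv_coord_symm hx]

omit [IsManifold (𝓡 k) ∞ B] [IsManifold (𝓡 d) ∞ M] in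
theorem mem_chartConormal_symm (hΛ : ∀ (b : B) (α β : Covec k b), β (Λ b α) = - α (Λ b β))
    {x : Model k d} (hx : x ∈ c.coord.target) (a : EuclideanSpace ℝ (Fin k) →L[ℝ] ℝ) :
    a ∈ chartConormal Λ (π m₀) x.1 ↔ a.comp (mfderiv (𝓡 k) (𝓡 k) (extChartAt (𝓡 k) (π m₀))
      (π (c.coord.symm x))) ∈ conormal Λ (π (c.coord.symm x)) := by
  rw [← c.fst_symm hx]
  exact mem_chartConormal hΛ (c.base_mem _ (c.coord.map_target hx))

/-- Conormal covectors are those whose contraction vector is vertical, which gives `mem_iff`. The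
twisting condition gives `closed`: `dσ` is a pullback from `B`, so it vanishes on a vertical
argument. -/
theorem flatModel (h : IsASCIR Λ π σ η)
    (hΛ : ∀ (b : B) (α β : Covec k b), β (Λ b α) = - α (Λ b β))
    {S : Set (EuclideanSpace ℝ (Fin k))} {Z : Set (EuclideanSpace ℝ (Fin (d - k)))}
    (ht : c.coord.target = S ×ˢ Z) (hS : IsOpen S) (hZ : IsOpen Z) (hZc : Convex ℝ Z) :
    FlatModel S Z (c.flatForm σ) (chartConormal Λ (π m₀)) := by
  have hsm : ∀ x ∈ c.coord.target,
      ∀ᶠ y in nhds x, ContMDiffAt 𝓘(ℝ, Model k d) (𝓡 d) ∞ c.coord.symm y := fun x hx =>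
    Filter.eventually_of_mem (c.coord.open_target.mem_nhds hx) c.smooth_symm
  have hform : ∀ x ∈ c.coord.target, ContDiffAt ℝ ∞ (formPull c.coord.symm σ) x := fun x hx =>
    contDiffAt_formPull_two (hsm x hx) (h.smooth _)
  refine ⟨hS, hZ, hZc, fun x hx => ?_, fun x v w => ?_, fun x hx ζ ζ' => ?_, fun x hx v hv => ?_,
    fun x hx a => ?_, fun x hx ζ v w => ?_⟩
  · rw [← ht] at hx
    exact contDiffAt_asBilin (hform x hx)
  · rw [flatForm, asBilin_apply, asBilin_apply]
    exact form_swap _ _ _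
  · rw [← ht] at hx
    rw [flatForm_apply]
    exact h.isotropic _ _ _ ((c.vertical_symm_iff hx _).2 rfl) ((c.vertical_symm_iff hx _).2 rfl)
  · rw [← ht] at hx
    have h1 := h.nondegenerate (c.coord.symm x)
      (mfderiv 𝓘(ℝ, Model k d) (𝓡 d) c.coord.symm x v) fun w => by
        obtain ⟨u, rfl⟩ := c.exists_mfderiv_symm_eq hx w
        exact (c.flatForm_apply x v u).symm.trans (hv u)
    rw [← c.mfderiv_coord_symm hx v, h1]
    exact map_zero (mfderiv (𝓡 d) 𝓘(ℝ, Model k d) c.coord (c.coord.symm x))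
  · rw [← ht] at hx
    rw [c.mem_chartConormal_symm hΛ hx]
    constructor
    · intro ha
      obtain ⟨v, hv⟩ := h.exists_contraction (c.coord.symm x)
        (a.comp (mfderiv (𝓡 k) (𝓡 k) (extChartAt (𝓡 k) (π m₀)) (π (c.coord.symm x))))
      have hv0 := (h.contraction_vertical_iff hΛ hv).2 ha
      obtain ⟨⟨η, ζ⟩, rfl⟩ := c.exists_mfderiv_symm_eq hx v
      obtain rfl : η = 0 := (c.vertical_symm_iff hx _).1 hv0
      refine ⟨ζ, fun w => ?_⟩
      refine (c.flatForm_apply x _ w).trans ((hv _).trans ?_)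
      exact congrArg a (c.mfderiv_fst_symm hx w)
    · rintro ⟨ζ, hζ⟩
      refine (h.contraction_vertical_iff hΛ fun w => ?_).1 ((c.vertical_symm_iff hx (0, ζ)).2 rfl)
      obtain ⟨u, rfl⟩ := c.exists_mfderiv_symm_eq hx w
      refine (c.flatForm_apply x _ u).symm.trans ((hζ u).trans ?_)
      exact (congrArg a (c.mfderiv_fst_symm hx u)).symm
  · rw [← ht] at hx
    have h1 := extDeriv_two_form ((hform x hx).of_le (WithTop.coe_le_coe.2 le_top))
      ![((0, ζ) : Model k d), v, w]
    rw [extDeriv_formPull (hsm x hx) (h.smooth _), h.twisting] at h1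
    refine Eq.trans h1.symm ?_
    refine (η (π (c.coord.symm x))).toAlternatingMap.map_coord_zero 0 ?_
    exact (c.vertical_symm_iff hx (0, ζ)).2 rfl

end SubmersionChart

end ToFlat


/-! ### Action charts: all vertical flows become translations. -/

section ActionCharts

open Set

variable {k d : ℕ} {B M : Type u}
  [TopologicalSpace B] [ChartedSpace (EuclideanSpace ℝ (Fin k)) B]
  [TopologicalSpace M] [ChartedSpace (EuclideanSpace ℝ (Fin d)) M]

/-- A submersion chart in which the vertical field `X` with `ι_X σ = π^* a` is the constant field
`(0, L a)`. -/
structure ActionChart (Λ : BivectorField k B) (π : C^∞⟮𝓡 d, M; 𝓡 k, B⟯) (σ : DiffForm d M 2)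
    (m₀ : M) extends SubmersionChart π m₀ where
  L : ∀ b : B, Covec k b →L[ℝ] EuclideanSpace ℝ (Fin (d - k))
  flow_iff : ∀ m ∈ coord.source, ∀ a ∈ conormal Λ (π m), ∀ v : TangentSpace (𝓡 d) m,
    (∀ w, σ m ![v, w] = a (mfderiv (𝓡 d) (𝓡 k) π m w)) ↔
      mfderiv (𝓡 d) 𝓘(ℝ, Model k d) coord m v = ((0, L (π m) a) : Model k d)
  injective : ∀ m ∈ coord.source, ∀ a ∈ conormal Λ (π m), L (π m) a = 0 → a = 0
  exists_form : ∀ m ∈ coord.source, ∀ g : B → EuclideanSpace ℝ (Fin (d - k)),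
    (∀ᶠ b in nhds (π m), ContMDiffAt (𝓡 k) 𝓘(ℝ, EuclideanSpace ℝ (Fin (d - k))) ∞ g b) →
    ∃ α : ∀ b : B, Covec k b, (∀ᶠ b in nhds (π m), DiffForm.SmoothAt (oneForm α) b ∧
      α b ∈ conormal Λ b ∧ L b (α b) = g b)
  smooth_L : ∀ m ∈ coord.source, ∀ α : (∀ b : B, Covec k b), DiffForm.SmoothAt (oneForm α) (π m) →
    ContMDiffAt (𝓡 k) 𝓘(ℝ, EuclideanSpace ℝ (Fin (d - k))) ∞ (fun b => L b (α b)) (π m)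
  pullback : ∀ (G : M → M) (α : ∀ b : B, Covec k b), ∀ m ∈ coord.source, G m ∈ coord.source →
    MDifferentiableAt (𝓡 d) (𝓡 d) G m → DiffForm.SmoothAt (oneForm α) (π m) →
    (∀ᶠ m' in nhds m, π (G m') = π m') → (∀ᶠ m' in nhds m, α (π m') ∈ conormal Λ (π m')) →
    (∀ᶠ m' in nhds m, (coord (G m')).2 = (coord m').2 + L (π m') (α (π m'))) →
    ∀ v w : TangentSpace (𝓡 d) m,
      σ (G m) ![mfderiv (𝓡 d) (𝓡 d) G m v, mfderiv (𝓡 d) (𝓡 d) G m w] = σ m ![v, w]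
        + DiffForm.d (oneForm α) (π m) ![mfderiv (𝓡 d) (𝓡 k) π m v, mfderiv (𝓡 d) (𝓡 k) π m w]

variable [IsManifold (𝓡 k) ∞ B] [IsManifold (𝓡 d) ∞ M]
  {Λ : BivectorField k B} {π : C^∞⟮𝓡 d, M; 𝓡 k, B⟯} {σ : DiffForm d M 2} {η : DiffForm k B 3}
  {m₀ : M}

theorem eventually_contMDiffAt_extChartAt_symm {b₀ : B} {y : EuclideanSpace ℝ (Fin k)}
    (hy : y ∈ (extChartAt (𝓡 k) b₀).target) :
    ∀ᶠ y' in nhds y, ContMDiffAt 𝓘(ℝ, EuclideanSpace ℝ (Fin k)) (𝓡 k) ∞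
      (extChartAt (𝓡 k) b₀).symm y' :=
  Filter.eventually_of_mem ((isOpen_extChartAt_target b₀).mem_nhds hy)
    fun _ h => contMDiffAt_extChartAt_symm h

/-- Covectors at `b` in the preferred chart at `b₀`. -/
noncomputable def covecCoord (b₀ b : B) : Covec k b →L[ℝ] EuclideanSpace ℝ (Fin k) →L[ℝ] ℝ :=
  ContinuousLinearMap.precomp ℝ
    (mfderiv (𝓡 k) (𝓡 k) (extChartAt (𝓡 k) b₀).symm (extChartAt (𝓡 k) b₀ b) :
      EuclideanSpace ℝ (Fin k) →L[ℝ] EuclideanSpace ℝ (Fin k))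

theorem covecCoord_comp {b₀ b : B} (hb : b ∈ (extChartAt (𝓡 k) b₀).source) (a : Covec k b) :
    (covecCoord b₀ b a).comp (mfderiv (𝓡 k) (𝓡 k) (extChartAt (𝓡 k) b₀) b) = a :=
  ContinuousLinearMap.ext fun v => congrArg a (mfderiv_extChartAt_symm_mfderiv hb v)

theorem covecCoord_apply_comp {b₀ b : B} (hb : b ∈ (extChartAt (𝓡 k) b₀).source)
    (a : EuclideanSpace ℝ (Fin k) →L[ℝ] ℝ) :
    covecCoord b₀ b (a.comp (mfderiv (𝓡 k) (𝓡 k) (extChartAt (𝓡 k) b₀) b)) = a := by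
  ext v
  have h1 := mfderiv_extChartAt_mfderiv_symm ((extChartAt (𝓡 k) b₀).map_source hb) v
  rw [(extChartAt (𝓡 k) b₀).left_inv hb] at h1
  exact congrArg a h1

omit [IsManifold (𝓡 k) ∞ B] in
theorem covPull_extChartAt_symm {b₀ b : B} (hb : b ∈ (extChartAt (𝓡 k) b₀).source)
    (α : ∀ b : B, Covec k b) :
    covPull (extChartAt (𝓡 k) b₀).symm α (extChartAt (𝓡 k) b₀ b) = covecCoord b₀ b (α b) := by
  have h : ∀ b', b' = b → ContinuousLinearMap.comp (α b' : EuclideanSpace ℝ (Fin k) →L[ℝ] ℝ)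
      (mfderiv (𝓡 k) (𝓡 k) (extChartAt (𝓡 k) b₀).symm (extChartAt (𝓡 k) b₀ b) :
        EuclideanSpace ℝ (Fin k) →L[ℝ] EuclideanSpace ℝ (Fin k)) = covecCoord b₀ b (α b) := by
    rintro _ rfl; rfl
  exact h _ ((extChartAt (𝓡 k) b₀).left_inv hb)

theorem covecCoord_mem_iff (hΛ : ∀ (b : B) (α β : Covec k b), β (Λ b α) = - α (Λ b β)) {b₀ b : B}
    (hb : b ∈ (extChartAt (𝓡 k) b₀).source) {a : Covec k b} :
    covecCoord b₀ b a ∈ chartConormal Λ b₀ (extChartAt (𝓡 k) b₀ b) ↔ a ∈ conormal Λ b := by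
  rw [mem_chartConormal hΛ hb, covecCoord_comp hb]

omit [IsManifold (𝓡 d) ∞ M] in
theorem covecCoord_apply_proj (c : SubmersionChart π m₀) {m : M} (hm : m ∈ c.coord.source)
    (a : Covec k (π m)) (w : TangentSpace (𝓡 d) m) :
    covecCoord (π m₀) (π m) a (mfderiv (𝓡 d) 𝓘(ℝ, Model k d) c.coord m w : Model k d).1
      = a (mfderiv (𝓡 d) (𝓡 k) π m w) :=
  congrArg a (c.mfderiv_proj hm w)

omit [IsManifold (𝓡 k) ∞ B] [IsManifold (𝓡 d) ∞ M] in
-- Both sides evaluate the pullback of `σ` along `G ∘ coord.symm`, which near `x` equals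
-- `coord.symm` composed with the chart expression of `G`.
theorem flatForm_conj (c : SubmersionChart π m₀) {G : M → M} {x : Model k d}
    (hx : x ∈ c.coord.target) (hGx : G (c.coord.symm x) ∈ c.coord.source)
    (hG : MDifferentiableAt (𝓡 d) (𝓡 d) G (c.coord.symm x)) (v w : Model k d) :
    DifferentiableAt ℝ (fun x => c.coord (G (c.coord.symm x))) x ∧
    c.flatForm σ (c.coord (G (c.coord.symm x)))
        (fderiv ℝ (fun x => c.coord (G (c.coord.symm x))) x v)
        (fderiv ℝ (fun x => c.coord (G (c.coord.symm x))) x w)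
      = σ (G (c.coord.symm x)) ![mfderiv (𝓡 d) (𝓡 d) G (c.coord.symm x)
            (mfderiv 𝓘(ℝ, Model k d) (𝓡 d) c.coord.symm x v),
          mfderiv (𝓡 d) (𝓡 d) G (c.coord.symm x)
            (mfderiv 𝓘(ℝ, Model k d) (𝓡 d) c.coord.symm x w)] := by
  set Gt : Model k d → Model k d := fun x => c.coord (G (c.coord.symm x))
  have hsym := (c.smooth_symm x hx).mdifferentiableAt (by simp)
  have hGs := hG.comp x hsym
  have hGt : MDifferentiableAt 𝓘(ℝ, Model k d) 𝓘(ℝ, Model k d) Gt x :=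
    ((c.smooth _ hGx).mdifferentiableAt (by simp)).comp x hGs
  have hsymG : MDifferentiableAt 𝓘(ℝ, Model k d) (𝓡 d) c.coord.symm (Gt x) :=
    (c.smooth_symm _ (c.coord.map_source hGx)).mdifferentiableAt (by simp)
  refine ⟨hGt.differentiableAt, ?_⟩
  have he : c.coord.symm ∘ Gt =ᶠ[nhds x] G ∘ c.coord.symm := by
    filter_upwards [hGs.continuousAt.eventually (c.coord.open_source.mem_nhds hGx)] with x' hx'
    exact c.coord.left_inv hx'
  have h1 := formPull_congr σ he
  have h2 : ∀ v : Fin 2 → Model k d, formPull (c.coord.symm ∘ Gt) σ x v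
      = formPull c.coord.symm σ (Gt x) (fun i => fderiv ℝ Gt x (v i)) := by
    intro v
    unfold formPull
    rw [mfderiv_comp x hsymG hGt, mfderiv_eq_fderiv]
    rfl
  have h3 : ∀ v : Fin 2 → Model k d, formPull (G ∘ c.coord.symm) σ x v
      = σ (G (c.coord.symm x)) (fun i => mfderiv (𝓡 d) (𝓡 d) G (c.coord.symm x)
            (mfderiv 𝓘(ℝ, Model k d) (𝓡 d) c.coord.symm x (v i))) := by
    intro v
    unfold formPull
    rw [mfderiv_comp x hG hsym]
    rfl
  have h4 := (h2 ![v, w]).symm.trans ((congrArg (fun A => A ![v, w]) h1).trans (h3 ![v, w]))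
  refine ((asBilin_apply _ _ _).trans ?_).trans (h4.trans ?_)
  · congr 1
    funext i
    fin_cases i <;> rfl
  · congr 1
    ext i
    fin_cases i <;> rfl

theorem fderiv_covPull_extChartAt_symm {b₀ b : B} (hb : b ∈ (extChartAt (𝓡 k) b₀).source)
    {α : ∀ b : B, Covec k b} (hα : DiffForm.SmoothAt (oneForm α) b)
    (v w : EuclideanSpace ℝ (Fin k)) :
    DifferentiableAt ℝ (covPull (extChartAt (𝓡 k) b₀).symm α) (extChartAt (𝓡 k) b₀ b) ∧
    fderiv ℝ (covPull (extChartAt (𝓡 k) b₀).symm α) (extChartAt (𝓡 k) b₀ b) v w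
      - fderiv ℝ (covPull (extChartAt (𝓡 k) b₀).symm α) (extChartAt (𝓡 k) b₀ b) w v
      = DiffForm.d (oneForm α) b
        ![mfderiv (𝓡 k) (𝓡 k) (extChartAt (𝓡 k) b₀).symm (extChartAt (𝓡 k) b₀ b) v,
          mfderiv (𝓡 k) (𝓡 k) (extChartAt (𝓡 k) b₀).symm (extChartAt (𝓡 k) b₀ b) w] := by
  have hg := eventually_contMDiffAt_extChartAt_symm ((extChartAt (𝓡 k) b₀).map_source hb)
  have hl := (extChartAt (𝓡 k) b₀).left_inv hb
  have hα' : DiffForm.SmoothAt (oneForm α)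
      ((extChartAt (𝓡 k) b₀).symm (extChartAt (𝓡 k) b₀ b)) := by rwa [hl]
  refine ⟨(contDiffAt_covPull hg hα').differentiableAt (by simp), ?_⟩
  refine (d_oneForm_pull hg hα' v w).trans ?_
  have h : ∀ b', b' = b → ∀ u : Fin 2 → EuclideanSpace ℝ (Fin k),
      (DiffForm.d (oneForm α) b' : EuclideanSpace ℝ (Fin k) [⋀^Fin 2]→L[ℝ] ℝ) u
        = DiffForm.d (oneForm α) b u := by
    rintro _ rfl u; rfl
  exact h _ hl _

/-- A submersion chart followed by the flat coordinates of its model. `L` is the projection `p`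
applied to covectors read in the chart of `B` at `π m₀`; every clause is the corresponding clause of
`FlatChart` carried back along the submersion chart. -/
theorem exists_actionChart (h : IsASCIR Λ π σ η)
    (hΛ : ∀ (b : B) (α β : Covec k b), β (Λ b α) = - α (Λ b β)) (m₀ : M) :
    Nonempty (ActionChart Λ π σ m₀) := by
  obtain ⟨c, S, Z, ht, hS, hZ, hZc⟩ := exists_submersionChart (h.submersion m₀)
  have hmem : c.coord m₀ ∈ S ×ˢ Z := ht ▸ c.coord.map_source c.mem_source
  obtain ⟨f, hf⟩ := (c.flatModel h hΛ ht hS hZ hZc).exists_chart hmem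
  set ψ := extChartAt (𝓡 k) (π m₀)
  let C : OpenPartialHomeomorph M (Model k d) := c.coord.trans f.coord
  have hCs : ∀ m ∈ C.source, m ∈ c.coord.source ∧ c.coord m ∈ f.coord.source := by
    intro m hm
    have hm' : m ∈ (c.coord.trans f.coord).source := hm
    rwa [OpenPartialHomeomorph.trans_source] at hm'
  have hCt : ∀ x ∈ C.target, x ∈ f.coord.target ∧ f.coord.symm x ∈ c.coord.target := by
    intro x hx
    have hx' : x ∈ (c.coord.trans f.coord).target := hx
    rwa [OpenPartialHomeomorph.trans_target] at hx'
  have hft : ∀ x ∈ f.coord.source, x ∈ c.coord.target := fun x hx => ht ▸ f.source_subset hx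
  have hfst : ∀ m ∈ C.source, (c.coord m).1 = ψ (π m) := fun m hm => c.fst m (hCs m hm).1
  have hψ : ∀ m ∈ C.source, π m ∈ ψ.source := fun m hm => c.base_mem m (hCs m hm).1
  have hdC : ∀ m ∈ C.source, ∀ v : TangentSpace (𝓡 d) m,
      mfderiv (𝓡 d) 𝓘(ℝ, Model k d) C m v
        = fderiv ℝ f.coord (c.coord m) (mfderiv (𝓡 d) 𝓘(ℝ, Model k d) c.coord m v) := by
    intro m hm v
    have h1 := mfderiv_comp m
      ((f.smooth _ (hCs m hm).2).contMDiffAt.mdifferentiableAt (by simp))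
      ((c.smooth m (hCs m hm).1).mdifferentiableAt (by simp))
    rw [mfderiv_eq_fderiv] at h1
    exact congrArg (fun A : EuclideanSpace ℝ (Fin d) →L[ℝ] Model k d => A v) h1
  have hNiff : ∀ m ∈ C.source, ∀ a : Covec k (π m),
      covecCoord (π m₀) (π m) a ∈ chartConormal Λ (π m₀) (c.coord m).1 ↔ a ∈ conormal Λ (π m) := by
    intro m hm a
    rw [hfst m hm, covecCoord_mem_iff hΛ (hψ m hm)]
  have hevψ : ∀ m ∈ C.source, ∀ᶠ b in nhds (π m), b ∈ ψ.source := fun m hm =>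
    (isOpen_extChartAt_source (I := 𝓡 k) (π m₀)).mem_nhds (hψ m hm)
  refine ⟨{
    coord := C
    mem_source := ?_
    smooth := ?_
    smooth_symm := ?_
    base_mem := hψ
    fst := ?_
    L := fun b => f.p.comp (covecCoord (π m₀) b)
    flow_iff := ?_
    injective := ?_
    exists_form := ?_
    smooth_L := ?_
    pullback := ?_ }⟩
  · change m₀ ∈ (c.coord.trans f.coord).source
    rw [OpenPartialHomeomorph.trans_source]
    exact ⟨c.mem_source, hf⟩
  · intro m hm
    exact (f.smooth _ (hCs m hm).2).contMDiffAt.comp m (c.smooth m (hCs m hm).1)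
  · intro x hx
    exact (c.smooth_symm _ (hCt x hx).2).comp x (f.smooth_symm x (hCt x hx).1).contMDiffAt
  · intro m hm
    exact (f.fst _ (hCs m hm).2).trans (hfst m hm)
  · intro m hm a ha v
    refine Iff.trans ?_ ((f.flow_iff _ (hCs m hm).2 _ ((hNiff m hm a).2 ha) _).trans
      (by rw [hdC m hm]; rfl))
    obtain ⟨x, hx, rfl⟩ : ∃ x ∈ c.coord.target, c.coord.symm x = m :=
      ⟨_, c.coord.map_source (hCs m hm).1, c.coord.left_inv (hCs m hm).1⟩
    obtain ⟨u, rfl⟩ := c.exists_mfderiv_symm_eq hx v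
    rw [c.mfderiv_coord_symm hx, c.coord.right_inv hx]
    constructor
    · intro H w
      refine (c.flatForm_apply x u w).trans ((H _).trans ?_)
      rw [← covecCoord_apply_proj c (hCs _ hm).1, c.mfderiv_coord_symm hx]
    · intro H w
      obtain ⟨w, rfl⟩ := c.exists_mfderiv_symm_eq hx w
      refine (c.flatForm_apply x u w).symm.trans ((H w).trans ?_)
      rw [← covecCoord_apply_proj c (hCs _ hm).1, c.mfderiv_coord_symm hx]
  · intro m hm a ha hLa
    have h1 := f.injective _ (hCs m hm).2 _ ((hNiff m hm a).2 ha) hLa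
    rw [← covecCoord_comp (hψ m hm) a, h1]
    rfl
  · intro m hm g hg
    -- The section `split` of `p` lifts a prescribed translation `g` to conormal covectors, smoothly
    -- in the base point.
    refine ⟨fun b => (f.split (ψ b) (g b)).comp (mfderiv (𝓡 k) (𝓡 k) ψ b), ?_⟩
    have hsrc : ∀ᶠ b in nhds (π m), (ψ b, (c.coord m).2) ∈ f.coord.source := by
      have h1 : ContinuousAt (fun b => (ψ b, (c.coord m).2)) (π m) :=
        (continuousAt_extChartAt' (hψ m hm)).prodMk continuousAt_const
      refine h1.eventually (f.coord.open_source.mem_nhds ?_)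
      change (ψ (π m), (c.coord m).2) ∈ f.coord.source
      rw [← hfst m hm]
      exact (hCs m hm).2
    filter_upwards [hsrc, hevψ m hm, hg.eventually_nhds] with b hb hbψ hgb
    refine ⟨?_, ?_, ?_⟩
    · have h1 : ∀ᶠ b' in nhds b, b' ∈ ψ.source :=
        (isOpen_extChartAt_source (I := 𝓡 k) (π m₀)).mem_nhds hbψ
      have hgc : ContDiffAt ℝ ∞ (fun y => g (ψ.symm y)) (ψ b) := by
        have h2 := hgb.self_of_nhds
        rw [← ψ.left_inv hbψ] at h2
        exact (h2.comp (ψ b) (contMDiffAt_extChartAt_symm (ψ.map_source hbψ))).contDiffAt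
      have h3 : ContDiffAt ℝ ∞ (fun y => f.split y (g (ψ.symm y))) (ψ b) :=
        (f.split_smooth _ hb).clm_apply hgc
      refine smoothAt_congr ?_ (smoothAt_oneForm_of_map (f := ψ)
        (h1.mono fun b' hb' => contMDiffAt_extChartAt_of_mem hb') h3)
      filter_upwards [h1] with b' hb'
      rw [ψ.left_inv hb']
    · exact (mem_chartConormal hΛ hbψ).1 (f.split_mem _ hb _)
    · change f.p (covecCoord (π m₀) b _) = _
      rw [covecCoord_apply_comp hbψ]
      exact f.p_split _ hb _
  · intro m hm α hα
    have h1 : ContDiffAt ℝ ∞ (covPull ψ.symm α) (ψ (π m)) :=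
      contDiffAt_covPull (eventually_contMDiffAt_extChartAt_symm (ψ.map_source (hψ m hm)))
        (by rwa [ψ.left_inv (hψ m hm)])
    have h2 : ContDiffAt ℝ ∞ (fun y => f.p (covPull ψ.symm α y)) (ψ (π m)) :=
      ContDiffAt.comp (g := f.p) _ f.p.contDiff.contDiffAt h1
    have h3 := h2.contMDiffAt.comp (π m) (contMDiffAt_extChartAt_of_mem (hψ m hm))
    refine h3.congr_of_eventuallyEq ?_
    filter_upwards [hevψ m hm] with b hb
    exact congrArg f.p (covPull_extChartAt_symm hb α).symm
  · intro G α m hm hGm hG hα hπ hαN hGα v w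
    obtain ⟨x, hx, rfl⟩ : ∃ x ∈ c.coord.target, c.coord.symm x = m :=
      ⟨_, c.coord.map_source (hCs m hm).1, c.coord.left_inv (hCs m hm).1⟩
    obtain ⟨v, rfl⟩ := c.exists_mfderiv_symm_eq hx v
    obtain ⟨w, rfl⟩ := c.exists_mfderiv_symm_eq hx w
    have hGx := (hCs _ hGm).1
    obtain ⟨hGt, hLHS⟩ := flatForm_conj (σ := σ) c hx hGx hG v w
    have hxf : x ∈ f.coord.source := by
      have := (hCs _ hm).2
      rwa [c.coord.right_inv hx] at this
    have hx1 : ψ (π (c.coord.symm x)) = x.1 := c.fst_symm hx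
    obtain ⟨hαt, hdα⟩ := fderiv_covPull_extChartAt_symm (hψ _ hm) hα v.1 w.1
    have hcs : Filter.Tendsto c.coord.symm (nhds x) (nhds (c.coord.symm x)) :=
      c.coord.continuousAt_symm hx
    have hev : ∀ᶠ x' in nhds x, x' ∈ c.coord.target := c.coord.open_target.mem_nhds hx
    have hevC : ∀ᶠ x' in nhds x, c.coord.symm x' ∈ C.source :=
      hcs.eventually (C.open_source.mem_nhds hm)
    have hevG : ∀ᶠ x' in nhds x, G (c.coord.symm x') ∈ C.source :=
      hcs.eventually (hG.continuousAt.eventually (C.open_source.mem_nhds hGm))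
    have hval : ∀ x' ∈ c.coord.target, c.coord.symm x' ∈ C.source →
        covPull ψ.symm α x'.1
          = covecCoord (π m₀) (π (c.coord.symm x')) (α (π (c.coord.symm x'))) := by
      intro x' hx' hC
      rw [← covPull_extChartAt_symm (hψ _ hC), c.fst_symm hx']
    -- The flat pullback formula is applied to the map and the form read in coordinates; the three
    -- open goals say that it preserves fibres, is conormal and translates by `p α` near `x`.
    have key := f.pullback (fun x => c.coord (G (c.coord.symm x))) (covPull ψ.symm α) x hxf
      (hCs _ hGm).2 hGt (hx1 ▸ hαt) ?_ ?_ ?_ v w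
    · rw [hLHS, c.flatForm_apply, ← hx1, hdα] at key
      refine key.trans ?_
      have hp : ∀ u : Model k d, mfderiv (𝓡 k) (𝓡 k) ψ.symm (ψ (π (c.coord.symm x))) u.1
          = mfderiv (𝓡 d) (𝓡 k) π (c.coord.symm x)
            (mfderiv 𝓘(ℝ, Model k d) (𝓡 d) c.coord.symm x u) := by
        intro u
        rw [← c.mfderiv_proj (c.coord.map_target hx), c.mfderiv_coord_symm hx]
      rw [← hp v, ← hp w]
    · filter_upwards [hcs.eventually hπ, hev, hevG] with x' h1 h2 h3
      rw [hfst _ h3, h1, c.fst_symm h2]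
    · filter_upwards [hcs.eventually hαN, hev, hevC] with x' h1 h2 h3
      rw [hval x' h2 h3, ← c.fst_symm h2, covecCoord_mem_iff hΛ (hψ _ h3)]
      exact h1
    · filter_upwards [hcs.eventually hGα, hev, hevC] with x' h1 h2 h3
      rw [hval x' h2 h3]
      refine h1.trans ?_
      change (f.coord (c.coord (c.coord.symm x'))).2 + _ = _
      rw [c.coord.right_inv h2]
      rfl

end ActionCharts


/-! ### Extending a local action of a vector space. -/

section LocalActions

variable {V F : Type*} [NormedAddCommGroup V] [NormedSpace ℝ V]

/-- Let `v` act by the `2 ^ j`-th iterate of `T (v / 2 ^ j)`. Because `T (v / 2)` twice is `T v` for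
small `v`, the result does not depend on `j` once `v / 2 ^ j` has norm below `δ`. -/
theorem exists_action_of_local {δ : ℝ} (hδ : 0 < δ) (T : V → F → F)
    (hT : ∀ v w, ‖v‖ < δ → ‖w‖ < δ → ‖v + w‖ < δ → ∀ x, T v (T w x) = T (v + w) x) :
    ∃ A : V → F → F, (∀ v, ‖v‖ < δ → A v = T v) ∧ ∀ v w x, A (v + w) x = A v (A w x) := by
  let r : ℕ → V → V := fun j v => ((2 : ℝ) ^ j)⁻¹ • v
  let A' : ℕ → V → F → F := fun j v => (T (r j v))^[2 ^ j]
  have hr : ∀ j v, ‖r j v‖ = ‖v‖ / 2 ^ j := by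
    intro j v
    simp only [r, norm_smul, norm_inv, norm_pow, Real.norm_ofNat]
    rw [div_eq_inv_mul]
  have hsucc : ∀ j v, ‖r j v‖ < δ → A' (j + 1) v = A' j v := by
    intro j v hv
    have h1 : r (j + 1) v + r (j + 1) v = r j v := by
      simp only [r, ← two_smul ℝ, smul_smul]
      congr 1
      rw [pow_succ]
      field_simp
    have h2 : ‖r (j + 1) v‖ < δ := by
      rw [hr] at hv ⊢
      refine lt_of_le_of_lt ?_ hv
      gcongr
      · norm_num
      · omega
    change (T (r (j + 1) v))^[2 ^ (j + 1)] = (T (r j v))^[2 ^ j]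
    rw [pow_succ, mul_comm, Function.iterate_mul]
    congr 1
    funext x
    exact (hT _ _ h2 h2 (h1.symm ▸ hv) x).trans (by rw [h1])
  have hmono : ∀ i j v, i ≤ j → ‖r i v‖ < δ → ‖r j v‖ < δ := by
    intro i j v hij hv
    rw [hr] at hv ⊢
    refine lt_of_le_of_lt ?_ hv
    gcongr
    norm_num
  have hstab : ∀ i j v, i ≤ j → ‖r i v‖ < δ → A' j v = A' i v := by
    intro i j v hij hv
    induction j, hij using Nat.le_induction with
    | base => rfl
    | succ j hij ih => rw [hsucc j v (hmono i j v hij hv), ih]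
  have hex : ∀ v, ∃ j, ‖r j v‖ < δ := by
    intro v
    obtain ⟨j, hj⟩ := pow_unbounded_of_one_lt (‖v‖ / δ) (one_lt_two (α := ℝ))
    refine ⟨j, ?_⟩
    rw [hr, div_lt_iff₀ (by positivity), mul_comm]
    exact (div_lt_iff₀ hδ).1 hj
  choose J hJ using hex
  refine ⟨fun v => A' (J v) v, fun v hv => ?_, fun v w x => ?_⟩
  · have h0 : r 0 v = v := by simp [r]
    change A' (J v) v = _
    rw [hstab 0 (J v) v (Nat.zero_le _) (by rwa [h0])]
    change (T (r 0 v))^[2 ^ 0] = _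
    rw [h0, pow_zero, Function.iterate_one]
  -- At a common level `n` all three vectors are small. The small translations commute, so the
  -- iterate of their composite is the composite of their iterates.
  · let n := max (J v) (max (J w) (J (v + w)))
    have hv := hmono _ n v (le_max_left _ _) (hJ v)
    have hw := hmono _ n w ((le_max_left _ _).trans (le_max_right _ _)) (hJ w)
    have hvw := hmono _ n (v + w) ((le_max_right _ _).trans (le_max_right _ _)) (hJ (v + w))
    change A' (J (v + w)) (v + w) x = A' (J v) v (A' (J w) w x)
    rw [← hstab _ n v (le_max_left _ _) (hJ v),
      ← hstab _ n w ((le_max_left _ _).trans (le_max_right _ _)) (hJ w),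
      ← hstab _ n (v + w) ((le_max_right _ _).trans (le_max_right _ _)) (hJ (v + w))]
    have hadd : r n (v + w) = r n v + r n w := smul_add _ _ _
    rw [hadd] at hvw
    have h1 : T (r n (v + w)) = T (r n v) ∘ T (r n w) := by
      funext y
      rw [hadd]
      exact (hT _ _ hv hw hvw y).symm
    have hcomm : Function.Commute (T (r n v)) (T (r n w)) := by
      intro y
      rw [hT _ _ hv hw hvw, hT _ _ hw hv (by rwa [add_comm]), add_comm]
    change (T (r n (v + w)))^[2 ^ n] x = _
    rw [h1, hcomm.comp_iterate]
    rfl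

end LocalActions

/-! ### Integral curves of the vertical fields and their uniqueness. -/

section FlowLines

open Set

variable {k d : ℕ} {B M : Type u}
  [TopologicalSpace B] [ChartedSpace (EuclideanSpace ℝ (Fin k)) B]
  [TopologicalSpace M] [ChartedSpace (EuclideanSpace ℝ (Fin d)) M]

/-- `γ` is at times `t ∈ S` an integral curve in the fiber over `b` of the field `X` with
`ι_X σ = π^* α`. -/
def IsFlowLine (π : C^∞⟮𝓡 d, M; 𝓡 k, B⟯) (σ : DiffForm d M 2) (α : ∀ b : B, Covec k b) (b : B)
    (S : Set ℝ) (γ : ℝ → M) : Prop :=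
  ∀ t ∈ S, π (γ t) = b ∧ ∃ v : TangentSpace (𝓡 d) (γ t),
    HasMFDerivAt 𝓘(ℝ, ℝ) (𝓡 d) γ t ((1 : ℝ →L[ℝ] ℝ).smulRight v) ∧
      ∀ w : TangentSpace (𝓡 d) (γ t),
        σ (γ t) ![v, w] = α (π (γ t)) (mfderiv (𝓡 d) (𝓡 k) π (γ t) w)

variable {Λ : BivectorField k B} {π : C^∞⟮𝓡 d, M; 𝓡 k, B⟯} {σ : DiffForm d M 2} {η : DiffForm k B 3}
  {α : ∀ b : B, Covec k b} {b : B} {S : Set ℝ} {γ γ' : ℝ → M} {m₀ : M}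

theorem flowsTo_iff {m m' : M} :
    FlowsTo π σ α m m' ↔ ∃ γ : ℝ → M, γ 0 = m ∧ γ 1 = m' ∧ IsFlowLine π σ α (π m) univ γ := by
  simp only [FlowsTo, IsFlowLine, mem_univ, true_implies]

theorem IsFlowLine.mono {S' : Set ℝ} (h : IsFlowLine π σ α b S γ) (hS : S' ⊆ S) :
    IsFlowLine π σ α b S' γ := fun t ht => h t (hS ht)

theorem IsFlowLine.congr_field {α' : ∀ b : B, Covec k b} (h : IsFlowLine π σ α b S γ)
    (hα : α b = α' b) : IsFlowLine π σ α' b S γ := by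
  intro t ht
  obtain ⟨hb, v, hv, hw⟩ := h t ht
  have h1 : ∀ b', b' = b → α b' = α' b' := by rintro _ rfl; exact hα
  exact ⟨hb, v, hv, fun w => (hw w).trans (by rw [h1 _ hb])⟩

theorem IsFlowLine.congr_curve {t : ℝ} (h : IsFlowLine π σ α b {t} γ) (hγ : γ' =ᶠ[nhds t] γ) :
    IsFlowLine π σ α b {t} γ' := by
  intro t' ht'
  obtain rfl : t' = t := ht'
  obtain ⟨hb, v, hv, hw⟩ := h _ rfl
  have h1 : ∀ m, m = γ t' → ∃ v' : TangentSpace (𝓡 d) m,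
      (v' : EuclideanSpace ℝ (Fin d)) = v ∧
        ∀ w, σ m ![v', w] = α (π m) (mfderiv (𝓡 d) (𝓡 k) π m w) := by
    rintro _ rfl; exact ⟨v, rfl, hw⟩
  obtain ⟨v', hv', hw'⟩ := h1 _ hγ.self_of_nhds
  refine ⟨(congrArg π hγ.self_of_nhds).trans hb, v', ?_, hw'⟩
  have h2 := hv.congr_of_eventuallyEq hγ
  subst hv'
  exact h2

theorem IsFlowLine.shift (h : IsFlowLine π σ α b S γ) (t : ℝ) :
    IsFlowLine π σ α b {s | t + s ∈ S} (fun s => γ (t + s)) := by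
  intro s hs
  obtain ⟨hb, v, hv, hw⟩ := h _ hs
  refine ⟨hb, v, ?_, hw⟩
  have h1 : HasMFDerivAt 𝓘(ℝ, ℝ) 𝓘(ℝ, ℝ) (fun s : ℝ => t + s) s (ContinuousLinearMap.id ℝ ℝ) :=
    ((hasFDerivAt_id s).const_add t).hasMFDerivAt
  exact HasMFDerivAt.comp s hv h1

theorem IsFlowLine.continuousAt {t : ℝ} (h : IsFlowLine π σ α b S γ) (ht : t ∈ S) :
    ContinuousAt γ t := by
  obtain ⟨-, v, hv, -⟩ := h t ht
  exact hv.continuousAt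

namespace ActionChart

variable (c : ActionChart Λ π σ m₀)

theorem hasDerivAt_flowLine (hα : α b ∈ conormal Λ b) (h : IsFlowLine π σ α b S γ) {t : ℝ}
    (ht : t ∈ S) (hγ : γ t ∈ c.coord.source) :
    HasDerivAt (fun s => c.coord (γ s)) ((0, c.L b (α b)) : Model k d) t := by
  obtain ⟨rfl, v, hv, hw⟩ := h t ht
  have h1 := (c.flow_iff _ hγ _ hα v).1 hw
  have h2 := (((c.smooth _ hγ).mdifferentiableAt (by simp)).hasMFDerivAt.comp t hv).hasFDerivAt
  have h3 : ((mfderiv (𝓡 d) 𝓘(ℝ, Model k d) c.coord (γ t)).comp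
      ((1 : ℝ →L[ℝ] ℝ).smulRight v) : ℝ →L[ℝ] Model k d)
      = (1 : ℝ →L[ℝ] ℝ).smulRight ((0, c.L _ (α (π (γ t)))) : Model k d) := by
    refine ContinuousLinearMap.ext fun r => ?_
    change mfderiv (𝓡 d) 𝓘(ℝ, Model k d) c.coord (γ t) (r • v) = _
    rw [map_smul, h1]
    rfl
  have h4 : HasFDerivAt (fun s => c.coord (γ s))
      ((1 : ℝ →L[ℝ] ℝ).smulRight ((0, c.L _ (α (π (γ t)))) : Model k d)) t := h2.congr_fderiv h3
  exact h4.hasDerivAt.congr_deriv (one_smul ℝ _)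

theorem proj_symm {x : Model k d} (hx : x ∈ c.coord.target)
    (hb : b ∈ (extChartAt (𝓡 k) (π m₀)).source) (hxb : x.1 = extChartAt (𝓡 k) (π m₀) b) :
    π (c.coord.symm x) = b := by
  refine (extChartAt (𝓡 k) (π m₀)).injOn (c.base_mem _ (c.coord.map_target hx)) hb ?_
  rw [← hxb]
  exact c.toSubmersionChart.fst_symm hx

/-- In an action chart the flow lines over `b` are straight lines in the direction `(0, L a)`, valid
for as long as they stay in the target. -/
theorem isFlowLine_symm {x : Model k d} {u : EuclideanSpace ℝ (Fin (d - k))}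
    (hb : b ∈ (extChartAt (𝓡 k) (π m₀)).source) (hxb : x.1 = extChartAt (𝓡 k) (π m₀) b)
    (hα : α b ∈ conormal Λ b) (hu : c.L b (α b) = u) :
    IsFlowLine π σ α b {t | x + t • ((0, u) : Model k d) ∈ c.coord.target}
      (fun t => c.coord.symm (x + t • ((0, u) : Model k d))) := by
  intro t ht
  set y := x + t • ((0, u) : Model k d) with hy
  have hyt : y ∈ c.coord.target := ht
  have hyb : y.1 = extChartAt (𝓡 k) (π m₀) b := by rw [← hxb, hy]; simp
  have hπ : π (c.coord.symm y) = b := c.proj_symm hyt hb hyb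
  refine ⟨hπ, mfderiv 𝓘(ℝ, Model k d) (𝓡 d) c.coord.symm y ((0, u) : Model k d), ?_, ?_⟩
  · have h1 : HasFDerivAt (fun t : ℝ => x + t • ((0, u) : Model k d))
        ((1 : ℝ →L[ℝ] ℝ).smulRight ((0, u) : Model k d)) t :=
      (((1 : ℝ →L[ℝ] ℝ).smulRight ((0, u) : Model k d)).hasFDerivAt).const_add x
    have h2 := ((c.smooth_symm y hyt).mdifferentiableAt (by simp)).hasMFDerivAt.comp t
      h1.hasMFDerivAt
    refine h2.congr_mfderiv ?_
    refine ContinuousLinearMap.ext fun r : ℝ => ?_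
    exact map_smul (mfderiv 𝓘(ℝ, Model k d) (𝓡 d) c.coord.symm y) r ((0, u) : Model k d)
  · refine (c.flow_iff _ (c.coord.map_target hyt) _ ?_ _).2 ?_
    · have h1 : ∀ b', b' = b → α b' ∈ conormal Λ b' := by rintro _ rfl; exact hα
      exact h1 _ hπ
    · refine (c.toSubmersionChart.mfderiv_coord_symm hyt _).trans ?_
      have h1 : ∀ b', b' = b → c.L b' (α b') = u := by rintro _ rfl; exact hu
      rw [h1 _ hπ]

end ActionChart

variable [IsManifold (𝓡 k) ∞ B] [IsManifold (𝓡 d) ∞ M] [T2Space M]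

/-- In an action chart both curves have the same constant velocity, so coincidence at a time spreads
to nearby times. Non-coincidence is open because `M` is Hausdorff, and `I` is connected. -/
theorem IsFlowLine.eqOn (hR : IsASCIR Λ π σ η)
    (hΛ : ∀ (b : B) (α β : Covec k b), β (Λ b α) = - α (Λ b β)) (hα : α b ∈ conormal Λ b)
    (h : IsFlowLine π σ α b S γ) (h' : IsFlowLine π σ α b S γ') (hS : IsOpen S) {I : Set ℝ}
    (hI : _root_.IsPreconnected I) (hIS : I ⊆ S) {t₀ : ℝ} (ht₀ : t₀ ∈ I) (h0 : γ t₀ = γ' t₀) :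
    EqOn γ γ' I := by
  have hU : IsOpen {t | t ∈ S ∧ γ t = γ' t} := by
    rw [isOpen_iff_mem_nhds]
    rintro t ⟨ht, he⟩
    obtain ⟨c⟩ := exists_actionChart hR hΛ (γ t)
    have h1 : ∀ᶠ s in nhds t, γ s ∈ c.coord.source :=
      (h.continuousAt ht).eventually (c.coord.open_source.mem_nhds c.mem_source)
    have h2 : ∀ᶠ s in nhds t, γ' s ∈ c.coord.source :=
      (h'.continuousAt ht).eventually (c.coord.open_source.mem_nhds (he ▸ c.mem_source))
    obtain ⟨ε, hε, hball⟩ := Metric.eventually_nhds_iff_ball.1 ((h1.and h2).and (hS.mem_nhds ht))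
    have hd : ∀ s ∈ Metric.ball t ε,
        HasDerivAt (fun s => c.coord (γ s) - c.coord (γ' s)) 0 s := by
      intro s hs
      have h3 := (c.hasDerivAt_flowLine hα h (hball s hs).2 (hball s hs).1.1).sub
        (c.hasDerivAt_flowLine hα h' (hball s hs).2 (hball s hs).1.2)
      rwa [sub_self] at h3
    filter_upwards [Metric.ball_mem_nhds t hε] with s hs
    refine ⟨(hball s hs).2, c.coord.injOn (hball s hs).1.1 (hball s hs).1.2 ?_⟩
    rw [← sub_eq_zero]
    have h3 := Metric.isOpen_ball.is_const_of_deriv_eq_zero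
      (convex_ball t ε).isPreconnected (fun s hs => (hd s hs).differentiableAt.differentiableWithinAt)
      (fun s hs => (hd s hs).deriv) hs (Metric.mem_ball_self hε)
    refine h3.trans ?_
    exact sub_eq_zero.2 (congrArg c.coord he)
  have hV : IsOpen {t | t ∈ S ∧ γ t ≠ γ' t} := by
    rw [isOpen_iff_mem_nhds]
    rintro t ⟨ht, he⟩
    exact (hS.eventually_mem ht).and
      (((h.continuousAt ht).ne_iff_eventually_ne (h'.continuousAt ht)).1 he)
  have hsub := hI.subset_left_of_subset_union hU hV
    (disjoint_left.2 fun t ht ht' => ht'.2 ht.2)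
    (fun t ht => (em (γ t = γ' t)).imp (fun e => ⟨hIS ht, e⟩) fun e => ⟨hIS ht, e⟩)
    ⟨t₀, ht₀, hIS ht₀, h0⟩
  exact fun t ht => (hsub ht).2

end FlowLines


/-! ### The action of the conormal space on a compact connected fibre. -/

section FiberAction

open Set

variable {k d : ℕ} {B M : Type u}
  [TopologicalSpace B] [ChartedSpace (EuclideanSpace ℝ (Fin k)) B]
  [TopologicalSpace M] [ChartedSpace (EuclideanSpace ℝ (Fin d)) M]
  {Λ : BivectorField k B} {π : C^∞⟮𝓡 d, M; 𝓡 k, B⟯} {σ : DiffForm d M 2} {η : DiffForm k B 3}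
  {α β : ∀ b : B, Covec k b} {b : B} {m₀ : M}

theorem smul_mem_conormal {a : Covec k b} (ha : a ∈ conormal Λ b) (r : ℝ) :
    r • a ∈ conormal Λ b := by
  intro v hv
  change r * a v = 0
  rw [ha v hv, mul_zero]

theorem flowsTo_congr (h : α (π m₀) = β (π m₀)) {m' : M} (hf : FlowsTo π σ α m₀ m') :
    FlowsTo π σ β m₀ m' := by
  obtain ⟨γ, h0, h1, hγ⟩ := flowsTo_iff.1 hf
  exact flowsTo_iff.2 ⟨γ, h0, h1, hγ.congr_field h⟩

theorem FlowsTo.proj {m m' : M} (h : FlowsTo π σ α m m') : π m' = π m := by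
  obtain ⟨γ, -, rfl, hγ⟩ := h
  exact (hγ 1).1

variable [IsManifold (𝓡 k) ∞ B] [IsManifold (𝓡 d) ∞ M]

section Local

variable {V : Type*} [NormedAddCommGroup V] [NormedSpace ℝ V] [FiniteDimensional ℝ V]
  (j : V →ₗ[ℝ] ∀ b : B, Covec k b)

/-- The coordinates of the translation by `j v` on the fiber over `b`. -/
noncomputable def ActionChart.shift (c : ActionChart Λ π σ m₀) (b : B) : V →ₗ[ℝ] Model k d :=
  (LinearMap.inr ℝ _ _).comp ((c.L b).toLinearMap.comp ((LinearMap.proj b).comp j))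

/-- Compactness of the fibre: near each point one chart absorbs all small translations, and finitely
many such neighbourhoods give a common `δ`. -/
theorem exists_uniform_chart (hR : IsASCIR Λ π σ η)
    (hΛ : ∀ (b : B) (α β : Covec k b), β (Λ b α) = - α (Λ b β)) (b : B) :
    ∃ δ > 0, ∀ m, π m = b → ∃ (m₀ : M) (c : ActionChart Λ π σ m₀), m ∈ c.coord.source ∧
      ∀ v : V, ‖v‖ < δ → c.coord m + c.shift j b v ∈ c.coord.target := by
  refine (hR.compact_fiber b).induction_on
    (p := fun s => ∃ δ > 0, ∀ m ∈ s, ∃ (m₀ : M) (c : ActionChart Λ π σ m₀), m ∈ c.coord.source ∧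
      ∀ v : V, ‖v‖ < δ → c.coord m + c.shift j b v ∈ c.coord.target) ?_ ?_ ?_ ?_
  · exact ⟨1, one_pos, fun m hm => hm.elim⟩
  · rintro s t hst ⟨δ, hδ, h⟩
    exact ⟨δ, hδ, fun m hm => h m (hst hm)⟩
  · rintro s t ⟨δ, hδ, h⟩ ⟨δ', hδ', h'⟩
    refine ⟨min δ δ', lt_min hδ hδ', ?_⟩
    rintro m (hm | hm)
    · obtain ⟨m₀, c, hc, hv⟩ := h m hm
      exact ⟨m₀, c, hc, fun v h => hv v (h.trans_le (min_le_left _ _))⟩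
    · obtain ⟨m₀, c, hc, hv⟩ := h' m hm
      exact ⟨m₀, c, hc, fun v h => hv v (h.trans_le (min_le_right _ _))⟩
  · intro m₀ hm₀
    obtain ⟨c⟩ := exists_actionChart hR hΛ m₀
    have hcont : ContinuousAt (fun p : M × V => c.coord p.1 + c.shift j b p.2) (m₀, 0) := by
      refine ContinuousAt.add ?_ ?_
      · exact ContinuousAt.comp (g := c.coord) (c.coord.continuousAt c.mem_source) continuousAt_fst
      · exact ((c.shift j b).continuous_of_finiteDimensional).continuousAt.comp continuousAt_snd
    have hev : ∀ᶠ p : M × V in nhds (m₀, 0), p.1 ∈ c.coord.source ∧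
        c.coord p.1 + c.shift j b p.2 ∈ c.coord.target := by
      refine (continuousAt_fst.eventually (c.coord.open_source.mem_nhds c.mem_source)).and
        (hcont.eventually (c.coord.open_target.mem_nhds ?_))
      change c.coord m₀ + c.shift j b 0 ∈ c.coord.target
      rw [map_zero, add_zero]
      exact c.coord.map_source c.mem_source
    rw [nhds_prod_eq, Filter.eventually_prod_iff] at hev
    obtain ⟨p, hp, q, hq, hpq⟩ := hev
    obtain ⟨δ, hδ, hball⟩ := Metric.eventually_nhds_iff_ball.1 hq
    refine ⟨{m | p m}, nhdsWithin_le_nhds hp, δ, hδ, fun m hm => ⟨m₀, c, ?_, fun v hv => ?_⟩⟩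
    · exact (hpq hm (hball 0 (Metric.mem_ball_self hδ))).1
    · exact (hpq hm (hball v (mem_ball_zero_iff.2 hv))).2

variable [T2Space M]

/-- Small vectors act by translation in a chart chosen at each point. The charts differ from point
to point, but uniqueness of flow lines makes the translations a local action, and
`exists_action_of_local` extends it. This replaces completeness of the flow and commutation of the
vector fields. -/
theorem exists_fiber_action (hR : IsASCIR Λ π σ η)
    (hΛ : ∀ (b : B) (α β : Covec k b), β (Λ b α) = - α (Λ b β)) (b : B)
    (hj : ∀ v, j v b ∈ conormal Λ b) :
    ∃ A : V → {m // π m = b} → {m // π m = b}, (∀ v w x, A (v + w) x = A v (A w x)) ∧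
      ∀ v x, (A 0 x = x) ∧ IsFlowLine π σ (j v) b univ (fun t => (A (t • v) x : M)) := by
  obtain ⟨δ, hδ, hδc⟩ := exists_uniform_chart j hR hΛ b
  choose m₀ c hcs hct using hδc
  have hb : ∀ m (hm : π m = b), b ∈ (extChartAt (𝓡 k) (π (m₀ m hm))).source := fun m hm => by
    have := (c m hm).base_mem m (hcs m hm)
    rwa [hm] at this
  have hfst : ∀ m (hm : π m = b), ((c m hm).coord m).1 = extChartAt (𝓡 k) (π (m₀ m hm)) b :=
    fun m hm => by
      have := (c m hm).fst m (hcs m hm)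
      rwa [hm] at this
  classical
  -- The value `x` for long vectors is a default; the extension uses `T` only on vectors shorter
  -- than `δ`.
  let T : V → {m // π m = b} → {m // π m = b} := fun v x =>
    if hv : ‖v‖ < δ then ⟨(c x x.2).coord.symm ((c x x.2).coord x + (c x x.2).shift j b v),
      (c x x.2).proj_symm (hct x x.2 v hv) (hb x x.2) (by
        refine Eq.trans ?_ (hfst x x.2)
        change _ + 0 = _
        rw [add_zero])⟩ else x
  have hTv : ∀ v, ‖v‖ < δ → ∀ x, (T v x : M)
      = (c x x.2).coord.symm ((c x x.2).coord x + (c x x.2).shift j b v) := by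
    intro v hv x
    simp only [T, dif_pos hv]
  have hT0 : ∀ x, T 0 x = x := by
    intro x
    apply Subtype.ext
    rw [hTv 0 (by rwa [norm_zero]), map_zero, add_zero]
    exact (c x x.2).coord.left_inv (hcs x x.2)
  have hline : ∀ v w x, IsFlowLine π σ (j w) b {t | ‖v + t • w‖ < δ}
      (fun t => (T (v + t • w) x : M)) := by
    intro v w x t ht
    have h1 := (c x x.2).isFlowLine_symm (x := (c x x.2).coord x + (c x x.2).shift j b v)
      (α := j w) (hb x x.2) (by
        refine Eq.trans ?_ (hfst x x.2)
        change _ + 0 = _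
        rw [add_zero]) (hj w) rfl
    have h2 : ∀ t : ℝ, (c x x.2).coord x + (c x x.2).shift j b v
        + t • ((0, (c x x.2).L b (j w b)) : Model k d)
        = (c x x.2).coord x + (c x x.2).shift j b (v + t • w) := by
      intro t
      rw [map_add, map_smul, add_assoc]
      rfl
    simp only [h2] at h1
    have hopen : IsOpen {t : ℝ | ‖v + t • w‖ < δ} :=
      isOpen_lt (by fun_prop) continuous_const
    refine (h1.mono (S' := {t}) ?_).congr_curve (γ' := fun t => (T (v + t • w) x : M)) ?_ t rfl
    · rintro _ rfl
      exact hct x x.2 _ ht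
    · filter_upwards [hopen.mem_nhds ht] with s hs
      exact hTv _ hs x
  have hT : ∀ v w, ‖v‖ < δ → ‖w‖ < δ → ‖v + w‖ < δ → ∀ x, T v (T w x) = T (v + w) x := by
    intro v w hv hw hvw x
    have hopen : ∀ u : V, IsOpen {t : ℝ | ‖u + t • v‖ < δ} := fun u =>
      isOpen_lt (by fun_prop) continuous_const
    have hconv : ∀ u : V, ‖u‖ < δ → ‖u + v‖ < δ → ∀ t ∈ Icc (0 : ℝ) 1, ‖u + t • v‖ < δ := by
      intro u hu huv t ht
      have h1 := (convex_ball (0 : V) δ).add_smul_mem (mem_ball_zero_iff.2 hu)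
        (mem_ball_zero_iff.2 huv) ht
      exact mem_ball_zero_iff.1 h1
    have h1 := (hline w v x).mono (S' := {t | ‖w + t • v‖ < δ} ∩ {t | ‖0 + t • v‖ < δ})
      inter_subset_left
    have h2 := (hline 0 v (T w x)).mono
      (S' := {t | ‖w + t • v‖ < δ} ∩ {t | ‖0 + t • v‖ < δ}) inter_subset_right
    have h3 := h1.eqOn hR hΛ (hj v) h2 ((hopen w).inter (hopen 0)) (I := Icc 0 1)
      isPreconnected_Icc (fun t ht => ⟨hconv w hw (by rwa [add_comm]) t ht,
        hconv 0 (by rwa [norm_zero]) (by rwa [zero_add]) t ht⟩) (t₀ := 0) ⟨le_rfl, zero_le_one⟩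
      (by simp only [zero_smul, add_zero, hT0]) (x := 1) ⟨zero_le_one, le_rfl⟩
    simp only [one_smul, zero_add] at h3
    rw [add_comm v w]
    exact Subtype.ext h3.symm
  obtain ⟨A, hAT, hA⟩ := exists_action_of_local hδ T hT
  refine ⟨A, hA, fun v x => ⟨?_, ?_⟩⟩
  · rw [hAT 0 (by rwa [norm_zero]), hT0]
  · intro t _
    -- Near time `t` the orbit is the small translation by `(s - t) • v` of its point at time `t`,
    -- so being a flow line is checked there.
    have h1 := (hline 0 v (A (t • v) x)).shift (-t) t (by simpa using hδ)
    have hopen : IsOpen {s : ℝ | ‖0 + (-t + s) • v‖ < δ} :=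
      isOpen_lt (by fun_prop) continuous_const
    have h2 : IsFlowLine π σ (j v) b {t} (fun s => (T (0 + (-t + s) • v) (A (t • v) x) : M)) := by
      rintro _ rfl
      exact h1
    refine h2.congr_curve (γ' := fun t => (A (t • v) x : M)) ?_ t rfl
    have ht : ‖0 + (-t + t) • v‖ < δ := by simpa using hδ
    filter_upwards [hopen.mem_nhds ht] with s hs
    rw [← hAT _ hs, ← hA]
    congr 2
    rw [zero_add, ← add_smul]
    congr 1
    ring

end Local

variable [T2Space M]

theorem flowsTo_unique (hR : IsASCIR Λ π σ η)
    (hΛ : ∀ (b : B) (α β : Covec k b), β (Λ b α) = - α (Λ b β)) {m m' m'' : M}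
    (hα : α (π m) ∈ conormal Λ (π m)) (h' : FlowsTo π σ α m m') (h'' : FlowsTo π σ α m m'') :
    m' = m'' := by
  obtain ⟨γ, h0, rfl, hγ⟩ := flowsTo_iff.1 h'
  obtain ⟨γ', h0', rfl, hγ'⟩ := flowsTo_iff.1 h''
  exact hγ.eqOn hR hΛ hα hγ' isOpen_univ isPreconnected_univ (subset_univ _) (mem_univ 0)
    (h0.trans h0'.symm) (mem_univ 1)

open Classical in
/-- The time-one flow of the vertical field `X` with `ι_X σ = π^* α`. -/
noncomputable def act (π : C^∞⟮𝓡 d, M; 𝓡 k, B⟯) (σ : DiffForm d M 2) (α : ∀ b : B, Covec k b)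
    (m : M) : M :=
  if h : ∃ m', FlowsTo π σ α m m' then h.choose else m

/-- The action of the plane spanned by two parameters, `(r, s)` acting as `r α + s β`, contains the
flows of `α`, of `β` and of their sum at once. -/
theorem flowsTo_add (hR : IsASCIR Λ π σ η)
    (hΛ : ∀ (b : B) (α β : Covec k b), β (Λ b α) = - α (Λ b β)) {m : M}
    (hα : α (π m) ∈ conormal Λ (π m)) (hβ : β (π m) ∈ conormal Λ (π m)) :
    ∃ m' m'', FlowsTo π σ β m m' ∧ FlowsTo π σ α m' m'' ∧ FlowsTo π σ (α + β) m m'' := by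
  let j : ℝ × ℝ →ₗ[ℝ] ∀ b : B, Covec k b :=
    (LinearMap.toSpanSingleton ℝ _ α).coprod (LinearMap.toSpanSingleton ℝ _ β)
  have hj : ∀ v, j v = v.1 • α + v.2 • β := fun v => rfl
  obtain ⟨A, hA, hflow⟩ := exists_fiber_action j hR hΛ (π m) fun v =>
    (conormal Λ (π m)).add_mem (smul_mem_conormal hα _) (smul_mem_conormal hβ _)
  have key : ∀ (v : ℝ × ℝ) (x : {m' // π m' = π m}), FlowsTo π σ (j v) x (A v x) := by
    intro v x
    refine flowsTo_iff.2 ⟨fun t => (A (t • v) x : M), ?_, ?_, ?_⟩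
    · simp only [zero_smul, (hflow v x).1]
    · simp only [one_smul]
    · rw [x.2]
      exact (hflow v x).2
  have h1 := key (0, 1) ⟨m, rfl⟩
  have h2 := key (1, 0) (A (0, 1) ⟨m, rfl⟩)
  have h3 := key (1, 1) ⟨m, rfl⟩
  have e : ((1, 1) : ℝ × ℝ) = (1, 0) + (0, 1) := by simp
  rw [e, hA, ← e] at h3
  simp only [hj, zero_smul, one_smul, zero_add, add_zero] at h1 h2 h3
  exact ⟨_, _, h1, h2, h3⟩

theorem flowsTo_act (hR : IsASCIR Λ π σ η)
    (hΛ : ∀ (b : B) (α β : Covec k b), β (Λ b α) = - α (Λ b β)) {m : M}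
    (hα : α (π m) ∈ conormal Λ (π m)) : FlowsTo π σ α m (act π σ α m) := by
  have h : ∃ m', FlowsTo π σ α m m' := by
    obtain ⟨m', _, h, _⟩ := flowsTo_add hR hΛ hα hα
    exact ⟨m', h⟩
  rw [act, dif_pos h]
  exact h.choose_spec

theorem act_eq (hR : IsASCIR Λ π σ η)
    (hΛ : ∀ (b : B) (α β : Covec k b), β (Λ b α) = - α (Λ b β)) {m m' : M}
    (hα : α (π m) ∈ conormal Λ (π m)) (h : FlowsTo π σ α m m') : act π σ α m = m' :=
  flowsTo_unique hR hΛ hα (flowsTo_act hR hΛ hα) h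

theorem flowsTo_iff_act (hR : IsASCIR Λ π σ η)
    (hΛ : ∀ (b : B) (α β : Covec k b), β (Λ b α) = - α (Λ b β)) {m m' : M}
    (hα : α (π m) ∈ conormal Λ (π m)) : FlowsTo π σ α m m' ↔ act π σ α m = m' :=
  ⟨act_eq hR hΛ hα, fun h => h ▸ flowsTo_act hR hΛ hα⟩

theorem act_congr (hR : IsASCIR Λ π σ η)
    (hΛ : ∀ (b : B) (α β : Covec k b), β (Λ b α) = - α (Λ b β)) {m : M}
    (hα : α (π m) ∈ conormal Λ (π m)) (h : α (π m) = β (π m)) : act π σ α m = act π σ β m :=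
  act_eq hR hΛ hα (flowsTo_congr h.symm (flowsTo_act hR hΛ (h ▸ hα)))

theorem act_zero (hR : IsASCIR Λ π σ η)
    (hΛ : ∀ (b : B) (α β : Covec k b), β (Λ b α) = - α (Λ b β)) (m : M) : act π σ 0 m = m := by
  refine act_eq hR hΛ (conormal Λ (π m)).zero_mem
    ⟨fun _ => m, rfl, rfl, fun t => ⟨rfl, 0, ?_, fun w => ?_⟩⟩
  · refine (hasMFDerivAt_const m t).congr_mfderiv ?_
    refine ContinuousLinearMap.ext fun r : ℝ => ?_
    exact (smul_zero r).symm
  · refine Eq.trans ?_ (rfl : (0 : ℝ) = _)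
    exact (σ m).map_coord_zero 0 rfl

theorem act_add (hR : IsASCIR Λ π σ η)
    (hΛ : ∀ (b : B) (α β : Covec k b), β (Λ b α) = - α (Λ b β)) {m : M}
    (hα : α (π m) ∈ conormal Λ (π m)) (hβ : β (π m) ∈ conormal Λ (π m)) :
    act π σ (α + β) m = act π σ α (act π σ β m) := by
  obtain ⟨m', m'', h1, h2, h3⟩ := flowsTo_add hR hΛ hα hβ
  rw [act_eq hR hΛ hβ h1, act_eq hR hΛ (by rwa [h1.proj]) h2,
    act_eq hR hΛ ((conormal Λ (π m)).add_mem hα hβ) h3]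

/-- Uniqueness of flow lines identifies the global flow with translation in the chart, provided the
whole segment remains in the target. -/
theorem act_eq_symm (hR : IsASCIR Λ π σ η)
    (hΛ : ∀ (b : B) (α β : Covec k b), β (Λ b α) = - α (Λ b β)) (c : ActionChart Λ π σ m₀) {m : M}
    (hm : m ∈ c.coord.source) (hα : α (π m) ∈ conormal Λ (π m))
    (h : ∀ t ∈ Icc (0 : ℝ) 1,
      c.coord m + t • ((0, c.L (π m) (α (π m))) : Model k d) ∈ c.coord.target) :
    act π σ α m = c.coord.symm (c.coord m + ((0, c.L (π m) (α (π m))) : Model k d)) := by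
  have h1 := c.isFlowLine_symm (x := c.coord m) (c.base_mem m hm) (c.fst m hm) hα rfl
  obtain ⟨γ, h0, h0', hγ⟩ := flowsTo_iff.1 (flowsTo_act hR hΛ hα)
  have hopen : IsOpen {t : ℝ | c.coord m + t • ((0, c.L (π m) (α (π m))) : Model k d)
      ∈ c.coord.target} := c.coord.open_target.preimage (by fun_prop)
  have h2 := (hγ.mono (subset_univ _)).eqOn hR hΛ hα h1 hopen isPreconnected_Icc h (t₀ := 0)
    ⟨le_rfl, zero_le_one⟩ (by
      rw [h0, zero_smul, add_zero, c.coord.left_inv hm]) (x := 1) ⟨zero_le_one, le_rfl⟩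
  rw [← h0', h2]
  simp only [one_smul]

/-- Transitivity. Nearby points of a fibre differ by a translation in an action chart, hence by the
action of some conormal covector, and the orbit relation is an equivalence relation. The connected
fibre is thus a single orbit. -/
theorem exists_act_eq (hR : IsASCIR Λ π σ η)
    (hΛ : ∀ (b : B) (α β : Covec k b), β (Λ b α) = - α (Λ b β)) {m m' : M} (h : π m = π m') :
    ∃ α : ∀ b : B, Covec k b, α (π m) ∈ conormal Λ (π m) ∧ act π σ α m = m' := by
  refine (hR.connected_fiber (π m)).isPreconnected.induction₂
    (fun m m' => ∃ α : ∀ b : B, Covec k b, α (π m) ∈ conormal Λ (π m) ∧ act π σ α m = m')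
    (fun m₀ hm₀ => ?_) ?_ ?_ (rfl : π m = π m) h.symm
  · obtain ⟨c⟩ := exists_actionChart hR hΛ m₀
    have ht := c.coord.open_target.mem_nhds (c.coord.map_source c.mem_source)
    obtain ⟨ε, hε, hball⟩ := Metric.mem_nhds_iff.1 ht
    have h1 : ∀ᶠ m' in nhds m₀, c.coord m' ∈ Metric.ball (c.coord m₀) ε :=
      (c.coord.continuousAt c.mem_source).eventually (Metric.ball_mem_nhds _ hε)
    filter_upwards [nhdsWithin_le_nhds h1, self_mem_nhdsWithin,
      nhdsWithin_le_nhds (c.coord.open_source.mem_nhds c.mem_source)] with m' hm' hπ hs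
    have hπ' : π m' = π m₀ := Eq.trans hπ (Eq.symm hm₀)
    -- A constant `g` suffices here: only the value of `α` at `π m₀` matters, and it must translate
    -- `m₀` to `m'`.
    obtain ⟨α, hα⟩ := c.exists_form m₀ c.mem_source
      (fun _ => (c.coord m').2 - (c.coord m₀).2) (Filter.Eventually.of_forall fun _ => contMDiffAt_const)
    obtain ⟨-, hαc, hαL⟩ := hα.self_of_nhds
    have hx : ((0, c.L (π m₀) (α (π m₀))) : Model k d) = c.coord m' - c.coord m₀ := by
      refine Prod.ext ?_ hαL
      change (0 : EuclideanSpace ℝ (Fin k)) = (c.coord m').1 - (c.coord m₀).1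
      rw [c.fst _ hs, c.fst _ c.mem_source, hπ', sub_self]
    refine ⟨α, hαc, ?_⟩
    rw [act_eq_symm hR hΛ c c.mem_source hαc, hx, add_sub_cancel, c.coord.left_inv hs]
    intro t ht
    rw [hx]
    refine hball ?_
    exact (convex_ball (c.coord m₀) ε).add_smul_sub_mem (Metric.mem_ball_self hε) hm' ht
  · rintro m₁ h₁ m₂ h₂ m₃ h₃ ⟨α, hα, rfl⟩ ⟨β, hβ, rfl⟩
    have hπ := (flowsTo_act hR hΛ hα).proj
    have hβ' : β (π m₁) ∈ conormal Λ (π m₁) := by rwa [hπ] at hβ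
    exact ⟨β + α, (conormal Λ _).add_mem hβ' hα, act_add hR hΛ hβ' hα⟩
  · rintro m₁ h₁ m₂ h₂ ⟨α, hα, rfl⟩
    have hπ := (flowsTo_act hR hΛ hα).proj
    refine ⟨-α, by rw [hπ]; exact (conormal Λ _).neg_mem hα, ?_⟩
    rw [← act_add hR hΛ ((conormal Λ _).neg_mem hα) hα, neg_add_cancel, act_zero hR hΛ]

end FiberAction


/-! ### The flow of `α` is smooth and changes `σ` by `π^*dα`. -/

section Smoothness

open Set

variable {k d : ℕ} {B M : Type u}
  [TopologicalSpace B] [ChartedSpace (EuclideanSpace ℝ (Fin k)) B]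
  [TopologicalSpace M] [ChartedSpace (EuclideanSpace ℝ (Fin d)) M]
  {Λ : BivectorField k B} {π : C^∞⟮𝓡 d, M; 𝓡 k, B⟯} {σ : DiffForm d M 2} {η : DiffForm k B 3}
  {α β : ∀ b : B, Covec k b} {b : B} {m₀ : M}

theorem smoothAt_smul (r : ℝ) (hα : DiffForm.SmoothAt (oneForm α) b) :
    DiffForm.SmoothAt (oneForm (r • α)) b := by
  have h : DiffForm.inChart (oneForm (r • α)) b = r • DiffForm.inChart (oneForm α) b := by
    funext y; ext v; rfl
  rw [DiffForm.SmoothAt, h]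
  exact contDiffAt_const.smul hα

/-- The field of covectors `α` is smooth and conormal near `b`. -/
def ConormalNear (Λ : BivectorField k B) (α : ∀ b : B, Covec k b) (b : B) : Prop :=
  ∀ᶠ c in nhds b, DiffForm.SmoothAt (oneForm α) c ∧ α c ∈ conormal Λ c

namespace ConormalNear

theorem smoothAt (h : ConormalNear Λ α b) : DiffForm.SmoothAt (oneForm α) b :=
  (Filter.Eventually.self_of_nhds h).1

theorem mem (h : ConormalNear Λ α b) : α b ∈ conormal Λ b := (Filter.Eventually.self_of_nhds h).2

theorem smul (h : ConormalNear Λ α b) (r : ℝ) : ConormalNear Λ (r • α) b :=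
  h.mono fun _ hc => ⟨smoothAt_smul r hc.1, smul_mem_conormal hc.2 r⟩

theorem add (h : ConormalNear Λ α b) (h' : ConormalNear Λ β b) : ConormalNear Λ (α + β) b :=
  (h.and h').mono fun c hc => ⟨smoothAt_add hc.1.1 hc.2.1, (conormal Λ c).add_mem hc.1.2 hc.2.2⟩

theorem neg (h : ConormalNear Λ α b) : ConormalNear Λ (-α) b :=
  h.mono fun c hc => ⟨smoothAt_neg hc.1, (conormal Λ c).neg_mem hc.2⟩

theorem comap_proj {m : M} (h : ConormalNear Λ α (π m)) :
    ∀ᶠ m' in nhds m, ConormalNear Λ α (π m') :=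
  (π.contMDiff.continuous.continuousAt (x := m)).eventually (Filter.Eventually.eventually_nhds h)

end ConormalNear

/-- Near `m`, the map `F` is smooth and changes `σ` by `π^* dα`. -/
structure ShiftsForm (π : C^∞⟮𝓡 d, M; 𝓡 k, B⟯) (σ : DiffForm d M 2) (F : M → M)
    (α : ∀ b : B, Covec k b) (m : M) : Prop where
  smooth : ContMDiffAt (𝓡 d) (𝓡 d) ∞ F m
  pullback : ∀ v w : TangentSpace (𝓡 d) m,
    σ (F m) ![mfderiv (𝓡 d) (𝓡 d) F m v, mfderiv (𝓡 d) (𝓡 d) F m w] = σ m ![v, w]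
      + DiffForm.d (oneForm α) (π m) ![mfderiv (𝓡 d) (𝓡 k) π m v, mfderiv (𝓡 d) (𝓡 k) π m w]

theorem mfderiv_proj_comp {F : M → M} {m : M} (hF : MDifferentiableAt (𝓡 d) (𝓡 d) F m)
    (hπ : ∀ᶠ m' in nhds m, π (F m') = π m') (v : TangentSpace (𝓡 d) m) :
    (mfderiv (𝓡 d) (𝓡 k) π (F m) (mfderiv (𝓡 d) (𝓡 d) F m v) : EuclideanSpace ℝ (Fin k))
      = mfderiv (𝓡 d) (𝓡 k) π m v := by
  have h1 := mfderiv_comp m (π.contMDiff.contMDiffAt.mdifferentiableAt (x := F m) (by simp)) hF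
  have h2 : π ∘ F =ᶠ[nhds m] π := hπ
  rw [h2.mfderiv_eq] at h1
  exact (congrArg (fun A : EuclideanSpace ℝ (Fin d) →L[ℝ] EuclideanSpace ℝ (Fin k) => A v) h1).symm

theorem form_congr (τ : DiffForm d M 2) {m m' : M} (h : m = m')
    {v w v' w' : EuclideanSpace ℝ (Fin d)} (hv : v = v') (hw : w = w') :
    (τ m : EuclideanSpace ℝ (Fin d) [⋀^Fin 2]→L[ℝ] ℝ) ![v, w] = τ m' ![v', w'] := by
  subst h hv hw; rfl

theorem ShiftsForm.congr {F F' : M → M} {m : M} (h : ShiftsForm π σ F α m)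
    (hF : F' =ᶠ[nhds m] F) : ShiftsForm π σ F' α m := by
  refine ⟨h.smooth.congr_of_eventuallyEq hF, fun v w => ?_⟩
  have h1 : ∀ v : EuclideanSpace ℝ (Fin d),
      (mfderiv (𝓡 d) (𝓡 d) F' m v : EuclideanSpace ℝ (Fin d)) = mfderiv (𝓡 d) (𝓡 d) F m v :=
    fun v => congrArg (fun A : EuclideanSpace ℝ (Fin d) →L[ℝ] EuclideanSpace ℝ (Fin d) => A v)
      hF.mfderiv_eq
  exact (form_congr σ hF.self_of_nhds (h1 v) (h1 w)).trans (h.pullback v w)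

/-- `G` covers the identity, so pulling `π^*dα` back along `G` leaves it unchanged and the two
corrections add. -/
theorem ShiftsForm.comp {F G : M → M} {m : M} (hF : ShiftsForm π σ F α (G m))
    (hG : ShiftsForm π σ G β m) (hπ : ∀ᶠ m' in nhds m, π (G m') = π m')
    (hα : DiffForm.SmoothAt (oneForm α) (π m)) (hβ : DiffForm.SmoothAt (oneForm β) (π m)) :
    ShiftsForm π σ (fun x => F (G x)) (α + β) m := by
  have hGd := hG.smooth.mdifferentiableAt (by simp)
  refine ⟨hF.smooth.comp m hG.smooth, fun v w => ?_⟩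
  have h1 := mfderiv_comp m (hF.smooth.mdifferentiableAt (by simp)) hGd
  have h2 : ∀ v : EuclideanSpace ℝ (Fin d),
      (mfderiv (𝓡 d) (𝓡 d) (fun x => F (G x)) m v : EuclideanSpace ℝ (Fin d))
        = mfderiv (𝓡 d) (𝓡 d) F (G m) (mfderiv (𝓡 d) (𝓡 d) G m v) := fun v =>
    congrArg (fun A : EuclideanSpace ℝ (Fin d) →L[ℝ] EuclideanSpace ℝ (Fin d) => A v) h1
  refine (form_congr σ rfl (h2 v) (h2 w)).trans ((hF.pullback _ _).trans ?_)
  rw [hG.pullback, d_add hα hβ]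
  have h3 := form_congr (DiffForm.d (oneForm α)) hπ.self_of_nhds
    (mfderiv_proj_comp hGd hπ v) (mfderiv_proj_comp hGd hπ w)
  refine (congrArg (fun r : ℝ => σ m ![v, w] + DiffForm.d (oneForm β) (π m)
    ![mfderiv (𝓡 d) (𝓡 k) π m v, mfderiv (𝓡 d) (𝓡 k) π m w] + r) h3).trans ?_
  exact (add_assoc _ _ _).trans (congrArg (fun r : ℝ => σ m ![v, w] + r) (add_comm _ _))

variable [IsManifold (𝓡 k) ∞ B] [IsManifold (𝓡 d) ∞ M] [T2Space M]

theorem proj_act (hR : IsASCIR Λ π σ η)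
    (hΛ : ∀ (b : B) (α β : Covec k b), β (Λ b α) = - α (Λ b β)) {m : M}
    (hα : α (π m) ∈ conormal Λ (π m)) : π (act π σ α m) = π m :=
  (flowsTo_act hR hΛ hα).proj

theorem shiftsForm_act_of_chart (hR : IsASCIR Λ π σ η)
    (hΛ : ∀ (b : B) (α β : Covec k b), β (Λ b α) = - α (Λ b β)) (c : ActionChart Λ π σ m₀) {m : M}
    (hm : m ∈ c.coord.source) (hα : ConormalNear Λ α (π m))
    (h : ∀ᶠ m' in nhds m, ∀ t ∈ Icc (0 : ℝ) 1,
      c.coord m' + t • ((0, c.L (π m') (α (π m'))) : Model k d) ∈ c.coord.target) :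
    ShiftsForm π σ (act π σ α) α m := by
  have hs : ∀ᶠ m' in nhds m, m' ∈ c.coord.source := c.coord.open_source.mem_nhds hm
  have hact : ∀ᶠ m' in nhds m, act π σ α m'
      = c.coord.symm (c.coord m' + ((0, c.L (π m') (α (π m'))) : Model k d)) := by
    filter_upwards [h, hs, hα.comap_proj] with m' h1 h2 h3
    exact act_eq_symm hR hΛ c h2 h3.mem h1
  have htgt : ∀ᶠ m' in nhds m,
      c.coord m' + ((0, c.L (π m') (α (π m'))) : Model k d) ∈ c.coord.target := by
    filter_upwards [h] with m' h1
    have := h1 1 ⟨zero_le_one, le_rfl⟩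
    rwa [one_smul] at this
  have hL : ContMDiffAt (𝓡 d) 𝓘(ℝ, EuclideanSpace ℝ (Fin (d - k))) ∞
      (fun m' => c.L (π m') (α (π m'))) m :=
    (c.smooth_L m hm α hα.smoothAt).comp m π.contMDiff.contMDiffAt
  have hsm : ContMDiffAt (𝓡 d) (𝓡 d) ∞ (act π σ α) m := by
    refine ContMDiffAt.congr_of_eventuallyEq ?_ hact
    refine (c.smooth_symm _ htgt.self_of_nhds).comp m ?_
    exact (c.smooth m hm).add (contMDiffAt_const.prodMk_space hL)
  refine ⟨hsm, c.pullback _ α m hm ?_ (hsm.mdifferentiableAt (by simp)) hα.smoothAt ?_ ?_ ?_⟩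
  · rw [hact.self_of_nhds]
    exact c.coord.map_target htgt.self_of_nhds
  · filter_upwards [hα.comap_proj] with m' h1
    exact proj_act hR hΛ h1.mem
  · filter_upwards [hα.comap_proj] with m' h1
    exact h1.mem
  · filter_upwards [hact, htgt] with m' h1 h2
    rw [h1, c.coord.right_inv h2]
    rfl

/-- Compactness of the fibre again: for small `r`, uniformly along the fibre, the flow of `r • α`
stays inside one action chart. -/
theorem exists_shiftsForm_act_smul (hR : IsASCIR Λ π σ η)
    (hΛ : ∀ (b : B) (α β : Covec k b), β (Λ b α) = - α (Λ b β)) (hα : ConormalNear Λ α b) :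
    ∃ δ > 0, ∀ m, π m = b → ∀ r : ℝ, |r| < δ → ShiftsForm π σ (act π σ (r • α)) (r • α) m := by
  have hfib : ∀ m ∈ π ⁻¹' {b}, π m = b := fun _ h => h
  suffices h : ∃ δ > 0, ∀ m ∈ π ⁻¹' {b}, π m = b → ∀ r : ℝ, |r| < δ →
      ShiftsForm π σ (act π σ (r • α)) (r • α) m by
    obtain ⟨δ, hδ, h⟩ := h
    exact ⟨δ, hδ, fun m hm => h m hm hm⟩
  refine (hR.compact_fiber b).induction_on
    (p := fun s => ∃ δ > 0, ∀ m ∈ s, π m = b → ∀ r : ℝ, |r| < δ →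
      ShiftsForm π σ (act π σ (r • α)) (r • α) m) ?_ ?_ ?_ ?_
  · exact ⟨1, one_pos, fun m hm => hm.elim⟩
  · rintro s t hst ⟨δ, hδ, h⟩
    exact ⟨δ, hδ, fun m hm => h m (hst hm)⟩
  · rintro s t ⟨δ, hδ, h⟩ ⟨δ', hδ', h'⟩
    refine ⟨min δ δ', lt_min hδ hδ', ?_⟩
    rintro m (hm | hm) hb r hr
    · exact h m hm hb r (hr.trans_le (min_le_left _ _))
    · exact h' m hm hb r (hr.trans_le (min_le_right _ _))
  · intro m₀ hm₀
    obtain rfl : b = π m₀ := Eq.symm hm₀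
    obtain ⟨c⟩ := exists_actionChart hR hΛ m₀
    have hL : ContinuousAt (fun m' => c.L (π m') (α (π m'))) m₀ :=
      ((c.smooth_L m₀ c.mem_source α hα.smoothAt).comp m₀ π.contMDiff.contMDiffAt).continuousAt
    have hcont : ContinuousAt (fun p : M × ℝ =>
        c.coord p.1 + p.2 • ((0, c.L (π p.1) (α (π p.1))) : Model k d)) (m₀, 0) := by
      refine ContinuousAt.add ?_ (continuousAt_snd.smul (continuousAt_const.prodMk ?_))
      · exact ContinuousAt.comp (g := c.coord) (c.coord.continuousAt c.mem_source) continuousAt_fst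
      · exact ContinuousAt.comp (g := fun m' => c.L (π m') (α (π m'))) hL continuousAt_fst
    have hev : ∀ᶠ p : M × ℝ in nhds (m₀, 0), p.1 ∈ c.coord.source ∧
        c.coord p.1 + p.2 • ((0, c.L (π p.1) (α (π p.1))) : Model k d) ∈ c.coord.target := by
      refine (continuousAt_fst.eventually (c.coord.open_source.mem_nhds c.mem_source)).and
        (hcont.eventually (c.coord.open_target.mem_nhds ?_))
      change c.coord m₀ + (0 : ℝ) • _ ∈ _
      rw [zero_smul, add_zero]
      exact c.coord.map_source c.mem_source
    rw [nhds_prod_eq, Filter.eventually_prod_iff] at hev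
    obtain ⟨p, hp, q, hq, hpq⟩ := hev
    obtain ⟨δ, hδ, hball⟩ := Metric.eventually_nhds_iff_ball.1 hq
    -- The neighbourhood condition is imposed around `m` and not only at `m`, since `ShiftsForm`
    -- involves derivatives of the flow; `t * r` stays in the ball for all `t` in `[0, 1]`.
    refine ⟨{m | ∀ᶠ m' in nhds m, p m'}, nhdsWithin_le_nhds hp.eventually_nhds, δ, hδ,
      fun m hm hb r hr => ?_⟩
    refine shiftsForm_act_of_chart hR hΛ c
      (hpq hm.self_of_nhds (hball 0 (Metric.mem_ball_self hδ))).1 (hb ▸ hα.smul r) ?_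
    filter_upwards [hm] with m' hm' t ht
    have h1 : (t * r) ∈ Metric.ball (0 : ℝ) δ := by
      rw [mem_ball_zero_iff, Real.norm_eq_abs, abs_mul, abs_of_nonneg ht.1]
      exact (mul_le_of_le_one_left (abs_nonneg r) ht.2).trans_lt hr
    have h2 := (hpq hm' (hball _ h1)).2
    have h3 : t • ((0, c.L (π m') ((r • α) (π m'))) : Model k d)
        = (t * r) • ((0, c.L (π m') (α (π m'))) : Model k d) := by
      have h4 : c.L (π m') ((r • α) (π m')) = r • c.L (π m') (α (π m')) :=
        (c.L (π m')).map_smul r (α (π m'))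
      rw [h4, mul_smul]
      simp
    rw [h3]
    exact h2

/-- The flow of `α` is the `(n + 1)`-fold iterate of the flow of `α / (n + 1)`, which is small
enough for the chart formula. The iterates never leave the fibre of `m`, so one `δ` serves for all
of them. -/
theorem shiftsForm_act (hR : IsASCIR Λ π σ η)
    (hΛ : ∀ (b : B) (α β : Covec k b), β (Λ b α) = - α (Λ b β)) {m : M}
    (hα : ConormalNear Λ α (π m)) : ShiftsForm π σ (act π σ α) α m := by
  obtain ⟨δ, hδ, h⟩ := exists_shiftsForm_act_smul hR hΛ hα
  obtain ⟨n, hn⟩ := exists_nat_one_div_lt hδ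
  set r : ℝ := 1 / (n + 1)
  have hr : |r| < δ := by rwa [abs_of_pos (by positivity)]
  have key : ∀ j : ℕ, ∀ m', π m' = π m → ShiftsForm π σ (act π σ ((j * r) • α)) ((j * r) • α) m' := by
    intro j
    induction j with
    | zero =>
      intro m' hm'
      simpa using h m' hm' 0 (by simpa using hδ)
    | succ j ih =>
      intro m' hm'
      have hα' : ConormalNear Λ α (π m') := by rwa [hm']
      have h1 : ((j + 1 : ℕ) * r) • α = (j * r) • α + r • α := by
        rw [← add_smul]
        push_cast
        ring_nf
      rw [h1]
      have h2 := (ih _ ((proj_act hR hΛ (hα'.smul r).mem).trans hm')).comp (h m' hm' r hr)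
        (by filter_upwards [(hα'.smul r).comap_proj] with x hx using proj_act hR hΛ hx.mem)
        (hα'.smul _).smoothAt (hα'.smul r).smoothAt
      refine h2.congr ?_
      filter_upwards [hα'.comap_proj] with x hx
      exact act_add hR hΛ (hx.smul _).mem (hx.smul r).mem
  have h1 := key (n + 1) m rfl
  have h2 : ((n + 1 : ℕ) * r) • α = α := by
    have : ((n + 1 : ℕ) : ℝ) * r = 1 := by
      simp only [r]
      push_cast
      field_simp
    rw [this, one_smul]
  rwa [h2] at h1

omit [IsManifold (𝓡 k) ∞ B] [IsManifold (𝓡 d) ∞ M] [T2Space M] in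
-- Pullback of a form along a submersion is injective.
theorem d_oneForm_eq_zero (hR : IsASCIR Λ π σ η) {m : M}
    (h : ∀ v w : TangentSpace (𝓡 d) m, DiffForm.d (oneForm α) (π m)
      ![mfderiv (𝓡 d) (𝓡 k) π m v, mfderiv (𝓡 d) (𝓡 k) π m w] = 0) :
    DiffForm.d (oneForm α) (π m) = 0 := by
  refine ContinuousAlternatingMap.ext fun u => ?_
  obtain ⟨v, hv⟩ := hR.submersion m (u 0)
  obtain ⟨w, hw⟩ := hR.submersion m (u 1)
  have h1 := h v w
  rw [hv, hw] at h1
  exact (form_eq_vecCons (X := EuclideanSpace ℝ (Fin k)) (DiffForm.d (oneForm α) (π m)) u).trans h1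

end Smoothness


/-! ### Automorphisms are locally flows of closed forms. -/

section Symmetries

open Set

variable {k d : ℕ} {B M : Type u}
  [TopologicalSpace B] [ChartedSpace (EuclideanSpace ℝ (Fin k)) B]
  [TopologicalSpace M] [ChartedSpace (EuclideanSpace ℝ (Fin d)) M]
  {Λ : BivectorField k B} {π : C^∞⟮𝓡 d, M; 𝓡 k, B⟯} {σ : DiffForm d M 2} {η : DiffForm k B 3}
  {α β : ∀ b : B, Covec k b} {b : B} {F : M → M} {U : Opens B}

/-- Over `U`, the map `F` is smooth, covers the identity of `B` and preserves `σ`. -/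
structure IsSymmetry (π : C^∞⟮𝓡 d, M; 𝓡 k, B⟯) (σ : DiffForm d M 2) (U : Opens B) (F : M → M) :
    Prop where
  smooth : ∀ m, π m ∈ U → ContMDiffAt (𝓡 d) (𝓡 d) ∞ F m
  proj : ∀ m, π m ∈ U → π (F m) = π m
  preserves : ∀ m, π m ∈ U → ∀ v w : TangentSpace (𝓡 d) m,
    σ (F m) ![mfderiv (𝓡 d) (𝓡 d) F m v, mfderiv (𝓡 d) (𝓡 d) F m w] = σ m ![v, w]

namespace IsSymmetry

theorem proj_eventually (h : IsSymmetry π σ U F) {m : M} (hm : π m ∈ U) :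
    ∀ᶠ m' in nhds m, π (F m') = π m' := by
  filter_upwards [(pre π U).2.mem_nhds hm] with m' hm'
  exact h.proj m' hm'

theorem mfderiv_surjective (hR : IsASCIR Λ π σ η) (h : IsSymmetry π σ U F) {m : M}
    (hm : π m ∈ U) : Function.Surjective (mfderiv (𝓡 d) (𝓡 d) F m) := by
  let A : EuclideanSpace ℝ (Fin d) →ₗ[ℝ] EuclideanSpace ℝ (Fin d) :=
    (mfderiv (𝓡 d) (𝓡 d) F m).toLinearMap
  have hA : Function.Injective A := by
    rw [injective_iff_map_eq_zero]
    intro v hv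
    refine hR.nondegenerate m v fun w => ?_
    refine (h.preserves m hm v w).symm.trans ?_
    exact (σ (F m)).map_coord_zero 0 hv
  have hs : Function.Surjective A := LinearMap.injective_iff_surjective.1 hA
  exact hs

/-- A map preserving `σ` and `π` carries the vertical field `X` with `ι_X σ = π^*α` to itself.
Nondegeneracy makes its differential surjective, so the contraction can be tested on images of
vectors. -/
theorem flowsTo (hR : IsASCIR Λ π σ η) (h : IsSymmetry π σ U F) {m m' : M} (hm : π m ∈ U)
    (hf : FlowsTo π σ α m m') : FlowsTo π σ α (F m) (F m') := by
  obtain ⟨γ, rfl, rfl, hγ⟩ := hf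
  refine ⟨fun t => F (γ t), rfl, rfl, fun t => ?_⟩
  obtain ⟨hπ, v, hv, hw⟩ := hγ t
  have hU : π (γ t) ∈ U := by rwa [hπ]
  refine ⟨by rw [h.proj _ hU, hπ, h.proj _ hm], mfderiv (𝓡 d) (𝓡 d) F (γ t) v, ?_, fun w => ?_⟩
  · have h1 := ((h.smooth _ hU).mdifferentiableAt (by simp)).hasMFDerivAt.comp t hv
    refine h1.congr_mfderiv ?_
    refine ContinuousLinearMap.ext fun r : ℝ => ?_
    exact map_smul (mfderiv (𝓡 d) (𝓡 d) F (γ t)) r v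
  · obtain ⟨w, rfl⟩ := h.mfderiv_surjective hR hU w
    rw [h.preserves _ hU]
    refine (hw w).trans ?_
    have h1 := mfderiv_proj_comp ((h.smooth _ hU).mdifferentiableAt (by simp))
      (h.proj_eventually hU) w
    have h2 : ∀ b', b' = π (γ t) → ∀ u : EuclideanSpace ℝ (Fin k),
        (α (π (γ t)) : EuclideanSpace ℝ (Fin k) →L[ℝ] ℝ) u = α b' u := by rintro _ rfl u; rfl
    exact (congrArg (α (π (γ t))) h1).symm.trans (h2 _ (h.proj _ hU) _)

variable [IsManifold (𝓡 k) ∞ B] [IsManifold (𝓡 d) ∞ M] [T2Space M]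

theorem map_act (hR : IsASCIR Λ π σ η)
    (hΛ : ∀ (b : B) (α β : Covec k b), β (Λ b α) = - α (Λ b β)) (h : IsSymmetry π σ U F) {m : M}
    (hm : π m ∈ U) (hα : α (π m) ∈ conormal Λ (π m)) : F (act π σ α m) = act π σ α (F m) :=
  (act_eq hR hΛ (by rwa [h.proj m hm]) (h.flowsTo hR hm (flowsTo_act hR hΛ hα))).symm

/-- A symmetry is locally the time-one flow of a closed form. -/
theorem exists_eq_act (hR : IsASCIR Λ π σ η)
    (hΛ : ∀ (b : B) (α β : Covec k b), β (Λ b α) = - α (Λ b β)) (h : IsSymmetry π σ U F)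
    (hb : b ∈ U) : ∃ α : ∀ b : B, Covec k b, ∀ᶠ c in nhds b, ConormalNear Λ α c ∧
      DiffForm.d (oneForm α) c = 0 ∧ ∀ m, π m = c → F m = act π σ α m := by
  obtain ⟨m₀, rfl⟩ := hR.surjective b
  obtain ⟨c⟩ := exists_actionChart hR hΛ m₀
  have hm₀ := c.mem_source
  -- Transitivity gives a covector moving `m₀` to `F m₀`; `α₁` extends it to a smooth conormal
  -- field, chosen to have constant `L`-value in the action chart.
  obtain ⟨α₀, hα₀, hα₀F⟩ := exists_act_eq hR hΛ (h.proj m₀ hb).symm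
  obtain ⟨α₁, hα₁⟩ := c.exists_form m₀ hm₀ (fun _ => c.L (π m₀) (α₀ (π m₀)))
    (Filter.Eventually.of_forall fun _ => contMDiffAt_const)
  have hα₁c : ConormalNear Λ α₁ (π m₀) := hα₁.mono fun _ h => ⟨h.1, h.2.1⟩
  have hα₁0 : α₀ (π m₀) = α₁ (π m₀) := by
    refine (sub_eq_zero.1 (c.injective m₀ hm₀ _ ((conormal Λ _).sub_mem hα₁c.mem hα₀) ?_)).symm
    rw [map_sub, hα₁.self_of_nhds.2.2, sub_self]
  -- the symmetry `H` fixes `m₀`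
  let H : M → M := fun m => act π σ (-α₁) (F m)
  have hH₀ : H m₀ = m₀ := by
    change act π σ (-α₁) (F m₀) = m₀
    rw [← hα₀F, act_congr hR hΛ hα₀ hα₁0, ← act_add hR hΛ hα₁c.neg.mem hα₁c.mem, neg_add_cancel,
      act_zero hR hΛ]
  set ψ := extChartAt (𝓡 k) (π m₀)
  -- a local section through `m₀`
  let s : B → M := fun b => c.coord.symm (ψ b, (c.coord m₀).2)
  have hψ₀ : (ψ (π m₀), (c.coord m₀).2) = c.coord m₀ := Prod.ext (c.fst m₀ hm₀).symm rfl
  have hs₀ : s (π m₀) = m₀ := by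
    change c.coord.symm (ψ (π m₀), (c.coord m₀).2) = m₀
    rw [hψ₀, c.coord.left_inv hm₀]
  have hψn : ∀ᶠ b in nhds (π m₀), b ∈ ψ.source :=
    (isOpen_extChartAt_source (I := 𝓡 k) (π m₀)).mem_nhds (mem_extChartAt_source _)
  have htn : ∀ᶠ b in nhds (π m₀), (ψ b, (c.coord m₀).2) ∈ c.coord.target := by
    have h1 : ContinuousAt (fun b => (ψ b, (c.coord m₀).2)) (π m₀) :=
      (continuousAt_extChartAt (π m₀)).prodMk continuousAt_const
    refine h1.eventually (c.coord.open_target.mem_nhds ?_)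
    change (ψ (π m₀), (c.coord m₀).2) ∈ _
    rw [hψ₀]
    exact c.coord.map_source hm₀
  have hs : ∀ᶠ b in nhds (π m₀), ContMDiffAt (𝓡 k) (𝓡 d) ∞ s b ∧ π (s b) = b ∧
      s b ∈ c.coord.source ∧ c.coord (s b) = (ψ b, (c.coord m₀).2) := by
    filter_upwards [hψn, htn] with b h1 h2
    refine ⟨?_, c.proj_symm h2 h1 rfl, c.coord.map_target h2, c.coord.right_inv h2⟩
    exact (c.smooth_symm _ h2).comp b
      ((contMDiffAt_extChartAt_of_mem h1).prodMk_space contMDiffAt_const)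
  have hUn : ∀ᶠ b in nhds (π m₀), b ∈ U := U.2.mem_nhds hb
  have hHs : ∀ᶠ b in nhds (π m₀), ContMDiffAt (𝓡 k) (𝓡 d) ∞ (fun b => H (s b)) b ∧
      π (H (s b)) = b := by
    filter_upwards [hs, hUn, Filter.Eventually.eventually_nhds hα₁c] with b h1 h2 h3
    have h4 : π (s b) ∈ U := by rwa [h1.2.1]
    have h5 : π (F (s b)) = b := (h.proj _ h4).trans h1.2.1
    have h6 : ConormalNear Λ α₁ (π (F (s b))) := by rw [h5]; exact h3
    exact ⟨ContMDiffAt.comp b (shiftsForm_act hR hΛ h6.neg).smooth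
      (ContMDiffAt.comp b (h.smooth _ h4) h1.1), (proj_act hR hΛ h6.neg.mem).trans h5⟩
  have hHc : ContinuousAt (fun b => H (s b)) (π m₀) := hHs.self_of_nhds.1.continuousAt
  have hHs₀ : H (s (π m₀)) = m₀ := by rw [hs₀, hH₀]
  have hHsrc : ∀ᶠ b in nhds (π m₀), H (s b) ∈ c.coord.source :=
    hHc.eventually (c.coord.open_source.mem_nhds (by
      change H (s (π m₀)) ∈ _
      rwa [hHs₀]))
  -- `H` keeps the section `s` inside the chart near `π m₀`, so the displacement from `s` to `H ∘ s`
  -- is a smooth translation, and `exists_form` realizes it by a conormal field.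
  obtain ⟨α₂, hα₂⟩ := c.exists_form m₀ hm₀ (fun b => (c.coord (H (s b))).2 - (c.coord m₀).2) (by
    filter_upwards [hHs, hHsrc] with b h1 h2
    have h3 : ContMDiffAt (𝓡 k) 𝓘(ℝ, Model k d) ∞ (fun b => c.coord (H (s b))) b :=
      ContMDiffAt.comp b (c.smooth _ h2) h1.1
    exact (contDiffAt_snd.contMDiffAt.comp b h3).sub contMDiffAt_const)
  have hα₂c : ConormalNear Λ α₂ (π m₀) := hα₂.mono fun _ h => ⟨h.1, h.2.1⟩
  obtain ⟨ε, hε, hball⟩ := Metric.mem_nhds_iff.1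
    (c.coord.open_target.mem_nhds (c.coord.map_source hm₀))
  have hn1 : ∀ᶠ b in nhds (π m₀), c.coord (H (s b)) ∈ Metric.ball (c.coord m₀) ε := by
    have h1 : ContinuousAt (fun b => c.coord (H (s b))) (π m₀) :=
      ContinuousAt.comp (g := c.coord) (by
        rw [hHs₀]
        exact c.coord.continuousAt hm₀) hHc
    refine h1.eventually (Metric.isOpen_ball.mem_nhds ?_)
    change c.coord (H (s (π m₀))) ∈ _
    rw [hHs₀]
    exact Metric.mem_ball_self hε
  have hn2 : ∀ᶠ b in nhds (π m₀), c.coord (s b) ∈ Metric.ball (c.coord m₀) ε := by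
    have h1 : ContinuousAt (fun b => c.coord (s b)) (π m₀) :=
      ContinuousAt.comp (g := c.coord) (by
        rw [hs₀]
        exact c.coord.continuousAt hm₀) hs.self_of_nhds.1.continuousAt
    refine h1.eventually (Metric.isOpen_ball.mem_nhds ?_)
    change c.coord (s (π m₀)) ∈ _
    rw [hs₀]
    exact Metric.mem_ball_self hε
  have hact₂ : ∀ᶠ b in nhds (π m₀), act π σ α₂ (s b) = H (s b) := by
    filter_upwards [hn1, hn2, hα₂, hs, hHs, hHsrc] with b h1 h2 h3 h4 h5 h6
    have hx : ((0, c.L (π (s b)) (α₂ (π (s b)))) : Model k d)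
        = c.coord (H (s b)) - c.coord (s b) := by
      refine Prod.ext ?_ ?_
      · change (0 : EuclideanSpace ℝ (Fin k)) = (c.coord (H (s b))).1 - (c.coord (s b)).1
        rw [c.fst _ h6, c.fst _ h4.2.2.1, h5.2, h4.2.1, sub_self]
      · have h7 : ∀ b', b' = b → c.L b' (α₂ b') = (c.coord (H (s b))).2 - (c.coord m₀).2 := by
          rintro _ rfl; exact h3.2.2
        refine (h7 _ h4.2.1).trans ?_
        change _ = (c.coord (H (s b))).2 - (c.coord (s b)).2
        rw [h4.2.2.2]
    have h8 : α₂ (π (s b)) ∈ conormal Λ (π (s b)) := by rw [h4.2.1]; exact h3.2.1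
    rw [act_eq_symm hR hΛ c h4.2.2.1 h8, hx, add_sub_cancel, c.coord.left_inv h6]
    intro t ht
    rw [hx]
    exact hball ((convex_ball (c.coord m₀) ε).add_smul_sub_mem h2 h1 ht)
  have hF : ∀ᶠ b in nhds (π m₀), b ∈ U ∧ ConormalNear Λ (α₁ + α₂) b ∧
      ∀ m, π m = b → F m = act π σ (α₁ + α₂) m := by
    filter_upwards [hact₂, hs, hUn, Filter.Eventually.eventually_nhds hα₁c,
      Filter.Eventually.eventually_nhds hα₂c] with b h1 h2 h3 h4 h5
    have hc : ConormalNear Λ α₁ b := h4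
    have hc' : ConormalNear Λ α₂ b := h5
    refine ⟨h3, hc.add hc', ?_⟩
    rintro m rfl
    have hsU : π (s (π m)) ∈ U := by rwa [h2.2.1]
    have hFs : F (s (π m)) = act π σ (α₁ + α₂) (s (π m)) := by
      rw [act_add hR hΛ (by rw [h2.2.1]; exact hc.mem) (by rw [h2.2.1]; exact hc'.mem), h1]
      change _ = act π σ α₁ (act π σ (-α₁) (F (s (π m))))
      have h6 : π (F (s (π m))) = π m := (h.proj _ hsU).trans h2.2.1
      rw [← act_add hR hΛ (by rw [h6]; exact hc.mem) (by rw [h6]; exact hc.neg.mem),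
        add_neg_cancel, act_zero hR hΛ]
    -- `F` and the flow of `α₁ + α₂` agree at `s (π m)`. Any `m` in the fibre is reached from there
    -- by some `β`; both maps commute with its action, so they agree at `m`.
    obtain ⟨β, hβ, hβm⟩ := exists_act_eq hR hΛ h2.2.1
    have hβ' : β (π m) ∈ conormal Λ (π m) := by rwa [h2.2.1] at hβ
    have hα' : (α₁ + α₂) (π (s (π m))) ∈ conormal Λ (π (s (π m))) := by
      rw [h2.2.1]; exact (hc.add hc').mem
    rw [← hβm, h.map_act hR hΛ hsU hβ, hFs, ← act_add hR hΛ hβ hα', add_comm β,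
      act_add hR hΛ hα' hβ]
  refine ⟨α₁ + α₂, ?_⟩
  filter_upwards [hF.eventually_nhds] with b hb
  obtain ⟨hbU, hbc, hbF⟩ := hb.self_of_nhds
  refine ⟨hbc, ?_, hbF⟩
  obtain ⟨m, rfl⟩ := hR.surjective b
  refine d_oneForm_eq_zero hR fun v w => ?_
  have h1 : F =ᶠ[nhds m] act π σ (α₁ + α₂) := by
    filter_upwards [(π.contMDiff.continuous.continuousAt (x := m)).eventually hb] with m' hm'
    exact hm'.2.2 m' rfl
  -- The flow changes `σ` by `π^*d(α₁ + α₂)` while `F` preserves `σ`; hence the form is closed.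
  have h2 := ((shiftsForm_act hR hΛ hbc).congr h1).pullback v w
  rw [h.preserves m hbU] at h2
  exact left_eq_add.1 h2

end IsSymmetry

end Symmetries


/-! ### Functions constant on the leaves have conormal differential, and conversely. -/

section Leaves

open Set

variable {k : ℕ} {B : Type u} [TopologicalSpace B] [ChartedSpace (EuclideanSpace ℝ (Fin k)) B]
  {Λ : BivectorField k B} {f : B → ℝ} {U : Opens B} {b : B}

theorem hasDerivAt_comp_curve {γ : ℝ → B} {r : ℝ}
    (hf : MDifferentiableAt (𝓡 k) 𝓘(ℝ, ℝ) f (γ r)) (hγ : MDifferentiableAt 𝓘(ℝ, ℝ) (𝓡 k) γ r) :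
    HasDerivAt (fun t => f (γ t)) (diffl f (γ r) (mfderiv 𝓘(ℝ, ℝ) (𝓡 k) γ r (1 : ℝ))) r := by
  have h1 := (hf.hasMFDerivAt.comp r hγ.hasMFDerivAt).hasFDerivAt
  have h2 : (((mfderiv (𝓡 k) 𝓘(ℝ, ℝ) f (γ r)).comp (mfderiv 𝓘(ℝ, ℝ) (𝓡 k) γ r)) : ℝ →L[ℝ] ℝ)
      = (1 : ℝ →L[ℝ] ℝ).smulRight (diffl f (γ r) (mfderiv 𝓘(ℝ, ℝ) (𝓡 k) γ r (1 : ℝ)) : ℝ) := by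
    refine ContinuousLinearMap.ext_ring ?_
    exact (one_smul ℝ _).symm
  have h3 : HasFDerivAt (fun t => f (γ t)) ((1 : ℝ →L[ℝ] ℝ).smulRight
    (diffl f (γ r) (mfderiv 𝓘(ℝ, ℝ) (𝓡 k) γ r (1 : ℝ)) : ℝ)) r := h1.congr_fderiv h2
  exact h3.hasDerivAt.congr_deriv (one_smul ℝ _)

/-- A function whose differential is conormal is constant on the leaves. -/
theorem eq_of_mem_leaf (hf : ∀ x ∈ U, MDifferentiableAt (𝓡 k) 𝓘(ℝ, ℝ) f x)
    (hc : ∀ x ∈ U, diffl f x ∈ conormal Λ x) {x y : B} (h : y ∈ leaf Λ U x) : f x = f y := by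
  have hstep : ∀ x y, LeafStep Λ U x y → f x = f y := by
    rintro x y ⟨γ, s, t, hst, rfl, rfl, hγ⟩
    have hd : ∀ r ∈ Icc s t, HasDerivAt (fun t => f (γ t)) 0 r := by
      intro r hr
      obtain ⟨hU, hγr, hL⟩ := hγ r hr
      exact (hasDerivAt_comp_curve (hf _ hU) (hγr.mdifferentiableAt (by simp))).congr_deriv
        (hc _ hU _ hL)
    exact (constant_of_has_deriv_right_zero
      (fun r hr => (hd r hr).continuousAt.continuousWithinAt)
      (fun r hr => (hd r (Ico_subset_Icc_self hr)).hasDerivWithinAt) t ⟨hst, le_rfl⟩).symm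
  have h' : Relation.ReflTransGen (LeafStep Λ U) x y := h
  induction h' with
  | refl => rfl
  | tail _ hbc ih => exact (ih ‹_›).trans (hstep _ _ hbc)

variable [IsManifold (𝓡 k) ∞ B]

/-- Through `b` there is a `C¹` curve tangent to the leaves with derivative `Π♯ a`. -/
theorem exists_leafCurve
    (hΛ : ContDiffAt ℝ ∞ (BivectorField.inChart Λ b) (extChartAt (𝓡 k) b b)) (hb : b ∈ U)
    (a : Covec k b) :
    ∃ γ : ℝ → B, γ 0 = b ∧ (mfderiv 𝓘(ℝ, ℝ) (𝓡 k) γ 0 (1 : ℝ) : EuclideanSpace ℝ (Fin k)) = Λ b a ∧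
      ∃ ε > 0, ∀ r, |r| < ε → γ r ∈ U ∧ ContMDiffAt 𝓘(ℝ, ℝ) (𝓡 k) 1 γ r ∧
        mfderiv 𝓘(ℝ, ℝ) (𝓡 k) γ r (1 : ℝ) ∈ leafTangent Λ (γ r) := by
  set ψ := extChartAt (𝓡 k) b
  -- The image under `Π♯` of a covector field with constant coefficients in the chart, tangent to
  -- the leaves throughout; Picard-Lindelöf supplies its integral curve.
  let X : EuclideanSpace ℝ (Fin k) → EuclideanSpace ℝ (Fin k) := fun y =>
    BivectorField.inChart Λ b y (covecCoord b b a)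
  have hX : ContDiffAt ℝ 1 X (ψ b) :=
    (hΛ.clm_apply contDiffAt_const).of_le (WithTop.coe_le_coe.2 le_top)
  obtain ⟨u, hu0, ε, hε, hu⟩ :=
    hX.exists_forall_mem_closedBall_exists_eq_forall_mem_Ioo_hasDerivAt₀ 0
  have hbψ : b ∈ ψ.source := mem_extChartAt_source b
  have hψb : ψ b ∈ ψ.target := mem_extChartAt_target b
  have huc : ContinuousAt u 0 := (hu 0 ⟨by simpa, by simpa⟩).continuousAt
  have hgood : ∀ᶠ y in nhds (ψ b), ContDiffAt ℝ 1 X y ∧ y ∈ ψ.target ∧ ψ.symm y ∈ U := by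
    refine (hX.eventually (by simp)).and (((isOpen_extChartAt_target b).mem_nhds hψb |>
      fun h => (h : ∀ᶠ y in nhds (ψ b), y ∈ ψ.target)).and ?_)
    refine (continuousAt_extChartAt_symm (I := 𝓡 k) b).eventually (U.2.mem_nhds ?_)
    rwa [extChartAt_to_inv]
  have hev : ∀ᶠ r in nhds (0 : ℝ), ∀ᶠ s in nhds r, HasDerivAt u (X (u s)) s ∧
      ContDiffAt ℝ 1 X (u s) ∧ u s ∈ ψ.target ∧ ψ.symm (u s) ∈ U := by
    refine Filter.Eventually.eventually_nhds (Filter.Eventually.and ?_ ?_)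
    · filter_upwards [Ioo_mem_nhds (a := 0 - ε) (b := 0 + ε) (x := (0 : ℝ)) (by simpa) (by simpa)]
        with s hs using hu s hs
    · exact huc.eventually (by rwa [hu0])
  have hXs : ∀ y ∈ ψ.target, mfderiv (𝓡 k) (𝓡 k) ψ.symm y (X y)
      = Λ (ψ.symm y) ((covecCoord b b a).comp (mfderiv (𝓡 k) (𝓡 k) ψ (ψ.symm y))) := by
    intro y hy
    have h1 := mfderiv_extChartAt_symm_mfderiv (ψ.map_target hy)
      (Λ (ψ.symm y) ((covecCoord b b a).comp (mfderiv (𝓡 k) (𝓡 k) ψ (ψ.symm y))))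
    have h2 : ψ (ψ.symm y) = y := ψ.right_inv hy
    have h3 : ∀ y', y' = y → ∀ v : EuclideanSpace ℝ (Fin k),
        (mfderiv (𝓡 k) (𝓡 k) ψ.symm y v : EuclideanSpace ℝ (Fin k))
          = mfderiv (𝓡 k) (𝓡 k) ψ.symm y' v := by rintro _ rfl v; rfl
    exact (h3 _ h2 _).trans h1
  have hγd : ∀ r, HasDerivAt u (X (u r)) r → u r ∈ ψ.target →
      (mfderiv 𝓘(ℝ, ℝ) (𝓡 k) (fun t => ψ.symm (u t)) r (1 : ℝ) : EuclideanSpace ℝ (Fin k))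
        = Λ (ψ.symm (u r)) ((covecCoord b b a).comp (mfderiv (𝓡 k) (𝓡 k) ψ (ψ.symm (u r)))) := by
    intro r h1 h2
    have h3 := ((contMDiffAt_extChartAt_symm h2).mdifferentiableAt (by simp)).hasMFDerivAt.comp r
      h1.hasFDerivAt.hasMFDerivAt
    have h4 : mfderiv 𝓘(ℝ, ℝ) (𝓡 k) (fun t => ψ.symm (u t)) r = _ := h3.mfderiv
    rw [h4]
    refine Eq.trans ?_ (hXs _ h2)
    exact congrArg (mfderiv (𝓡 k) (𝓡 k) ψ.symm (u r)) (one_smul ℝ (X (u r)))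
  refine ⟨fun t => ψ.symm (u t), ?_, ?_, ?_⟩
  · change ψ.symm (u 0) = b
    rw [hu0]
    exact extChartAt_to_inv b
  · have h0 := hev.self_of_nhds.self_of_nhds
    refine (hγd 0 h0.1 h0.2.2.1).trans ?_
    have h1 : ∀ b', b' = b → (Λ b' ((covecCoord b b a).comp (mfderiv (𝓡 k) (𝓡 k) ψ b')) :
        EuclideanSpace ℝ (Fin k)) = Λ b a := by
      intro b' hb'
      subst hb'
      exact congrArg (Λ b') (covecCoord_comp hbψ a)
    refine h1 _ ?_
    rw [hu0]
    exact extChartAt_to_inv b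
  · obtain ⟨δ, hδ, hball⟩ := Metric.eventually_nhds_iff_ball.1 hev
    refine ⟨δ, hδ, fun r hr => ?_⟩
    have hr' := hball r (by rwa [mem_ball_zero_iff])
    obtain ⟨h1, h2, h3, h4⟩ := hr'.self_of_nhds
    refine ⟨h4, ?_, ?_⟩
    · have hu1 : ContDiffAt ℝ 1 u r := by
        obtain ⟨V, hV, hVo, hrV⟩ := eventually_nhds_iff.1 hr'
        rw [contDiffAt_one_iff]
        refine ⟨fun s => ContinuousLinearMap.toSpanSingleton ℝ (X (u s)), V, hVo.mem_nhds hrV, ?_,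
          fun s hs => (hV s hs).1.hasFDerivAt⟩
        intro s hs
        have h5 : ContinuousAt (fun s => X (u s)) s :=
          ContinuousAt.comp (g := X) (hV s hs).2.1.continuousAt (hV s hs).1.continuousAt
        exact ((ContinuousLinearMap.toSpanSingletonCLE (𝕜 := ℝ)).continuous.continuousAt.comp
          h5).continuousWithinAt
      exact ((contMDiffAt_extChartAt_symm h3).of_le (WithTop.coe_le_coe.2 le_top)).comp r
        hu1.contMDiffAt
    · exact ⟨_, (hγd r h1 h3).symm⟩

/-- The differential of a function that is constant on the leaves is conormal. -/
theorem diffl_mem_conormal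
    (hΛ : ContDiffAt ℝ ∞ (BivectorField.inChart Λ b) (extChartAt (𝓡 k) b b)) (hb : b ∈ U)
    (hf : MDifferentiableAt (𝓡 k) 𝓘(ℝ, ℝ) f b)
    (hc : ∀ x ∈ U, ∀ y ∈ U, y ∈ leaf Λ U x → f x = f y) : diffl f b ∈ conormal Λ b := by
  rintro _ ⟨a, rfl⟩
  change diffl f b (Λ b a) = 0
  obtain ⟨γ, rfl, hd, ε, hε, hγ⟩ := exists_leafCurve hΛ hb a
  have h0 := hγ 0 (by simpa)
  have h1 := hasDerivAt_comp_curve hf (h0.2.1.mdifferentiableAt (by simp))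
  have h2 : (fun t => f (γ t)) =ᶠ[nhds 0] fun _ => f (γ 0) := by
    filter_upwards [Metric.ball_mem_nhds (0 : ℝ) hε] with t ht
    rw [mem_ball_zero_iff, Real.norm_eq_abs] at ht
    have hstep : ∀ s t : ℝ, s ≤ t → |s| < ε → |t| < ε → f (γ s) = f (γ t) := by
      intro s t hst hs ht
      refine hc _ (hγ s hs).1 _ (hγ t ht).1 (Relation.ReflTransGen.single
        ⟨γ, s, t, hst, rfl, rfl, fun r hr => hγ r ?_⟩)
      exact abs_lt.2 ⟨(abs_lt.1 hs).1.trans_le hr.1, hr.2.trans_lt (abs_lt.1 ht).2⟩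
    rcases le_total t 0 with h | h
    · exact hstep t 0 h ht (by simpa)
    · exact (hstep 0 t h (by simpa) ht).symm
  have h3 := h1.unique ((hasDerivAt_const (0 : ℝ) (f (γ 0))).congr_of_eventuallyEq h2)
  exact (congrArg (diffl f (γ 0)) hd).symm.trans h3

end Leaves

/-! ### The Poincaré lemma for one-forms on a manifold. -/

section Poincare

open Set

variable {k : ℕ} {B : Type u} [TopologicalSpace B] [ChartedSpace (EuclideanSpace ℝ (Fin k)) B]
  [IsManifold (𝓡 k) ∞ B] {f : B → ℝ} {α : ∀ b : B, Covec k b} {b : B}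

/-- In a chart, `df` is the derivative of the coordinate expression of `f`, and closedness is the
symmetry of its second derivative. -/
theorem smoothAt_diffl (hf : ∀ᶠ c in nhds b, ContMDiffAt (𝓡 k) 𝓘(ℝ, ℝ) ∞ f c) :
    DiffForm.SmoothAt (oneForm (diffl (k := k) f)) b ∧
      DiffForm.d (oneForm (diffl (k := k) f)) b = 0 := by
  set ψ := extChartAt (𝓡 k) b
  have hψb : ψ.symm (ψ b) = b := extChartAt_to_inv b
  have hfe : ∀ᶠ y in nhds (ψ b), ContMDiffAt (𝓡 k) 𝓘(ℝ, ℝ) ∞ f (ψ.symm y) :=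
    (continuousAt_extChartAt_symm (I := 𝓡 k) b).eventually (by rwa [hψb])
  have hte : ∀ᶠ y in nhds (ψ b), y ∈ ψ.target :=
    (isOpen_extChartAt_target b).mem_nhds (mem_extChartAt_target b)
  have hF : ContDiffAt ℝ ∞ (fun y => f (ψ.symm y)) (ψ b) :=
    (ContMDiffAt.comp (ψ b) hfe.self_of_nhds
      (contMDiffAt_extChartAt_symm hte.self_of_nhds)).contDiffAt
  have he : covPull ψ.symm (diffl (k := k) f) =ᶠ[nhds (ψ b)] fderiv ℝ (fun y => f (ψ.symm y)) := by
    filter_upwards [hfe, hte] with y hy hyt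
    have h1 := mfderiv_comp y (hy.mdifferentiableAt (by simp))
      ((contMDiffAt_extChartAt_symm hyt).mdifferentiableAt (by simp))
    exact (mfderiv_eq_fderiv.symm.trans h1).symm
  have hs : DiffForm.SmoothAt (oneForm (diffl (k := k) f)) b := by
    rw [smoothAt_oneForm_iff]
    exact (hF.fderiv_right (by simp)).congr_of_eventuallyEq he
  refine ⟨hs, ContinuousAlternatingMap.ext fun u => ?_⟩
  refine (form_eq_vecCons (X := EuclideanSpace ℝ (Fin k)) _ u).trans ?_
  have hu : ∀ v : TangentSpace (𝓡 k) b,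
      mfderiv (𝓡 k) (𝓡 k) ψ.symm (ψ b) (mfderiv (𝓡 k) (𝓡 k) ψ b v) = v := fun v =>
    mfderiv_extChartAt_symm_mfderiv (mem_extChartAt_source b) v
  have h1 := (fderiv_covPull_extChartAt_symm (mem_extChartAt_source b) hs
    (mfderiv (𝓡 k) (𝓡 k) ψ b (u 0)) (mfderiv (𝓡 k) (𝓡 k) ψ b (u 1))).2
  rw [hu, hu] at h1
  refine h1.symm.trans ?_
  rw [he.fderiv_eq]
  refine sub_eq_zero.2 ?_
  exact (hF.isSymmSndFDerivAt (by
    rw [minSmoothness_of_isRCLikeNormedField]; exact WithTop.coe_le_coe.2 le_top)) _ _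

/-- A closed `1`-form is locally exact. -/
theorem exists_diffl_eq
    (hα : ∀ᶠ c in nhds b, DiffForm.SmoothAt (oneForm α) c ∧ DiffForm.d (oneForm α) c = 0) :
    ∃ f : B → ℝ, ∀ᶠ c in nhds b, ContMDiffAt (𝓡 k) 𝓘(ℝ, ℝ) ∞ f c ∧ diffl f c = α c := by
  set ψ := extChartAt (𝓡 k) b
  have hev : ∀ᶠ y in nhds (ψ b), y ∈ ψ.target ∧
      DiffForm.SmoothAt (oneForm α) (ψ.symm y) ∧ DiffForm.d (oneForm α) (ψ.symm y) = 0 := by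
    refine Filter.Eventually.and ((isOpen_extChartAt_target b).mem_nhds (mem_extChartAt_target b)) ?_
    rw [← extChartAt_to_inv (I := 𝓡 k) b] at hα
    exact (continuousAt_extChartAt_symm (I := 𝓡 k) b).eventually hα
  obtain ⟨ε, hε, hball⟩ := Metric.eventually_nhds_iff_ball.1 hev
  have hsm : ∀ y ∈ Metric.ball (ψ b) ε, ContDiffAt ℝ ∞ (covPull ψ.symm α) y := fun y hy =>
    contDiffAt_covPull (eventually_contMDiffAt_extChartAt_symm (hball y hy).1) (hball y hy).2.1
  -- On a ball of the chart, closedness is the symmetry of the derivative of the coefficients, which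
  -- yields a primitive; its smoothness follows since its derivative is smooth.
  obtain ⟨g, hg⟩ := (convex_ball (ψ b) ε).exists_forall_hasFDerivAt_of_fderiv_symmetric
    Metric.isOpen_ball
    (fun y hy => ((hsm y hy).differentiableAt (by simp)).differentiableWithinAt) (by
      intro y hy v w
      rw [← sub_eq_zero, d_oneForm_pull (eventually_contMDiffAt_extChartAt_symm (hball y hy).1)
        (hball y hy).2.1, (hball y hy).2.2]
      rfl)
  have hgs : ∀ y ∈ Metric.ball (ψ b) ε, ContDiffAt ℝ ∞ g y := by
    have h1 : ContDiffOn ℝ ∞ g (Metric.ball (ψ b) ε) := by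
      rw [contDiffOn_infty_iff_fderiv_of_isOpen Metric.isOpen_ball]
      refine ⟨fun y hy => (hg y hy).differentiableAt.differentiableWithinAt, ?_⟩
      refine ContDiffOn.congr (f := covPull ψ.symm α)
        (fun y hy => (hsm y hy).contDiffWithinAt) fun y hy => (hg y hy).fderiv
    exact fun y hy => h1.contDiffAt (Metric.isOpen_ball.mem_nhds hy)
  refine ⟨fun c => g (ψ c), ?_⟩
  have hsrc : ∀ᶠ c in nhds b, c ∈ ψ.source :=
    (isOpen_extChartAt_source (I := 𝓡 k) b).mem_nhds (mem_extChartAt_source b)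
  filter_upwards [hsrc, (continuousAt_extChartAt (I := 𝓡 k) b).eventually
    (Metric.ball_mem_nhds _ hε)] with c h1 h2
  have h3 := contMDiffAt_extChartAt_of_mem h1
  refine ⟨(hgs _ h2).contMDiffAt.comp c h3, ?_⟩
  have h4 := mfderiv_comp c ((hgs _ h2).contMDiffAt.mdifferentiableAt (by simp))
    (h3.mdifferentiableAt (by simp))
  rw [mfderiv_eq_fderiv, (hg _ h2).fderiv, covPull_extChartAt_symm h1] at h4
  exact h4.trans (covecCoord_comp h1 (α c))

end Poincare


/-! ### Descent of morphisms along locally surjective maps of sheaves of groups. -/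

section SheafDescent

variable {X : TopCat.{u}} {F G H : TopCat.Sheaf GrpCat.{u} X}

/-- Every section of `G` is locally in the image of `p`. -/
def LocallyOnto (p : F ⟶ G) : Prop :=
  ∀ (U : Opens X) (t : G.presheaf.obj (op U)), ∀ x ∈ U, ∃ (V : Opens X) (i : V ⟶ U)
    (s : F.presheaf.obj (op V)), x ∈ V ∧ (p.hom.app (op V)).hom s = (G.presheaf.map i.op).hom t

theorem LocallyOnto.isLocallySurjective {p : F ⟶ G} (h : LocallyOnto p) :
    TopCat.Presheaf.IsLocallySurjective p.hom :=
  ⟨fun {U} t x hx => by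
    obtain ⟨V, i, s, hxV, hs⟩ := h U t x hx
    exact ⟨V, i, ⟨s, hs⟩, hxV⟩⟩

theorem map_map_apply (F : TopCat.Sheaf GrpCat.{u} X) {U V W : Opens X} (i : V ⟶ U) (j : W ⟶ V)
    (s : F.presheaf.obj (op U)) : (F.presheaf.map j.op).hom ((F.presheaf.map i.op).hom s)
      = (F.presheaf.map (j ≫ i).op).hom s := by
  rw [op_comp, F.presheaf.map_comp]
  rfl

theorem naturality_map (p : F ⟶ G) {U V : Opens X} (i : V ⟶ U) (s : F.presheaf.obj (op U)) :
    (p.hom.app (op V)).hom ((F.presheaf.map i.op).hom s)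
      = (G.presheaf.map i.op).hom ((p.hom.app (op U)).hom s) :=
  congrArg (fun f => GrpCat.Hom.hom f s) (p.hom.naturality i.op)

theorem LocallyOnto.comp {p : F ⟶ G} {q : G ⟶ H} (hp : LocallyOnto p) (hq : LocallyOnto q) :
    LocallyOnto (p ≫ q) := by
  intro U t x hx
  obtain ⟨V, i, s, hxV, hs⟩ := hq U t x hx
  obtain ⟨W, j, r, hxW, hr⟩ := hp V s x hxV
  refine ⟨W, j ≫ i, r, hxW, ?_⟩
  refine (congrArg (q.hom.app (op W)).hom hr).trans ?_
  rw [naturality_map, hs, map_map_apply]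

theorem section_ext (G : TopCat.Sheaf GrpCat.{u} X) {U : Opens X} {t t' : G.presheaf.obj (op U)}
    (h : ∀ x ∈ U, ∃ (V : Opens X) (i : V ⟶ U), x ∈ V ∧
      (G.presheaf.map i.op).hom t = (G.presheaf.map i.op).hom t') : t = t' := by
  choose V i hV hi using h
  refine G.eq_of_locally_eq' (fun x : U => V x x.2) U (fun x => i x x.2) ?_ t t' fun x => hi x x.2
  exact fun x hx => Opens.mem_iSup.2 ⟨⟨x, hx⟩, hV x hx⟩

theorem hom_ext_of_locallyOnto {p : F ⟶ G} (hp : LocallyOnto p) {Φ Ψ : G ⟶ H}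
    (h : p ≫ Φ = p ≫ Ψ) : Φ = Ψ := by
  apply CategoryTheory.Sheaf.hom_ext
  ext U t
  refine section_ext H fun x hx => ?_
  obtain ⟨V, i, s, hxV, hs⟩ := hp U.unop t x hx
  refine ⟨V, i, hxV, ?_⟩
  refine (naturality_map Φ i t).symm.trans (Eq.trans ?_ (naturality_map Ψ i t))
  rw [← hs]
  exact congrArg (fun f : F ⟶ H => (f.hom.app (op V)).hom s) h

/-- A section of `G` is lifted locally through `p` and sent on by `q`. Two lifts differ by the
kernel of `p`, which `q` kills, so the images agree on overlaps and glue. -/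
theorem exists_desc {p : F ⟶ G} {q : F ⟶ H} (hp : LocallyOnto p)
    (hker : ∀ (U : Opens X) (s : F.presheaf.obj (op U)), (p.hom.app (op U)).hom s = 1 →
      (q.hom.app (op U)).hom s = 1) : ∃ Φ : G ⟶ H, p ≫ Φ = q := by
  have hker' : ∀ (U : Opens X) (s s' : F.presheaf.obj (op U)),
      (p.hom.app (op U)).hom s = (p.hom.app (op U)).hom s' →
      (q.hom.app (op U)).hom s = (q.hom.app (op U)).hom s' := by
    intro U s s' h
    rw [← div_eq_one, ← map_div] at h ⊢
    exact hker U _ h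
  -- The glued section is specified on every local lift, not just on a chosen cover;
  -- multiplicativity and naturality then become local checks.
  have hex : ∀ (U : Opens X) (t : G.presheaf.obj (op U)), ∃ h : H.presheaf.obj (op U),
      ∀ (V : Opens X) (i : V ⟶ U) (s : F.presheaf.obj (op V)),
        (p.hom.app (op V)).hom s = (G.presheaf.map i.op).hom t →
        (H.presheaf.map i.op).hom h = (q.hom.app (op V)).hom s := by
    intro U t
    -- The index set consists of all local lifts of `t`, so that no lift has to be chosen.
    let ι : Type u := Σ (V : Opens X), { s : F.presheaf.obj (op V) //
      ∃ i : V ⟶ U, (p.hom.app (op V)).hom s = (G.presheaf.map i.op).hom t }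
    have hU : U ≤ iSup fun i : ι => i.1 := by
      intro x hx
      obtain ⟨V, i, s, hxV, hs⟩ := hp U t x hx
      exact Opens.mem_iSup.2 ⟨⟨V, s, i, hs⟩, hxV⟩
    obtain ⟨h, hh, -⟩ := H.existsUnique_gluing' (fun i : ι => i.1) U (fun i => i.2.2.choose) hU
      (fun i => (q.hom.app (op i.1)).hom i.2.1) (by
        intro i j
        refine (naturality_map q _ _).symm.trans (Eq.trans ?_ (naturality_map q _ _))
        refine hker' _ _ _ ?_
        rw [naturality_map, naturality_map, i.2.2.choose_spec, j.2.2.choose_spec, map_map_apply,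
          map_map_apply]
        rfl)
    refine ⟨h, fun V i s hs => ?_⟩
    have h1 := hh ⟨V, ⟨s, i, hs⟩⟩
    rw [Subsingleton.elim (Exists.choose _) i] at h1
    exact h1
  choose Φ hΦ using hex
  let Φ' : ∀ U : Opens X, G.presheaf.obj (op U) →* H.presheaf.obj (op U) := fun U =>
    MonoidHom.mk' (Φ U) fun t t' => by
      refine section_ext H fun x hx => ?_
      obtain ⟨V, i, s, hxV, hs⟩ := hp U t x hx
      obtain ⟨V', i', s', hxV', hs'⟩ := hp V ((G.presheaf.map i.op).hom t') x hxV
      refine ⟨V', i' ≫ i, hxV', ?_⟩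
      have h1 : (p.hom.app (op V')).hom ((F.presheaf.map i'.op).hom s)
          = (G.presheaf.map (i' ≫ i).op).hom t := by
        rw [naturality_map, hs, map_map_apply]
      rw [map_map_apply] at hs'
      rw [map_mul, hΦ U t V' _ _ h1, hΦ U t' V' _ _ hs', ← map_mul]
      refine hΦ U (t * t') V' _ _ ?_
      rw [map_mul, map_mul, h1, hs']
  refine ⟨⟨{ app := fun U => GrpCat.ofHom (Φ' U.unop), naturality := ?_ }⟩, ?_⟩
  · intro U V i
    ext t
    refine section_ext H fun x hx => ?_
    obtain ⟨W, j, s, hxW, hs⟩ := hp V.unop ((G.presheaf.map i).hom t) x hx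
    refine ⟨W, j, hxW, ?_⟩
    refine (hΦ V.unop _ W j s hs).trans ?_
    have hs' : (p.hom.app (op W)).hom s = (G.presheaf.map (j ≫ i.unop).op).hom t :=
      hs.trans (map_map_apply G i.unop j t)
    exact ((map_map_apply H i.unop j _).trans (hΦ U.unop t W _ s hs')).symm
  · apply CategoryTheory.Sheaf.hom_ext
    ext U s
    have h1 := hΦ U.unop ((p.hom.app U).hom s) U.unop (𝟙 _) s (by
      rw [op_id, G.presheaf.map_id]; rfl)
    rw [op_id, H.presheaf.map_id] at h1
    exact h1

/-- Two locally surjective maps of sheaves of groups with the same kernel have isomorphic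
targets. -/
theorem exists_iso_of_ker_eq {p : F ⟶ G} {q : F ⟶ H} (hp : LocallyOnto p) (hq : LocallyOnto q)
    (hker : ∀ (U : Opens X) (s : F.presheaf.obj (op U)), (p.hom.app (op U)).hom s = 1 ↔
      (q.hom.app (op U)).hom s = 1) : ∃ Φ : G ≅ H, p ≫ Φ.hom = q := by
  obtain ⟨Φ, hΦ⟩ := exists_desc hp fun U s => (hker U s).1
  obtain ⟨Ψ, hΨ⟩ := exists_desc hq fun U s => (hker U s).2
  refine ⟨⟨Φ, Ψ, hom_ext_of_locallyOnto hp ?_, hom_ext_of_locallyOnto hq ?_⟩, hΦ⟩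
  · rw [← Category.assoc, hΦ, hΨ, Category.comp_id]
  · rw [← Category.assoc, hΨ, hΦ, Category.comp_id]

end SheafDescent

/-! ### The projection onto the quotient sheaf and its kernel. -/

section QuotientSheaf

variable {k : ℕ} {B : Type u} [TopologicalSpace B] [ChartedSpace (EuclideanSpace ℝ (Fin k)) B]
  (Λ : BivectorField k B) (P : ∀ b : B, AddSubgroup (Covec k b))

theorem locallyOnto_toKSheaf : LocallyOnto (asGroupsMap (toKSheaf Λ P)) := by
  intro U t x hx
  have h1 : CategoryTheory.Presheaf.IsLocallySurjective (Opens.grothendieckTopology (TopCat.of B))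
      (toSheafify (Opens.grothendieckTopology (TopCat.of B)) (quotientPresheaf Λ P)) := inferInstance
  obtain ⟨V, i, ⟨s, hs⟩, hxV⟩ := h1.imageSieve_mem (U := U)
    (show ToType ((KSheaf Λ P).presheaf.obj (op U)) from Multiplicative.toAdd t) x hx
  obtain ⟨s, rfl⟩ := QuotientAddGroup.mk_surjective s
  exact ⟨V, i, Multiplicative.ofAdd s, hxV, congrArg Multiplicative.ofAdd hs⟩

/-- A section dies in the sheafification exactly when it is locally zero in the presheaf quotient,
that is, locally in `𝒫`. Since `𝒫` is itself a sheaf, the kernel does not grow. -/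
theorem toKSheaf_eq_one_iff (U : Opens B) (s : (Z1 Λ).carrier U) :
    (((asGroupsMap (toKSheaf Λ P)).hom.app (op U)).hom (Multiplicative.ofAdd s)) = 1 ↔
      s.1 ∈ (periodSections P).carrier U := by
  let J := Opens.grothendieckTopology (TopCat.of B)
  let q : (quotientPresheaf Λ P).obj (op U) := QuotientAddGroup.mk s
  let T : (quotientPresheaf Λ P).obj (op U) → ToType ((KSheaf Λ P).presheaf.obj (op U)) :=
    fun x => ((toSheafify J (quotientPresheaf Λ P)).app (op U)).hom x
  have hT : T 0 = 0 := map_zero ((toSheafify J (quotientPresheaf Λ P)).app (op U)).hom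
  constructor
  · intro h
    have h0 : T q = T 0 := (congrArg Multiplicative.toAdd h).trans hT.symm
    have hS := CategoryTheory.Presheaf.equalizerSieve_mem J (toSheafify J (quotientPresheaf Λ P))
      q 0 h0
    refine (periodSections P).local_mem s.1 fun b => ?_
    obtain ⟨V, i, hi, hbV⟩ := hS b b.2
    refine ⟨V, i.le, hbV, ?_⟩
    have h1 : (quotientPresheaf Λ P).map i.op q = (quotientPresheaf Λ P).map i.op 0 := hi
    rw [map_zero] at h1
    exact AddSubgroup.mem_addSubgroupOf.1 ((QuotientAddGroup.eq_zero_iff _).1 h1)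
  · intro h
    have h1 : q = 0 := (QuotientAddGroup.eq_zero_iff s).2 (AddSubgroup.mem_addSubgroupOf.2 h)
    exact congrArg Multiplicative.ofAdd ((congrArg T h1).trans hT)

end QuotientSheaf


/-! ### The differential and the inclusion as morphisms of sheaves on the base. -/

section BaseSheaves

variable {k : ℕ} {B : Type u} [TopologicalSpace B] [ChartedSpace (EuclideanSpace ℝ (Fin k)) B]
  {Λ : BivectorField k B} {P : ∀ b : B, AddSubgroup (Covec k b)} {U : Opens B} {b : B}

theorem eventually_eq_extend {A : B → Type} [∀ b, AddCommGroup (A b)] {U : Opens B}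
    (α : ∀ c : B, A c) (hb : b ∈ U) :
    ∀ᶠ c in nhds b, α c = extend (fun c : U => α c) c := by
  filter_upwards [U.2.mem_nhds hb] with c hc
  exact (extend_apply (fun c : U => α c) ⟨c, hc⟩).symm

theorem conormalNear_extend {s : ∀ b : U, Covec k (b : B)} (hs : s ∈ (Z1 Λ).carrier U)
    (hb : b ∈ U) : ConormalNear Λ (extend s) b := by
  filter_upwards [U.2.mem_nhds hb] with c hc
  exact ⟨(hs ⟨c, hc⟩).1, (hs ⟨c, hc⟩).2.1⟩

theorem extend_dSection (f : ∀ _ : U, ℝ) (hb : b ∈ U) :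
    ∀ᶠ c in nhds b, diffl (extend (A := fun _ : B => ℝ) f) c
      = extend (A := fun c : B => Covec k c) (dSection f) c :=
  eventually_eq_extend (A := fun c : B => Covec k c) (diffl (extend (A := fun _ : B => ℝ) f)) hb

variable [IsManifold (𝓡 k) ∞ B]

theorem dSection_mem_Z1
    (hΛ : ∀ b : B, ContDiffAt ℝ ∞ (BivectorField.inChart Λ b) (extChartAt (𝓡 k) b b))
    {f : ∀ _ : U, ℝ} (hf : f ∈ (Omega0 Λ).carrier U) : dSection f ∈ (Z1 Λ).carrier U := by
  rintro ⟨b, hb⟩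
  have h1 : ∀ᶠ c in nhds b, ContMDiffAt (𝓡 k) 𝓘(ℝ, ℝ) ∞ (extend (A := fun _ : B => ℝ) f) c := by
    filter_upwards [U.2.mem_nhds hb] with c hc
    exact hf.1 ⟨c, hc⟩
  have h2 := smoothAt_diffl h1
  have he := extend_dSection (k := k) f hb
  refine ⟨smoothAt_congr he h2.1, ?_, (d_congr he).symm.trans h2.2⟩
  have h3 : diffl (k := k) (extend (A := fun _ : B => ℝ) f) b ∈ conormal Λ b := by
    refine diffl_mem_conormal (hΛ b) hb (h1.self_of_nhds.mdifferentiableAt (by simp)) ?_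
    intro x hx y hy hxy
    rw [extend_apply (A := fun _ : B => ℝ) f ⟨x, hx⟩, extend_apply (A := fun _ : B => ℝ) f ⟨y, hy⟩]
    exact hf.2 ⟨x, hx⟩ ⟨y, hy⟩ hxy
  exact he.self_of_nhds ▸ h3

omit [IsManifold (𝓡 k) ∞ B] in
theorem mem_Omega0_of_dSection_mem {f : ∀ _ : U, ℝ} (hf : f ∈ (smoothFunctions k B).carrier U)
    (h : ∀ b : U, dSection (k := k) f b ∈ conormal Λ b) : f ∈ (Omega0 Λ).carrier U := by
  refine ⟨hf, fun x y hxy => ?_⟩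
  rw [← extend_apply (A := fun _ : B => ℝ) f x, ← extend_apply (A := fun _ : B => ℝ) f y]
  exact eq_of_mem_leaf (fun c hc => (hf ⟨c, hc⟩).mdifferentiableAt (by simp))
    (fun c hc => h ⟨c, hc⟩) hxy

/-- The exterior differential `Ω⁰_F → Z¹_F`. -/
noncomputable def differential (hΛ : IsRegularTwistedPoisson Λ) :
    (Omega0 Λ).sheaf ⟶ (Z1 Λ).sheaf :=
  ⟨{ app := fun U => AddCommGrpCat.ofHom
        { toFun := fun f : (Omega0 Λ).carrier U.unop => (⟨dSection f.1,
            dSection_mem_Z1 hΛ.smooth f.2⟩ : (Z1 Λ).carrier U.unop)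
          map_zero' := Subtype.ext dSection_zero
          map_add' := fun f g => Subtype.ext (dSection_add f.2.1 g.2.1) }
     naturality := fun U V i => by
        ext f
        exact Subtype.ext (dSection_res i.unop.le _) }⟩

/-- A local primitive of a closed conormal form has conormal differential, hence is constant on the
leaves of the smaller open set. -/
theorem locallyOnto_differential (hΛ : IsRegularTwistedPoisson Λ) :
    LocallyOnto (asGroupsMap (differential hΛ)) := by
  intro U t b hb
  let α : (Z1 Λ).carrier U := Multiplicative.toAdd t
  obtain ⟨f, hf⟩ := exists_diffl_eq (α := extend α.1) (b := b) (by
    filter_upwards [U.2.mem_nhds hb] with c hc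
    exact ⟨(α.2 ⟨c, hc⟩).1, (α.2 ⟨c, hc⟩).2.2⟩)
  obtain ⟨V, hV, hVo, hbV⟩ := eventually_nhds_iff.1 (hf.and (U.2.mem_nhds hb))
  let V' : Opens B := ⟨V, hVo⟩
  have hle : V' ≤ U := fun c hc => (hV c hc).2
  let g : ∀ _ : V', ℝ := fun c => f c
  have hg : ∀ c ∈ V', f =ᶠ[nhds c] extend (A := fun _ : B => ℝ) g := fun c hc =>
    eventually_eq_extend (A := fun _ : B => ℝ) f hc
  have hd : dSection g = res hle α.1 := by
    funext c
    refine ((hg c c.2).mfderiv_eq).symm.trans ((hV c c.2).1.2.trans ?_)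
    exact extend_apply α.1 ⟨c, hle c.2⟩
  have hg0 : g ∈ (Omega0 Λ).carrier V' := by
    refine mem_Omega0_of_dSection_mem (fun c => ?_) fun c => ?_
    · exact (hV c c.2).1.1.congr_of_eventuallyEq (hg c c.2).symm
    · rw [hd]
      have h1 := (α.2 ⟨c, hle c.2⟩).2.1
      rw [extend_apply α.1 ⟨c, hle c.2⟩] at h1
      exact h1
  exact ⟨V', homOfLE hle, Multiplicative.ofAdd (⟨g, hg0⟩ : (Omega0 Λ).carrier V'), hbV,
    congrArg Multiplicative.ofAdd (Subtype.ext hd)⟩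

omit [IsManifold (𝓡 k) ∞ B] in
theorem structureSheaf_le (hP : ∀ b, P b ≤ conormal Λ b) :
    (structureSheaf P).carrier U ≤ (Omega0 Λ).carrier U := fun f hf =>
  mem_Omega0_of_dSection_mem hf.1 fun b => hP b (extend_apply (A := fun c : B => Covec k c)
    (dSection f) b ▸ (hf.2 b).2)

/-- The inclusion `O_P → Ω⁰_F`. -/
def inclusion (hP : ∀ b, P b ≤ conormal Λ b) : (structureSheaf P).sheaf ⟶ (Omega0 Λ).sheaf :=
  ⟨{ app := fun _ => AddCommGrpCat.ofHom (AddSubgroup.inclusion (structureSheaf_le hP))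
     naturality := fun _ _ _ => rfl }⟩

end BaseSheaves

/-! ### The time-one flow as a morphism of sheaves. -/

section Flow

variable {k d : ℕ} {B M : Type u}
  [TopologicalSpace B] [ChartedSpace (EuclideanSpace ℝ (Fin k)) B]
  [TopologicalSpace M] [ChartedSpace (EuclideanSpace ℝ (Fin d)) M]
  {Λ : BivectorField k B} {P : ∀ b : B, AddSubgroup (Covec k b)}
  {π : C^∞⟮𝓡 d, M; 𝓡 k, B⟯} {σ : DiffForm d M 2} {η : DiffForm k B 3} {U : Opens B}
  [IsManifold (𝓡 k) ∞ B] [IsManifold (𝓡 d) ∞ M] [T2Space M]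

/-- The period condition quantifies over all fields with a given value at `b`; the flow on that
fibre sees only this value, so one field is enough. -/
theorem mem_period_iff (hR : IsASCIR Λ π σ η)
    (hΛ : ∀ (b : B) (α β : Covec k b), β (Λ b α) = - α (Λ b β)) (hP : IsPeriodBundle Λ π σ P)
    {α : ∀ b : B, Covec k b} {b : B} (hα : α b ∈ conormal Λ b) :
    α b ∈ P b ↔ ∀ m, π m = b → act π σ α m = m := by
  constructor
  · rintro h m rfl
    exact act_eq hR hΛ hα (((hP _ _).1 h).2 α rfl m rfl)
  · intro h
    refine (hP _ _).2 ⟨hα, ?_⟩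
    rintro β hβ m rfl
    have hβ' : β (π m) ∈ conormal Λ (π m) := hβ ▸ hα
    exact (flowsTo_iff_act hR hΛ hβ').2 ((act_congr hR hΛ hβ' hβ).trans (h m rfl))

/-- A smooth section of `P` flows by the identity, so `σ = σ + π^*dα` and `dα = 0` because `π` is a
submersion. -/
theorem periodSections_le (hR : IsASCIR Λ π σ η)
    (hΛ : ∀ (b : B) (α β : Covec k b), β (Λ b α) = - α (Λ b β)) (hP : IsPeriodBundle Λ π σ P)
    (U : Opens B) : (periodSections P).carrier U ≤ (Z1 Λ).carrier U := by
  rintro s hs ⟨b, hb⟩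
  have hs' : ∀ c ∈ U, extend s c ∈ conormal Λ c := fun c hc => ((hP _ _).1 (hs ⟨c, hc⟩).2).1
  refine ⟨(hs ⟨b, hb⟩).1, hs' b hb, ?_⟩
  obtain ⟨m, rfl⟩ := hR.surjective b
  have hn : ConormalNear Λ (extend s) (π m) := by
    filter_upwards [U.2.mem_nhds hb] with c hc
    exact ⟨(hs ⟨c, hc⟩).1, hs' c hc⟩
  have hid : id =ᶠ[nhds m] act π σ (extend s) := by
    filter_upwards [(pre π U).2.mem_nhds hb] with m' hm'
    exact ((mem_period_iff hR hΛ hP (hs' _ hm')).1 (hs ⟨_, hm'⟩).2 m' rfl).symm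
  have h1 := (shiftsForm_act hR hΛ hn).congr hid
  refine d_oneForm_eq_zero hR fun v w => ?_
  have h2 := h1.pullback v w
  rw [mfderiv_id] at h2
  exact left_eq_add.1 h2

/-- The time-one flow of `σ♯ (π^* α)` over `U`. -/
noncomputable def flowPerm (hR : IsASCIR Λ π σ η)
    (hΛ : ∀ (b : B) (α β : Covec k b), β (Λ b α) = - α (Λ b β)) (α : (Z1 Λ).carrier U) :
    Equiv.Perm (pre π U) :=
  have hα : ∀ m : pre π U, extend α.1 (π m) ∈ conormal Λ (π m) := fun m => (α.2 ⟨_, m.2⟩).2.1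
  have hn : ∀ m : pre π U, extend (-α.1) (π m) ∈ conormal Λ (π m) := fun m =>
    ((-α).2 ⟨_, m.2⟩).2.1
  { toFun := fun m => ⟨act π σ (extend α.1) m, (congrArg (· ∈ U) (proj_act hR hΛ (hα m))).mpr m.2⟩
    invFun := fun m => ⟨act π σ (extend (-α.1)) m,
      (congrArg (· ∈ U) (proj_act hR hΛ (hn m))).mpr m.2⟩
    left_inv := fun m => Subtype.ext (by
      refine (act_add hR hΛ (hn m) (hα m)).symm.trans ?_
      rw [← extend_add, neg_add_cancel, extend_zero]
      exact act_zero hR hΛ _)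
    right_inv := fun m => Subtype.ext (by
      refine (act_add hR hΛ (hα m) (hn m)).symm.trans ?_
      rw [← extend_add, add_neg_cancel, extend_zero]
      exact act_zero hR hΛ _) }

theorem flowPerm_add (hR : IsASCIR Λ π σ η)
    (hΛ : ∀ (b : B) (α β : Covec k b), β (Λ b α) = - α (Λ b β)) (α β : (Z1 Λ).carrier U) :
    flowPerm hR hΛ (α + β) = flowPerm hR hΛ α * flowPerm hR hΛ β := by
  refine Equiv.ext fun m => Subtype.ext ?_
  refine (congrArg (fun γ => act π σ γ m) (extend_add α.1 β.1)).trans ?_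
  exact act_add hR hΛ (α.2 ⟨_, m.2⟩).2.1 (β.2 ⟨_, m.2⟩).2.1

theorem isAutMap_flowPerm (hR : IsASCIR Λ π σ η)
    (hΛ : ∀ (b : B) (α β : Covec k b), β (Λ b α) = - α (Λ b β)) (α : (Z1 Λ).carrier U) :
    IsAutMap π σ (flowPerm hR hΛ α) := by
  have h : ∀ m ∈ pre π U, ShiftsForm π σ (extendPerm (flowPerm hR hΛ α)) (extend α.1) m := by
    intro m hm
    refine (shiftsForm_act hR hΛ (conormalNear_extend α.2 hm)).congr ?_
    filter_upwards [(pre π U).2.mem_nhds hm] with m' hm'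
    exact extendPerm_coe (flowPerm hR hΛ α) ⟨m', hm'⟩
  refine ⟨fun m hm => (h m hm).smooth.contMDiffWithinAt, fun m => ?_, fun m hm => ?_⟩
  · exact proj_act hR hΛ (α.2 ⟨_, m.2⟩).2.1
  · ext v
    have h1 := (h m hm).pullback (v 0) (v 1)
    rw [(α.2 ⟨_, hm⟩).2.2] at h1
    have h2 : ∀ {E : Type} (f : E → EuclideanSpace ℝ (Fin d)) (v : Fin 2 → E),
        (fun i => f (v i)) = ![f (v 0), f (v 1)] := fun f v => by
      funext i; fin_cases i <;> rfl
    refine (congrArg (σ (extendPerm (flowPerm hR hΛ α) m)) (h2 _ v)).trans (h1.trans ?_)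
    refine (add_zero _).trans ?_
    exact congrArg (σ m) (h2 id v).symm

theorem flowPerm_mem (hR : IsASCIR Λ π σ η)
    (hΛ : ∀ (b : B) (α β : Covec k b), β (Λ b α) = - α (Λ b β)) (α : (Z1 Λ).carrier U) :
    flowPerm hR hΛ α ∈ autGroup π σ U := by
  refine ⟨isAutMap_flowPerm hR hΛ α, ?_⟩
  have h : (flowPerm hR hΛ α)⁻¹ = flowPerm hR hΛ (-α) := Equiv.ext fun _ => rfl
  exact h ▸ isAutMap_flowPerm hR hΛ (-α)

/-- The time-one flow `φ : Z¹_F → Aut`. -/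
noncomputable def timeOneFlow (hR : IsASCIR Λ π σ η)
    (hΛ : ∀ (b : B) (α β : Covec k b), β (Λ b α) = - α (Λ b β)) :
    asGroups (Z1 Λ).sheaf ⟶ autSheaf π σ :=
  ⟨{ app := fun U => GrpCat.ofHom (MonoidHom.mk'
        (fun α : Multiplicative ((Z1 Λ).carrier U.unop) =>
          (⟨flowPerm hR hΛ α.toAdd, flowPerm_mem hR hΛ α.toAdd⟩ : autGroup π σ U.unop))
        fun α β => Subtype.ext (flowPerm_add hR hΛ α.toAdd β.toAdd))
     naturality := fun U V i => by
        ext α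
        refine Subtype.ext (Equiv.ext fun m => Subtype.ext ?_)
        let a : (Z1 Λ).carrier U.unop := Multiplicative.toAdd α
        -- Restriction commutes with the flow because the flow through a point depends only on the
        -- covector at its projection.
        refine act_congr hR hΛ (α := extend (res i.unop.le a.1)) (β := extend a.1)
          ((⟨_, (Z1 Λ).res_mem i.unop.le a.1 a.2⟩ : (Z1 Λ).carrier V.unop).2 ⟨_, m.2⟩).2.1 ?_
        exact (extend_res i.unop.le a.1 m.2).self_of_nhds }⟩

theorem timeOneFlow_eq_one_iff (hR : IsASCIR Λ π σ η)
    (hΛ : ∀ (b : B) (α β : Covec k b), β (Λ b α) = - α (Λ b β)) (hP : IsPeriodBundle Λ π σ P)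
    (U : Opens B) (s : (Z1 Λ).carrier U) :
    ((timeOneFlow hR hΛ).hom.app (op U)).hom (Multiplicative.ofAdd s) = 1 ↔
      s.1 ∈ (periodSections P).carrier U := by
  constructor
  · intro h b
    refine ⟨(s.2 b).1, (mem_period_iff hR hΛ hP (s.2 b).2.1).2 fun m hm => ?_⟩
    have hm' : m ∈ pre π U := (congrArg (· ∈ U) hm).mpr b.2
    exact congrArg Subtype.val (Equiv.congr_fun (congrArg Subtype.val h) ⟨m, hm'⟩)
  · intro h
    refine Subtype.ext (Equiv.ext fun m => Subtype.ext ?_)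
    exact (mem_period_iff hR hΛ hP (s.2 ⟨_, m.2⟩).2.1).1 (h ⟨_, m.2⟩).2 m rfl

omit [IsManifold (𝓡 k) ∞ B] [IsManifold (𝓡 d) ∞ M] [T2Space M] in
theorem isSymmetry_extendPerm {f : Equiv.Perm (pre π U)} (hf : IsAutMap π σ f) :
    IsSymmetry π σ U (extendPerm f) where
  smooth := fun m hm => hf.smooth.contMDiffAt ((pre π U).2.mem_nhds hm)
  proj := fun m hm => (congrArg π (extendPerm_coe f ⟨m, hm⟩)).trans (hf.proj ⟨m, hm⟩)
  preserves := fun m hm v w => by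
    refine Eq.trans ?_ (congrArg (fun τ : EuclideanSpace ℝ (Fin d) [⋀^Fin 2]→L[ℝ] ℝ => τ ![v, w])
      (hf.preserves m hm))
    refine congrArg (σ (extendPerm f m)) ?_
    funext i; fin_cases i <;> rfl

theorem locallyOnto_timeOneFlow (hR : IsASCIR Λ π σ η)
    (hΛ : ∀ (b : B) (α β : Covec k b), β (Λ b α) = - α (Λ b β)) :
    LocallyOnto (timeOneFlow hR hΛ) := by
  intro U t b hb
  let f : autGroup π σ U := t
  obtain ⟨α, hα⟩ := (isSymmetry_extendPerm f.2.1).exists_eq_act hR hΛ hb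
  obtain ⟨V, hV, hVo, hbV⟩ := eventually_nhds_iff.1 (hα.and (U.2.mem_nhds hb))
  let V' : Opens B := ⟨V, hVo⟩
  have hle : V' ≤ U := fun c hc => (hV c hc).2
  let s : ∀ c : V', Covec k (c : B) := fun c => α c
  have he : ∀ c ∈ V', ∀ᶠ c' in nhds c, α c' = extend s c' := fun c hc =>
    eventually_eq_extend α hc
  have hs : s ∈ (Z1 Λ).carrier V' := fun c =>
    ⟨smoothAt_congr (he c c.2) (hV c c.2).1.1.smoothAt,
      (he c c.2).self_of_nhds ▸ (hV c c.2).1.1.mem, (d_congr (he c c.2)).symm.trans (hV c c.2).1.2.1⟩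
  refine ⟨V', homOfLE hle, Multiplicative.ofAdd (⟨s, hs⟩ : (Z1 Λ).carrier V'), hbV,
    Subtype.ext (Equiv.ext fun m => Subtype.ext ?_)⟩
  refine Eq.trans ?_ (((hV (π m) m.2).1.2.2 m rfl).symm.trans
    (extendPerm_coe f.1 ⟨m, hle m.2⟩))
  exact act_congr hR hΛ (hs ⟨_, m.2⟩).2.1 (he _ m.2).self_of_nhds.symm

end Flow

end ASCIR

theorem mainTheorem5 {k d : ℕ} {B M : Type u}
    [TopologicalSpace B] [T2Space B] [SecondCountableTopology B]
    [ChartedSpace (EuclideanSpace ℝ (Fin k)) B] [IsManifold (𝓡 k) ∞ B]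
    [TopologicalSpace M] [T2Space M] [SecondCountableTopology M]
    [ChartedSpace (EuclideanSpace ℝ (Fin d)) M] [IsManifold (𝓡 d) ∞ M]
    (Λ : ASCIR.BivectorField k B) (hΛ : ASCIR.IsRegularTwistedPoisson Λ)
    (P : ∀ b : B, AddSubgroup (ASCIR.Covec k b))
    (Θ : ASCIR.DiffForm k B 2) (hΘ : ASCIR.IsCharacteristicForm Λ Θ)
    (π : C^∞⟮𝓡 d, M; 𝓡 k, B⟯) (σ : ASCIR.DiffForm d M 2)
    (hM : ASCIR.IsASCIR0 Λ P Θ π σ) :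
    (∀ U : Opens B, (ASCIR.periodSections P).carrier U ≤ (ASCIR.Z1 Λ).carrier U) ∧
    ∃ (ι : (ASCIR.structureSheaf P).sheaf ⟶ (ASCIR.Omega0 Λ).sheaf)
      (δ : (ASCIR.Omega0 Λ).sheaf ⟶ (ASCIR.Z1 Λ).sheaf)
      (φ : ASCIR.asGroups (ASCIR.Z1 Λ).sheaf ⟶ ASCIR.autSheaf π σ),
      ASCIR.IsInclusion ι ∧ ASCIR.IsDifferential δ ∧ ASCIR.IsTimeOneFlow φ ∧
      ASCIR.IsShortExact (ASCIR.asGroupsMap ι) (ASCIR.asGroupsMap δ ≫ φ) ∧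
      ∃ Φ : ASCIR.asGroups (ASCIR.KSheaf Λ P) ≅ ASCIR.autSheaf π σ,
        ASCIR.asGroupsMap (ASCIR.toKSheaf Λ P) ≫ Φ.hom = φ := by
  have hR := hM.isASCIR
  have hs := hΛ.skew
  have hP : ∀ b, P b ≤ ASCIR.conormal Λ b := fun b a ha => ((hM.period b a).1 ha).1
  have hδ := ASCIR.locallyOnto_differential hΛ
  have hφ := ASCIR.locallyOnto_timeOneFlow hR hs
  have hker := ASCIR.timeOneFlow_eq_one_iff hR hs hM.period
  refine ⟨ASCIR.periodSections_le hR hs hM.period, ASCIR.inclusion hP, ASCIR.differential hΛ,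
    ASCIR.timeOneFlow hR hs, fun _ _ => rfl, fun _ _ => rfl,
    fun U α m => ASCIR.flowsTo_act hR hs (α.2 ⟨_, m.2⟩).2.1, ⟨fun U f g h => ?_, fun U f => ?_,
      (hδ.comp hφ).isLocallySurjective⟩, ?_⟩
  · exact AddSubgroup.inclusion_injective (ASCIR.structureSheaf_le hP) h
  · let f' : (ASCIR.Omega0 Λ).carrier U := Multiplicative.toAdd f
    -- The flow of `df` is trivial exactly when `df` is a section of `P`, the condition defining
    -- `O_P`.
    refine (hker U ⟨_, ASCIR.dSection_mem_Z1 hΛ.smooth f'.2⟩).trans ⟨fun h => ?_, ?_⟩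
    · exact ⟨Multiplicative.ofAdd (⟨f'.1, f'.2.1, h⟩ : (ASCIR.structureSheaf P).carrier U), rfl⟩
    · rintro ⟨r, hr⟩
      let r' : (ASCIR.structureSheaf P).carrier U := Multiplicative.toAdd r
      have h1 : r'.1 = f'.1 := congrArg Subtype.val (congrArg Multiplicative.toAdd hr)
      have h2 := r'.2.2
      rw [h1] at h2
      exact h2
  · exact ASCIR.exists_iso_of_ker_eq (ASCIR.locallyOnto_toKSheaf Λ P) hφ fun U s =>
      (ASCIR.toKSheaf_eq_one_iff Λ P U (Multiplicative.toAdd s)).trans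
        (hker U (Multiplicative.toAdd s)).symm
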